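/- **Setting.** An instance of *hypergraph orientation* consists of a finite hypergraph $H=(V,E)$ with nonempty hyperedges (a family of $m$ vertex sets, $n=|V|$), query costs $c_v\ge 0$, and for each vertex $v$ an atomless probability distribution $d_v$ on $\mathbb R$, where $I_v=(\ell_v,r_v)$ is the minimal bounded open interval containing its support ($\ell_v$ is the largest value with $\mathbb P[w_v\le \ell_v]=0$, $r_v$ the smallest with $\mathbb P[w_v\ge r_v]=0$). The precise weights $w_v\sim d_v$ are independent; querying $v$ reveals $w_v$. A set $Q\subseteq V$ is *feasible* for $w$ if for each hyperedge $F$ some $v\in F$ is a minimum-weight vertex of $F$ for all weights $w'$ with $w'_u=w_u$ for $u\in Q$ and $w'_u\in I_u$ for $u\notin Q$. Put $c(Q)=\sum_{v\in Q}c_v$, let $\mathrm{OPT}(w)$ be the minimum of $c(Q)$ over feasible $Q$, call $v$ *mandatory* if it lies in every feasible set, and let $p_v$ be the probability of that event. A vertex of $F$ with smallest left endpoint is called leftmost in $F$. The instance is *preprocessed*: if $v$ is leftmost in $F$ and $u\in F\setminus\{v\}$, then $I_u\not\subseteq I_v$. The *vertex cover instance* is the graph $\bar G=(V,\bar E)$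 in which distinct $u,v$ are adjacent iff some hyperedge contains both, one of them is leftmost in it, and $I_u\cap I_v\ne\emptyset$. **Machine.** Algorithms are programs of a real RAM without rounding (natural-number indices with $+$ and $-$, real $+,-,\times,\div$, comparisons, bounded loops), in which each assignment, test, loop pass, drawing of a fresh sample from some $d_v$, and query is one step. A program may also call a black box for weighted vertex cover; a call takes the running time of the black box on that input plus $n^2+1$ steps. The input consists of $n,m$, the incidence matrix of $H$, the numbers $\ell_v,r_v,c_v$, a threshold $d$ and a number $k$. **Theorem 3.2.** There are one program and one constant $C\in\mathbb N$ such that the following holds for every preprocessed instance, all real $\alpha\in[1,2]$, $\varepsilon>0$, $\delta\in(0,1)$, and every black box that on each weighted induced subgraph $\bar G[S]$, $S\subseteq V$ (weights $c$), returns a vertex cover contained in $S$ of weight at most $\alpha$ times the minimum. Let $$R=\tfrac12\Bigl(\alpha+\sqrt{\alpha^2+4(2-\alpha)\bigl(1+\alpha\varepsilon+(2-\alpha)\varepsilon^2\bigr)}+(4-2\alpha)\varepsilon\Bigr),\qquad d=\tfrac1R+\varepsilon,\qquad k=\Bigl\lceil \frac{\ln(2/\delta')}{2\varepsilon^2}\Bigr\rceil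 ,$$ where $(1-\delta')^n=1-\delta$ (for $n=0$, put $k=0$). Run the program with parameters $d$ and $k$. 1. *Modified Threshold algorithm.* For all samples and all weights $w$ with $w_v\in I_v$, the run has the following form, where the estimates $Y_v$ and the LP solution $x$ depend on the samples but not on $w$. Let $M=\{v: Y_v\ge d\}$; let $x$ be a half-integral optimal solution of the LP $\min\sum_v c_vx_v$ subject to $x_u+x_v\ge1$ for the edges $uv$ of $\bar G[V\setminus M]$ and $x\ge0$; and let $V_1$ and $V_{1/2}$ be the sets of $v\in V\setminus M$ with $x_v=1$ and $x_v=\frac12$. The black box is called exactly once, on $\bar G[V_{1/2}]$ with weights $c$, and returns $VC'$. First exactly the vertices of $M\cup V_1\cup VC'$ are queried, and afterwards only vertices that are mandatory for all realizations consistent with the weights revealed so far. 2. *Correctness.* On each such run the program outputs, for each hyperedge, a vertex that is certified by the queried set to be of minimum weight. 3. *Running time.* On each such run at most $n\cdot nk$ samples of single weights are drawn ($k$ realizations of the $n$ weights for each of the $n$ estimates), and the number of steps is at most $C\,(n+m+1)^C\,(k+1)$ plus the running time of the black box on $\bar G[V_{1/2}]$. 4. *Competitive ratio.* With probability at least $1-\delta$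 over the samples (independent of $w$), $|Y_v-p_v|\le\varepsilon$ for all $v$, and $$\mathbb E_w[\mathrm{ALG}]\le R\cdot\mathbb E_w[\mathrm{OPT}],$$ where $\mathrm{ALG}=c(\text{set of queried vertices})$ and both expectations, taken over $w$ for fixed samples, exist and are finite. -/

import Mathlib

open MeasureTheory

noncomputable section

namespace HypOrient

/-! ### Instances, feasible query sets, mandatory vertices -/

/-- An instance of hypergraph orientation with vertices `0, …, n-1` and hyperedges `0, …, m-1`.
The weight of `v` is drawn from the atomless probability distribution `law v`, and
`(lo v, hi v)` is the minimal interval that contains its support. -/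
structure Instance (n m : ℕ) where
  edge : Fin m → Finset (Fin n)
  edge_nonempty : ∀ j, (edge j).Nonempty
  cost : Fin n → ℝ
  cost_nonneg : ∀ v, 0 ≤ cost v
  law : Fin n → Measure ℝ
  law_prob : ∀ v, IsProbabilityMeasure (law v)
  law_noAtoms : ∀ v, NullSingletonClass (law v)
  lo : Fin n → ℝ
  hi : Fin n → ℝ
  lo_spec : ∀ v, IsGreatest {x | law v (Set.Iic x) = 0} (lo v)
  hi_spec : ∀ v, IsLeast {x | law v (Set.Ici x) = 0} (hi v)

namespace Instance

variable {n m : ℕ} (I : Instance n m)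

instance (v : Fin n) : IsProbabilityMeasure (I.law v) := I.law_prob v

/-- The uncertainty interval of `v`. -/
def interval (v : Fin n) : Set ℝ := Set.Ioo (I.lo v) (I.hi v)

/-- `v` is leftmost in the hyperedge `j`. -/
def Leftmost (j : Fin m) (v : Fin n) : Prop :=
  v ∈ I.edge j ∧ ∀ u ∈ I.edge j, I.lo v ≤ I.lo u

/-- The instance is preprocessed: in no hyperedge does the interval of the leftmost vertex contain
the interval of another vertex. -/
def Preprocessed : Prop :=
  ∀ j v, I.Leftmost j v → ∀ u ∈ I.edge j, u ≠ v → ¬ I.interval u ⊆ I.interval v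

/-- The vertex cover instance: `u` and `v` are adjacent if in some hyperedge that contains both,
one of them is leftmost, and their intervals intersect. -/
def coverGraph : SimpleGraph (Fin n) :=
  SimpleGraph.fromRel fun v u =>
    ∃ j, I.Leftmost j v ∧ u ∈ I.edge j ∧ (I.interval v ∩ I.interval u).Nonempty

/-- The weights `w` are possible: each lies in its interval. -/
def Realization (w : Fin n → ℝ) : Prop := ∀ v, w v ∈ I.interval v

/-- The weights `w'` agree with what is known after the vertices in `Q` have been queried
under `w`. -/
def Consistent (w : Fin n → ℝ) (Q : Finset (Fin n)) (w' : Fin n → ℝ) : Prop :=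
  (∀ v ∈ Q, w' v = w v) ∧ ∀ v, v ∉ Q → w' v ∈ I.interval v

/-- Querying `Q` under `w` certifies that `v` is a minimum-weight vertex of hyperedge `j`. -/
def Identifies (w : Fin n → ℝ) (Q : Finset (Fin n)) (j : Fin m) (v : Fin n) : Prop :=
  v ∈ I.edge j ∧ ∀ w', I.Consistent w Q w' → ∀ u ∈ I.edge j, w' v ≤ w' u

/-- `Q` is a feasible query set for `w`: it permits one to identify a minimum-weight vertex in
every hyperedge. -/
def Feasible (w : Fin n → ℝ) (Q : Finset (Fin n)) : Prop := ∀ j, ∃ v, I.Identifies w Q j v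

/-- `v` belongs to every feasible query set for `w`. -/
def Mandatory (w : Fin n → ℝ) (v : Fin n) : Prop := ∀ Q, I.Feasible w Q → v ∈ Q

/-- `v` is known to be mandatory after the vertices in `Q` have been queried under `w`. -/
def KnownMandatory (w : Fin n → ℝ) (Q : Finset (Fin n)) (v : Fin n) : Prop :=
  ∀ w', I.Consistent w Q w' → I.Mandatory w' v

/-- The total query cost of a set of vertices. -/
def setCost (Q : Finset (Fin n)) : ℝ := ∑ v ∈ Q, I.cost v

/-- The minimum cost of a feasible query set for `w`. -/
def opt (w : Fin n → ℝ) : ℝ := sInf (I.setCost '' {Q | I.Feasible w Q})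

/-- The joint law of the weights, which are independent. -/
def weightLaw : Measure (Fin n → ℝ) := Measure.pi I.law

instance : IsProbabilityMeasure I.weightLaw := by unfold weightLaw; infer_instance

/-- The probability that `v` is mandatory. -/
def mandatoryProb (v : Fin n) : ℝ := I.weightLaw.real {w | I.Mandatory w v}

/-- The law of the source of samples: a sequence of independent realizations. -/
def tapeLaw : Measure (ℕ → Fin n → ℝ) := Measure.infinitePi fun _ : ℕ => I.weightLaw

end Instance

/-! ### Vertex covers -/

/-- An input of the weighted vertex cover problem, with vertex set `verts`. -/
structure CoverInput (n : ℕ) where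
  verts : Finset (Fin n)
  graph : SimpleGraph (Fin n)
  weight : Fin n → ℝ

/-- `X` is a vertex cover. -/
def CoverInput.IsCover {n : ℕ} (p : CoverInput n) (X : Finset (Fin n)) : Prop :=
  X ⊆ p.verts ∧ ∀ u ∈ p.verts, ∀ v ∈ p.verts, p.graph.Adj u v → u ∈ X ∨ v ∈ X

/-- `X` is a vertex cover of weight at most `α` times that of any other. -/
def CoverInput.IsApproxCover {n : ℕ} (p : CoverInput n) (α : ℝ) (X : Finset (Fin n)) : Prop :=
  p.IsCover X ∧ ∀ Z, p.IsCover Z → ∑ v ∈ X, p.weight v ≤ α * ∑ v ∈ Z, p.weight v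

/-- A procedure for vertex cover: its answer and its running time on each input. -/
structure BlackBox (n : ℕ) where
  answer : CoverInput n → Finset (Fin n)
  time : CoverInput n → ℕ

/-- The subgraph of `G` induced by `S`, all other vertices being isolated. -/
def restrict {n : ℕ} (G : SimpleGraph (Fin n)) (S : Finset (Fin n)) : SimpleGraph (Fin n) where
  Adj u v := G.Adj u v ∧ u ∈ S ∧ v ∈ S
  symm := ⟨fun _ _ h => ⟨h.1.symm, h.2.2, h.2.1⟩⟩
  loopless := ⟨fun _ h => h.1.ne rfl⟩

namespace Instance

variable {n m : ℕ} (I : Instance n m)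

/-- The subgraph of the vertex cover instance induced by `S`, weighted by the query costs. -/
def coverInput (S : Finset (Fin n)) : CoverInput n := ⟨S, restrict I.coverGraph S, I.cost⟩

/-- `x` is feasible for the vertex cover LP relaxation of the subgraph of the vertex cover
instance that is induced by `U`. Coordinates outside `U` are irrelevant. -/
def LPFeasible (U : Finset (Fin n)) (x : Fin n → ℝ) : Prop :=
  (∀ v ∈ U, 0 ≤ x v) ∧ ∀ u ∈ U, ∀ v ∈ U, I.coverGraph.Adj u v → 1 ≤ x u + x v

/-- `x` is a half-integral optimal solution of that LP. -/
def IsHalfIntegralOptimum (U : Finset (Fin n)) (x : Fin n → ℝ) : Prop :=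
  I.LPFeasible U x ∧ (∀ v ∈ U, x v = 0 ∨ x v = 1 / 2 ∨ x v = 1) ∧
    ∀ y, I.LPFeasible U y → ∑ v ∈ U, I.cost v * x v ≤ ∑ v ∈ U, I.cost v * y v

end Instance

/-! ### The machine

A real RAM without rounding, programmed by structured commands. It has named two-dimensional
arrays of natural numbers and of reals. Besides arithmetic it can draw a fresh sample from the
distribution of a vertex, query a vertex, and call a procedure for vertex cover. -/

/-- Natural-number expressions; `cell a i j` is an array entry. -/
inductive NExp where
  | const (k : ℕ)
  | cell (a : ℕ) (i j : NExp)
  | add (e f : NExp)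
  | sub (e f : NExp)

/-- Real expressions; `cell a i j` is an array entry. -/
inductive RExp where
  | const (k : ℕ)
  | cell (a : ℕ) (i j : NExp)
  | add (e f : RExp)
  | sub (e f : RExp)
  | mul (e f : RExp)
  | div (e f : RExp)

/-- Tests. -/
inductive Test where
  | natLE (e f : NExp)
  | realLE (e f : RExp)
  | neg (b : Test)
  | both (b c : Test)

/-- Programs. -/
inductive Cmd where
  | skip
  | seq (p q : Cmd)
  | setNat (a : ℕ) (i j : NExp) (e : NExp)
  | setReal (a : ℕ) (i j : NExp) (e : RExp)
  | cond (b : Test) (p q : Cmd)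
  /-- run `p` for each value `0, …, e - 1` of the cell `(0, 0)` of the natural array `a` -/
  | loop (a : ℕ) (e : NExp) (p : Cmd)
  /-- store in a real cell a fresh sample of the weight of vertex `v` -/
  | sample (a : ℕ) (i j : NExp) (v : NExp)
  /-- query vertex `v` and store its precise weight in a real cell -/
  | query (a : ℕ) (i j : NExp) (v : NExp)
  /-- call the vertex cover procedure: the arrays `s`, `g`, `c` hold the vertex set, the adjacency
  matrix and the weights; the answer is written to the array `t` -/
  | cover (s g c t : ℕ)

/-- Memory of the machine, its step count `time`, the number `draws` of samples drawn, the list of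
queried vertices (in the order of the queries), and the list of calls of the vertex cover
procedure. -/
structure State (n : ℕ) where
  nat : ℕ → ℕ → ℕ → ℕ
  real : ℕ → ℕ → ℕ → ℝ
  time : ℕ
  draws : ℕ
  queries : List (Fin n)
  calls : List (CoverInput n)

/-- What a program interacts with: the samples, the precise weights, the vertex cover procedure. -/
structure Env (n : ℕ) where
  tape : ℕ → Fin n → ℝ
  weight : Fin n → ℝ
  box : BlackBox n

section semantics

variable {n : ℕ}

/-- Change one entry of a two-dimensional array in a family of arrays. -/
def put {β : Type} (f : ℕ → ℕ → ℕ → β) (a i j : ℕ) (y : β) : ℕ → ℕ → ℕ → β :=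
  fun a' i' j' => if a' = a ∧ i' = i ∧ j' = j then y else f a' i' j'

/-- Count `t` steps. -/
def State.tick (s : State n) (t : ℕ) : State n := { s with time := s.time + t }

def NExp.eval (s : State n) : NExp → ℕ
  | const k => k
  | cell a i j => s.nat a (i.eval s) (j.eval s)
  | add e f => e.eval s + f.eval s
  | sub e f => e.eval s - f.eval s

def RExp.eval (s : State n) : RExp → ℝ
  | const k => k
  | cell a i j => s.real a (i.eval s) (j.eval s)
  | add e f => e.eval s + f.eval s
  | sub e f => e.eval s - f.eval s
  | mul e f => e.eval s * f.eval s
  | div e f => e.eval s / f.eval s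

def Test.eval (s : State n) : Test → Prop
  | natLE e f => e.eval s ≤ f.eval s
  | realLE e f => e.eval s ≤ f.eval s
  | neg b => ¬ b.eval s
  | both b c => b.eval s ∧ c.eval s

open Classical in
/-- The input of the vertex cover procedure that is stored in three arrays. -/
def State.coverInput (s : State n) (S G C : ℕ) : CoverInput n :=
  let U : Finset (Fin n) := Finset.univ.filter fun v => s.nat S v 0 = 1
  ⟨U, restrict (SimpleGraph.fromRel fun u v : Fin n => s.nat G u v = 1) U,
    fun v => s.real C v 0⟩

open Classical in
/-- Run a program. An assignment, a test, a pass of a loop, a sample or a query is one step; a call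
of the vertex cover procedure takes the time of the procedure, and `n ^ 2 + 1` steps to transfer
the data. Sampling or querying an index that is no vertex has no effect. -/
def Cmd.exec (env : Env n) : Cmd → State n → State n
  | skip, s => s
  | seq p q, s => q.exec env (p.exec env s)
  | setNat a i j e, s =>
      { s with nat := put s.nat a (i.eval s) (j.eval s) (e.eval s), time := s.time + 1 }
  | setReal a i j e, s =>
      { s with real := put s.real a (i.eval s) (j.eval s) (e.eval s), time := s.time + 1 }
  | cond b p q, s => if b.eval s then p.exec env (s.tick 1) else q.exec env (s.tick 1)
  | loop a e p, s =>
      Nat.rec (s.tick 1)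
        (fun t s' => p.exec env { s' with nat := put s'.nat a 0 0 t, time := s'.time + 1 })
        (e.eval s)
  | sample a i j v, s =>
      if h : v.eval s < n then
        { s with
          real := put s.real a (i.eval s) (j.eval s) (env.tape s.draws ⟨v.eval s, h⟩)
          time := s.time + 1
          draws := s.draws + 1 }
      else s.tick 1
  | query a i j v, s =>
      if h : v.eval s < n then
        { s with
          real := put s.real a (i.eval s) (j.eval s) (env.weight ⟨v.eval s, h⟩)
          time := s.time + 1
          queries := s.queries ++ [⟨v.eval s, h⟩] }
      else s.tick 1
  | cover S G C T, s =>
      let p := s.coverInput S G C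
      { s with
        nat := fun a i j =>
          if h : a = T ∧ j = 0 ∧ i < n then (if ⟨i, h.2.2⟩ ∈ env.box.answer p then 1 else 0)
          else s.nat a i j
        time := s.time + (n ^ 2 + 1) + env.box.time p
        calls := s.calls ++ [p] }

end semantics

open Classical in
/-- The memory at the start. Natural array `0` holds `n`, `m` and the number `k` of samples per
estimate, natural array `1` the incidence matrix of the hypergraph; real array `0` holds the end
points of the intervals and the query costs, real array `1` the threshold `d`. -/
def Instance.start {n m : ℕ} (I : Instance n m) (k : ℕ) (d : ℝ) : State n where
  nat a i j :=
    if a = 0 ∧ j = 0 then (if i = 0 then n else if i = 1 then m else if i = 2 then k else 0)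
    else if a = 1 then
      (if ∃ (hi : i < m) (hj : j < n), (⟨j, hj⟩ : Fin n) ∈ I.edge ⟨i, hi⟩ then 1 else 0)
    else 0
  real a i j :=
    if a = 0 then
      (if h : i < n then
        (if j = 0 then I.lo ⟨i, h⟩ else if j = 1 then I.hi ⟨i, h⟩
          else if j = 2 then I.cost ⟨i, h⟩ else 0)
      else 0)
    else if a = 1 ∧ i = 0 ∧ j = 0 then d else 0
  time := 0
  draws := 0
  queries := []
  calls := []

/-- The set of vertices that were queried. -/
def State.queried {n : ℕ} (s : State n) : Finset (Fin n) := s.queries.toFinset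

/-- At the end, entry `(j, 0)` of natural array `2` names a vertex that the queries certify to be a
minimum-weight vertex of hyperedge `j`. -/
def Instance.Solved {n m : ℕ} (I : Instance n m) (w : Fin n → ℝ) (s : State n) : Prop :=
  ∀ j : Fin m, ∃ v : Fin n, s.nat 2 j 0 = v ∧ I.Identifies w s.queried j v

/-! ### The threshold algorithm -/

/-- The competitive ratio. -/
def ratio (α ε : ℝ) : ℝ :=
  (1 / 2) * (α + √(α ^ 2 + 4 * (2 - α) * (1 + α * ε + (2 - α) * ε ^ 2)) + (4 - 2 * α) * ε)

/-- The number of realizations that are sampled to estimate one mandatory probability up to an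
error of `ε` with probability `1 - δ'`, where `(1 - δ') ^ n = 1 - δ`. -/
def sampleCount (n : ℕ) (ε δ : ℝ) : ℕ :=
  ⌈Real.log (2 / (1 - (1 - δ) ^ (1 / (n : ℝ)))) / (2 * ε ^ 2)⌉₊

open Classical in
/-- The vertices whose estimated mandatory probability is at least the threshold. -/
def overThreshold {n : ℕ} (d : ℝ) (Y : Fin n → ℝ) : Finset (Fin n) :=
  Finset.univ.filter fun v => d ≤ Y v

open Classical in
/-- The vertices of `U` at which `x` has the value `t`. -/
def levelSet {n : ℕ} (U : Finset (Fin n)) (x : Fin n → ℝ) (t : ℝ) : Finset (Fin n) :=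
  U.filter fun v => x v = t

/-- The queries recorded in `s` are those of the threshold algorithm with threshold `d`,
estimates `Y` and LP solution `x`: first the vertices in `M`, in `V₁` and in the answer of the black
box on the subgraph induced by `V_{1/2}`, which is called exactly once, and afterwards only
vertices that are known to be mandatory. -/
def Instance.IsThresholdRun {n m : ℕ} (I : Instance n m) (B : BlackBox n) (d : ℝ)
    (Y x w : Fin n → ℝ) (s : State n) : Prop :=
  let M := overThreshold d Y
  let p := I.coverInput (levelSet Mᶜ x (1 / 2))
  I.IsHalfIntegralOptimum Mᶜ x ∧ s.calls = [p] ∧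
    ∃ first later : List (Fin n), s.queries = first ++ later ∧
      first.toFinset = M ∪ levelSet Mᶜ x 1 ∪ B.answer p ∧
      ∀ before v after, later = before ++ v :: after →
        I.KnownMandatory w (first ++ before).toFinset v

end HypOrient

end

noncomputable section

/-! ### Certificates, mandatory vertices and vertex covers -/

namespace HypOrient
namespace Instance

variable {n m : ℕ} (I : Instance n m)

/-! After querying `Q`, what is known about each weight is a lower and an upper bound, and a vertex
is certified exactly when its upper bound is at most the lower bounds of the other vertices of the
hyperedge (`identifies_iff`). Two consequences follow. A vertex is mandatory if and only if, in some
hyperedge containing it, the minimum of the other weights falls into its interval (`mandatory_iff`);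
this event can be tested on samples. Every feasible set is a vertex cover of the cover graph
(`Feasible.covers`). Conversely, once a vertex cover has been queried, a vertex with the least known
lower bound in a hyperedge is queried, or certified without a query, or already known to be
mandatory (`Candidate.knownMandatory`). So the instance can be finished by queries of known
mandatory vertices.

For the cost, let `p v` be the mandatory probability and `q v` the probability that `v` lies in a
fixed optimal set. Then `p ≤ q`, the expected optimum is the sum of `c v * q v`, and `q` is feasible
for the LP of every induced subgraph. The algorithm pays at most the cost of its first queries plus
the sum of `c v * p v` over the other vertices. This is compared with `R` times the cost of `q` in
three pieces. On `M`, `p ≥ 1 / R` gives the factor `R`. On `V₀ ∪ V₁`, optimality of the LP solution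
against one well-chosen competitor gives a factor `R ≥ 1 + P`, where `P` bounds `p` outside `M`. On
the half-integral vertices, the LP costs their whole set at most twice `q`, the black box costs its
cover at most `α` times `q`, and mixing the two yields `α + (2 - α) * P ≤ R`; this is the equation
that determines `R` (`ratio_spec`, `threshold_cost_le`, `expected_cost_le`).

The estimates read disjoint parts of the sample tape and are therefore independent. Hoeffding's
inequality for each of them and a product over the vertices give the success probability
(`estimates_close`).

The half-integral optimum is computed exactly, with real arithmetic, by push-relabel in the
bipartite double cover. A potential bounds the number of sweeps by a polynomial in the number of
vertices, independently of the costs. At the end some label value is unused; cutting there gives the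
LP solution, and the preflow, scaled down, is a dual solution satisfying complementary slackness
(`Preflow.twiceSolution_optimal`).

The program is verified with a loop rule that carries along syntactic information on what a command
can change. Its planning phase contains no query, so the estimates and the LP solution do not depend
on the weights; this also makes the queried set measurable in the weights although the black box is
arbitrary. Loop bounds depend only on the input sizes, so the step count can be read off the program
text. -/

theorem lo_lt_hi (v : Fin n) : I.lo v < I.hi v := by
  by_contra! h
  have h1 : I.law v (Set.Iic (I.lo v)) = 0 := (I.lo_spec v).1
  have h2 : I.law v (Set.Ici (I.hi v)) = 0 := (I.hi_spec v).1
  have h3 : I.law v Set.univ = 0 := by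
    refine measure_mono_null (fun x _ => ?_) (measure_union_null h1 h2)
    rcases le_total x (I.lo v) with h' | h'
    · exact Or.inl h'
    · exact Or.inr (h.trans h')
  simp at h3

/-- The largest lower bound on the weight of `u` that is known after querying `Q`. -/
def lower (w : Fin n → ℝ) (Q : Finset (Fin n)) (u : Fin n) : ℝ := if u ∈ Q then w u else I.lo u

/-- The least upper bound on the weight of `u` that is known after querying `Q`. -/
def upper (w : Fin n → ℝ) (Q : Finset (Fin n)) (u : Fin n) : ℝ := if u ∈ Q then w u else I.hi u

variable {I}

theorem Consistent.realization {w w' : Fin n → ℝ} {Q : Finset (Fin n)} (hw : I.Realization w)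
    (h : I.Consistent w Q w') : I.Realization w' := by
  intro v
  by_cases hv : v ∈ Q
  · rw [h.1 v hv]; exact hw v
  · exact h.2 v hv

theorem Consistent.lower_le {w w' : Fin n → ℝ} {Q : Finset (Fin n)}
    (h : I.Consistent w Q w') (u : Fin n) : I.lower w Q u ≤ w' u := by
  unfold lower
  split_ifs with hu
  · exact (h.1 u hu).ge
  · exact (h.2 u hu).1.le

theorem Consistent.le_upper {w w' : Fin n → ℝ} {Q : Finset (Fin n)}
    (h : I.Consistent w Q w') (u : Fin n) : w' u ≤ I.upper w Q u := by
  unfold upper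
  split_ifs with hu
  · exact (h.1 u hu).le
  · exact (h.2 u hu).2.le

theorem consistent_self {w : Fin n → ℝ} (hw : I.Realization w) (Q : Finset (Fin n)) :
    I.Consistent w Q w := ⟨fun _ _ => rfl, fun v _ => hw v⟩

/-- If the upper bound of `v` exceeds the lower bound of `u`, some consistent weights put `v`
strictly above `u`, because open intervals leave room for both values. This turns a quantifier over
all consistent weights into finitely many comparisons. -/
theorem identifies_iff {w : Fin n → ℝ} {Q : Finset (Fin n)} {j : Fin m} {v : Fin n} :
    I.Identifies w Q j v ↔
      v ∈ I.edge j ∧ ∀ u ∈ I.edge j, u ≠ v → I.upper w Q v ≤ I.lower w Q u := by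
  constructor
  · rintro ⟨hv, h⟩
    refine ⟨hv, fun u hu huv => ?_⟩
    by_contra! hlt
    -- A value that `v` may still have and that exceeds the lower bound of `u`; afterwards `u`
    -- receives an allowed value below it.
    obtain ⟨x, hx1, hx2, hx3⟩ : ∃ x, I.lower w Q u < x ∧ (v ∈ Q → x = w v) ∧
        (v ∉ Q → x ∈ I.interval v) := by
      by_cases hvQ : v ∈ Q
      · exact ⟨w v, by simpa [upper, hvQ] using hlt, fun _ => rfl, fun h => absurd hvQ h⟩
      · obtain ⟨x, h1, h2⟩ := exists_between (max_lt (I.lo_lt_hi v)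
          (show I.lower w Q u < I.hi v by simpa [upper, hvQ] using hlt))
        rw [max_lt_iff] at h1
        exact ⟨x, h1.2, fun h => absurd h hvQ, fun _ => ⟨h1.1, h2⟩⟩
    obtain ⟨y, hy1, hy2, hy3⟩ : ∃ y, y < x ∧ (u ∈ Q → y = w u) ∧
        (u ∉ Q → y ∈ I.interval u) := by
      by_cases huQ : u ∈ Q
      · exact ⟨w u, by simpa [lower, huQ] using hx1, fun _ => rfl, fun h => absurd huQ h⟩
      · obtain ⟨y, h1, h2⟩ := exists_between (lt_min (I.lo_lt_hi u)
          (show I.lo u < x by simpa [lower, huQ] using hx1))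
        rw [lt_min_iff] at h2
        exact ⟨y, h2.2, fun h => absurd h huQ, fun _ => ⟨h1, h2.1⟩⟩
    have hmid : ∀ z, ∃ t, t ∈ I.interval z := fun z => by
      obtain ⟨t, h1, h2⟩ := exists_between (I.lo_lt_hi z)
      exact ⟨t, h1, h2⟩
    choose t ht using hmid
    have := h (fun z => if z = v then x else if z = u then y else if z ∈ Q then w z else t z)
      ⟨fun z hz => ?_, fun z hz => ?_⟩ u hu
    · simp only [if_true, huv, if_false] at this
      linarith
    · dsimp only
      split_ifs with h1 h2
      · subst h1; exact hx2 hz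
      · subst h2; exact hy2 hz
      · rfl
    · dsimp only
      split_ifs with h1 h2
      · subst h1; exact hx3 hz
      · subst h2; exact hy3 hz
      · exact ht z
  · rintro ⟨hv, h⟩
    refine ⟨hv, fun w' hw' u hu => ?_⟩
    by_cases huv : u = v
    · rw [huv]
    · exact (hw'.le_upper v).trans ((h u hu huv).trans (hw'.lower_le u))

theorem feasible_univ (w : Fin n → ℝ) : I.Feasible w Finset.univ := by
  intro j
  obtain ⟨v, hv, hmin⟩ := (I.edge j).exists_min_image w (I.edge_nonempty j)
  exact ⟨v, identifies_iff.2 ⟨hv, fun u hu _ => by simpa [upper, lower] using hmin u hu⟩⟩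

variable (I)

/-- In some hyperedge that contains `v`, the minimum of the other weights lies in the interval
of `v`. -/
def SomeOtherMinInside (r : Fin n → ℝ) (v : Fin n) : Prop :=
  ∃ j, v ∈ I.edge j ∧ (∃ u ∈ I.edge j, u ≠ v ∧ r u < I.hi v) ∧
    ∀ u ∈ I.edge j, u ≠ v → I.lo v < r u

variable {I}

/-- Querying everything except `v` can fail only in a hyperedge that contains `v` and in which
neither `v` nor the lightest other vertex is certified. The first is uncertified when the minimum of
the other weights is below `hi v`, the second when it is above `lo v`. Conversely, such a hyperedge
defeats every set that misses `v`. -/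
theorem mandatory_iff {w : Fin n → ℝ} (hw : I.Realization w) {v : Fin n} :
    I.Mandatory w v ↔ I.SomeOtherMinInside w v := by
  constructor
  · intro h
    have hnf : ¬ I.Feasible w (Finset.univ.erase v) := fun hf => by simpa using h _ hf
    simp only [Feasible, not_forall, not_exists] at hnf
    obtain ⟨j, hj⟩ := hnf
    have hlow : ∀ u, u ≠ v → I.lower w (Finset.univ.erase v) u = w u := fun u hu => by
      simp [lower, hu]
    have hupp : ∀ u, u ≠ v → I.upper w (Finset.univ.erase v) u = w u := fun u hu => by
      simp [upper, hu]
    have hlowv : I.lower w (Finset.univ.erase v) v = I.lo v := by simp [lower]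
    have huppv : I.upper w (Finset.univ.erase v) v = I.hi v := by simp [upper]
    have hv : v ∈ I.edge j := by
      by_contra hv
      obtain ⟨z, hz, hmin⟩ := (I.edge j).exists_min_image w (I.edge_nonempty j)
      refine hj z (identifies_iff.2 ⟨hz, fun u hu _ => ?_⟩)
      rw [hlow u (fun h => hv (h ▸ hu)), hupp z (fun h => hv (h ▸ hz))]
      exact hmin u hu
    refine ⟨j, hv, ?_, ?_⟩
    · by_contra! hne
      refine hj v (identifies_iff.2 ⟨hv, fun u hu huv => ?_⟩)
      rw [hlow u huv, huppv]
      exact hne u hu huv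
    · by_contra! hne
      obtain ⟨u, hu, huv, hle⟩ := hne
      obtain ⟨z, hz, hmin⟩ := ((I.edge j).erase v).exists_min_image w
        ⟨u, Finset.mem_erase.2 ⟨huv, hu⟩⟩
      rw [Finset.mem_erase] at hz
      refine hj z (identifies_iff.2 ⟨hz.2, fun y hy hyz => ?_⟩)
      rw [hupp z hz.1]
      by_cases hyv : y = v
      · rw [hyv, hlowv]
        exact (hmin u (Finset.mem_erase.2 ⟨huv, hu⟩)).trans hle
      · rw [hlow y hyv]
        exact hmin y (Finset.mem_erase.2 ⟨hyv, hy⟩)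
  · rintro ⟨j, hv, ⟨u, hu, huv, hlt⟩, hall⟩ Q hQ
    by_contra hvQ
    obtain ⟨z, hz⟩ := hQ j
    by_cases hzv : z = v
    · subst hzv
      have := (identifies_iff.1 hz).2 u hu huv
      have h2 := Consistent.lower_le (consistent_self hw Q) u
      simp only [upper, hvQ, if_false] at this
      linarith
    · have := (identifies_iff.1 hz).2 v hv (Ne.symm hzv)
      have h2 := Consistent.le_upper (consistent_self hw Q) z
      simp only [lower, hvQ, if_false] at this
      linarith [hall z hz.1 hzv]

theorem interval_inter_nonempty {u v : Fin n} :
    (I.interval v ∩ I.interval u).Nonempty ↔ I.lo u < I.hi v ∧ I.lo v < I.hi u := by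
  unfold interval
  rw [Set.Ioo_inter_Ioo, Set.nonempty_Ioo, sup_lt_iff, lt_inf_iff, lt_inf_iff]
  constructor
  · rintro ⟨⟨-, h⟩, h', -⟩; exact ⟨h', h⟩
  · rintro ⟨h', h⟩; exact ⟨⟨I.lo_lt_hi v, h⟩, h', I.lo_lt_hi u⟩

theorem coverGraph_adj {u v : Fin n} : I.coverGraph.Adj u v ↔ u ≠ v ∧
    ∃ j, u ∈ I.edge j ∧ v ∈ I.edge j ∧ (I.Leftmost j u ∨ I.Leftmost j v) ∧
      I.lo u < I.hi v ∧ I.lo v < I.hi u := by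
  rw [coverGraph, SimpleGraph.fromRel_adj]
  simp only [interval_inter_nonempty]
  constructor
  · rintro ⟨hne, ⟨j, h1, h2, h3⟩ | ⟨j, h1, h2, h3⟩⟩
    · exact ⟨hne, j, h1.1, h2, Or.inl h1, h3.symm⟩
    · exact ⟨hne, j, h2, h1.1, Or.inr h1, h3⟩
  · rintro ⟨hne, j, h1, h2, h3 | h3, h4⟩
    · exact ⟨hne, Or.inl ⟨j, h3, h2, h4.symm⟩⟩
    · exact ⟨hne, Or.inr ⟨j, h3, h1, h4⟩⟩

/-- Suppose the leftmost vertex `v` and an overlapping `u` are both unqueried. Then `v` is not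
certified, since `lo u < hi v`, and no other `z` is certified against `v`, since `w z > lo z ≥ lo
v`. -/
theorem Feasible.covers {w : Fin n → ℝ} (hw : I.Realization w) {Q : Finset (Fin n)}
    (hQ : I.Feasible w Q) {u v : Fin n} (h : I.coverGraph.Adj u v) : u ∈ Q ∨ v ∈ Q := by
  have key : ∀ (j : Fin m) (v u : Fin n), u ≠ v → I.Leftmost j v → u ∈ I.edge j →
      I.lo u < I.hi v → u ∈ Q ∨ v ∈ Q := by
    intro j v u hne hv hu hlt
    by_contra! hno
    obtain ⟨z, hz⟩ := hQ j
    have hz' := (identifies_iff.1 hz).2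
    by_cases hzv : z = v
    · subst hzv
      have := hz' u hu hne
      simp only [upper, lower, hno.1, hno.2, if_false] at this
      linarith
    · have h1 := hz' v hv.1 (Ne.symm hzv)
      have h2 := Consistent.le_upper (consistent_self hw Q) z
      simp only [lower, hno.2, if_false] at h1
      have := (hw z).1
      linarith [hv.2 z hz.1]
  obtain ⟨hne, j, h1, h2, h3 | h3, h4, h5⟩ := coverGraph_adj.1 h
  · exact (key j u v hne.symm h3 h2 h5).symm
  · exact key j v u hne h3 h1 h4

variable (I)

/-- `b` has a smallest known lower bound in hyperedge `j`, where ties are broken in favour of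
queried vertices. -/
def Candidate (w : Fin n → ℝ) (Q : Finset (Fin n)) (j : Fin m) (b : Fin n) : Prop :=
  b ∈ I.edge j ∧ ∀ u ∈ I.edge j, I.lower w Q b ≤ I.lower w Q u ∧
    (u ∈ Q → b ∉ Q → I.lower w Q b < I.lower w Q u)

/-- Some other vertex of hyperedge `j` might be lighter than `b`. -/
def Challenged (w : Fin n → ℝ) (Q : Finset (Fin n)) (j : Fin m) (b : Fin n) : Prop :=
  ∃ u ∈ I.edge j, u ≠ b ∧ I.lower w Q u < I.hi b

variable {I}

theorem exists_candidate (w : Fin n → ℝ) (Q : Finset (Fin n)) (j : Fin m) :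
    ∃ b, I.Candidate w Q j b := by
  obtain ⟨b, hb, hmin⟩ := (I.edge j).exists_min_image (I.lower w Q) (I.edge_nonempty j)
  -- If the minimum is also attained at a queried vertex, that vertex is chosen; otherwise all
  -- queried vertices are strictly larger.
  by_cases h : ∃ u ∈ I.edge j, u ∈ Q ∧ I.lower w Q u ≤ I.lower w Q b
  · obtain ⟨u, hu, huQ, hle⟩ := h
    exact ⟨u, hu, fun z hz => ⟨hle.trans (hmin z hz), fun _ h => absurd huQ h⟩⟩
  · push Not at h
    exact ⟨b, hb, fun z hz => ⟨hmin z hz, fun hzQ _ => h z hz hzQ⟩⟩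

theorem Candidate.identifies {w : Fin n → ℝ} {Q : Finset (Fin n)} {j : Fin m} {b : Fin n}
    (h : I.Candidate w Q j b) (h' : b ∈ Q ∨ ¬ I.Challenged w Q j b) : I.Identifies w Q j b := by
  refine identifies_iff.2 ⟨h.1, fun u hu hub => ?_⟩
  by_cases hb : b ∈ Q
  · have := (h.2 u hu).1
    simpa [lower, upper, hb] using this
  · have h' := h'.resolve_left hb
    simp only [Challenged, not_exists, not_and, not_lt] at h'
    simpa [upper, hb] using h' u hu hub

theorem Preprocessed.hi_lt_hi (hI : I.Preprocessed) {j : Fin m} {u v : Fin n}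
    (hv : I.Leftmost j v) (hu : u ∈ I.edge j) (huv : u ≠ v) : I.hi v < I.hi u := by
  by_contra! h
  exact hI j v hv u hu huv (Set.Ioo_subset_Ioo (hv.2 u hu) h)

theorem exists_leftmost (j : Fin m) : ∃ v, I.Leftmost j v := by
  obtain ⟨b, hb, hmin⟩ := (I.edge j).exists_min_image I.lo (I.edge_nonempty j)
  exact ⟨b, hb, hmin⟩

/-- The criterion of `mandatory_iff` has to hold for all consistent weights. All other weights
exceed `lo b`: for queried vertices by the tie-breaking, for unqueried ones because intervals are
open. Some other weight is below `hi b`: if `b` is leftmost, the challenger is queried, as otherwise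
it would be an uncovered neighbour of `b`; if `b` is not leftmost, preprocessing makes the leftmost
interval end before `hi b`. -/
theorem Candidate.knownMandatory (hI : I.Preprocessed) {w : Fin n → ℝ} (hw : I.Realization w)
    {Q : Finset (Fin n)} (hQ : ∀ u v, I.coverGraph.Adj u v → u ∈ Q ∨ v ∈ Q) {j : Fin m} {b : Fin n}
    (h : I.Candidate w Q j b) (hb : b ∉ Q) (hc : I.Challenged w Q j b) :
    I.KnownMandatory w Q b := by
  intro w' hw'
  have hreal := hw'.realization hw
  refine (mandatory_iff hreal).2 ⟨j, h.1, ?_, fun u hu hub => ?_⟩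
  · obtain ⟨v, hv⟩ := I.exists_leftmost j
    by_cases hvb : v = b
    · subst hvb
      obtain ⟨u, hu, huv, hlt⟩ := hc
      refine ⟨u, hu, huv, ?_⟩
      by_cases huQ : u ∈ Q
      · rw [hw'.1 u huQ]
        simpa [lower, huQ] using hlt
      · have hadj : I.coverGraph.Adj u v := coverGraph_adj.2
          ⟨huv, j, hu, hv.1, Or.inr hv, by simpa [lower, huQ] using hlt,
            (hv.2 u hu).trans_lt (I.lo_lt_hi u)⟩
        exact absurd (hQ u v hadj) (by simp [huQ, hb])
    · refine ⟨v, hv.1, hvb, (hreal v).2.trans (hI.hi_lt_hi hv h.1 (Ne.symm hvb))⟩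
  · by_cases huQ : u ∈ Q
    · have := (h.2 u hu).2 huQ hb
      simp only [lower, huQ, hb, if_true, if_false] at this
      rw [hw'.1 u huQ]
      exact this
    · have := (h.2 u hu).1
      simp only [lower, huQ, hb, if_false] at this
      exact this.trans_lt (hw'.2 u huQ).1

end Instance
end HypOrient

/-! ### The ratio, and the comparison with fractional vertex covers -/

namespace HypOrient

/-- The ratio is the larger root of `R ^ 2 = (α + 2 * (2 - α) * ε) * R + (2 - α)`. In the form of a
fixed-point equation this is exactly what balances the half-integral vertices against the threshold.
-/
theorem ratio_spec {α ε : ℝ} (h1 : 1 ≤ α) (h2 : α ≤ 2) (hε : 0 < ε) :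
    1 ≤ ratio α ε ∧ ratio α ε = α + (2 - α) * (1 / ratio α ε + 2 * ε) := by
  have hrad : 0 ≤ α ^ 2 + 4 * (2 - α) * (1 + α * ε + (2 - α) * ε ^ 2) := by
    have : 0 ≤ 2 - α := by linarith
    positivity
  have hge : 1 ≤ ratio α ε := by
    unfold ratio
    -- With this bound the ratio is at least `(α + (2 - α)) / 2 = 1`.
    have hs : 2 - α ≤ √(α ^ 2 + 4 * (2 - α) * (1 + α * ε + (2 - α) * ε ^ 2)) := by
      apply Real.le_sqrt_of_sq_le
      have h3 : 0 ≤ 2 - α := by linarith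
      have h4 : 0 ≤ (2 - α) * (α * ε + (2 - α) * ε ^ 2) := by positivity
      nlinarith
    nlinarith
  refine ⟨hge, ?_⟩
  have hpos : (0 : ℝ) < ratio α ε := by linarith
  have hquad : ratio α ε ^ 2 = (α + 2 * (2 - α) * ε) * ratio α ε + (2 - α) := by
    unfold ratio
    have hs := Real.sq_sqrt hrad
    nlinarith
  field_simp
  linarith

variable {n m : ℕ}

theorem mem_levelSet {U : Finset (Fin n)} {x : Fin n → ℝ} {t : ℝ} {v : Fin n} :
    v ∈ levelSet U x t ↔ v ∈ U ∧ x v = t := by simp [levelSet]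

theorem mem_overThreshold {d : ℝ} {Y : Fin n → ℝ} {v : Fin n} :
    v ∈ overThreshold d Y ↔ d ≤ Y v := by simp [overThreshold]

namespace Instance

variable {I : Instance n m}

theorem IsHalfIntegralOptimum.sum_eq {U : Finset (Fin n)} {x : Fin n → ℝ}
    (hx : I.IsHalfIntegralOptimum U x) (g : Fin n → ℝ) :
    ∑ v ∈ U, g v = ∑ v ∈ levelSet U x 0, g v + ∑ v ∈ levelSet U x (1 / 2), g v +
      ∑ v ∈ levelSet U x 1, g v := by
  classical
  have hU : U = levelSet U x 0 ∪ levelSet U x (1 / 2) ∪ levelSet U x 1 := by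
    ext v
    simp only [Finset.mem_union, mem_levelSet]
    have := hx.2.1 v
    tauto
  conv_lhs => rw [hU]
  rw [Finset.sum_union, Finset.sum_union]
  · rw [Finset.disjoint_left]
    intro v h1 h2
    rw [mem_levelSet] at h1 h2
    linarith [h1.2, h2.2]
  · rw [Finset.disjoint_left]
    intro v h1 h2
    rw [Finset.mem_union, mem_levelSet, mem_levelSet] at h1
    rw [mem_levelSet] at h2
    rcases h1 with h1 | h1 <;> linarith [h1.2, h2.2]

/-- Replacing `x` by `q` on the half-integral vertices keeps feasibility: such a vertex has no
neighbour of value `0`, and a neighbour of value `1` already satisfies the edge. Optimality of `x`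
does the rest. -/
theorem IsHalfIntegralOptimum.half_le {U : Finset (Fin n)} {x q : Fin n → ℝ}
    (hx : I.IsHalfIntegralOptimum U x) (hq : I.LPFeasible U q) :
    1 / 2 * ∑ v ∈ levelSet U x (1 / 2), I.cost v ≤
      ∑ v ∈ levelSet U x (1 / 2), I.cost v * q v := by
  have hfeas : I.LPFeasible U (fun v => if x v = 1 / 2 then q v else x v) := by
    refine ⟨fun v hv => ?_, fun u hu v hv huv => ?_⟩
    · dsimp only
      split_ifs
      · exact hq.1 v hv
      · exact hx.1.1 v hv
    · have h1 := hx.1.2 u hu v hv huv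
      have h2 := hq.2 u hu v hv huv
      have h3 := hq.1 u hu
      have h4 := hq.1 v hv
      dsimp only
      rcases hx.2.1 u hu with h | h | h <;> rcases hx.2.1 v hv with h' | h' | h' <;>
        rw [h, h'] at h1 ⊢ <;>
        first | (exfalso; linarith) | (norm_num; done) | (norm_num; linarith)
  have := hx.2.2 _ hfeas
  rw [hx.sum_eq, hx.sum_eq] at this
  have e0 : ∀ y : ℝ, y ≠ 1 / 2 → ∑ v ∈ levelSet U x y, I.cost v * (if x v = 1 / 2 then q v else x v)
      = ∑ v ∈ levelSet U x y, I.cost v * x v := fun y hy =>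
    Finset.sum_congr rfl fun v hv => by rw [(mem_levelSet.1 hv).2, if_neg hy]
  have e1 : ∑ v ∈ levelSet U x (1 / 2), I.cost v * (if x v = 1 / 2 then q v else x v)
      = ∑ v ∈ levelSet U x (1 / 2), I.cost v * q v :=
    Finset.sum_congr rfl fun v hv => by rw [if_pos (mem_levelSet.1 hv).2]
  have e2 : ∑ v ∈ levelSet U x (1 / 2), I.cost v * x v
      = 1 / 2 * ∑ v ∈ levelSet U x (1 / 2), I.cost v := by
    rw [Finset.mul_sum]
    exact Finset.sum_congr rfl fun v hv => by rw [(mem_levelSet.1 hv).2]; ring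
  rw [e0 0 (by norm_num), e0 1 (by norm_num), e1, e2] at this
  linarith

/-- Optimality of `x` is tested against the single competitor `y`, which moves `V₀` to `(R * q - p)
/ 2` and `V₁` to `(1 + R * q) / 2`. The critical edges join `V₀` to `V₁`: there the sum is at least
`(R - P + 1) / 2`, which is at least `1` because `1 + P ≤ R`. Doubling the resulting inequality and
cancelling the cost of `V₁` gives the claim. -/
theorem IsHalfIntegralOptimum.integral_part_le {U : Finset (Fin n)} {x p q : Fin n → ℝ} {R P : ℝ}
    (hx : I.IsHalfIntegralOptimum U x) (hq : I.LPFeasible U q) (hR : 1 + P ≤ R) (hR' : 1 ≤ R)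
    (hpq : ∀ v, p v ≤ q v) (hP : ∀ v ∈ U, p v ≤ P) :
    ∑ v ∈ levelSet U x 1, I.cost v + ∑ v ∈ levelSet U x 0, I.cost v * p v ≤
      R * (∑ v ∈ levelSet U x 0, I.cost v * q v + ∑ v ∈ levelSet U x 1, I.cost v * q v) := by
  set y : Fin n → ℝ := fun v =>
    if x v = 0 then (R * q v - p v) / 2 else if x v = 1 then (1 + R * q v) / 2 else x v with hy
  have hfeas : I.LPFeasible U y := by
    refine ⟨fun v hv => ?_, fun u hu v hv huv => ?_⟩
    · have h0 := hq.1 v hv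
      have : q v ≤ R * q v := by nlinarith
      have := hpq v
      rw [hy]; dsimp only
      split_ifs
      · linarith
      · linarith
      · exact hx.1.1 v hv
    · have h1 := hx.1.2 u hu v hv huv
      have h2 := hq.2 u hu v hv huv
      have h3 := hq.1 u hu
      have h4 := hq.1 v hv
      have h5 : R ≤ R * q u + R * q v := by nlinarith
      have h6 : 0 ≤ R * q u := by positivity
      have h7 : 0 ≤ R * q v := by positivity
      have := hP u hu
      have := hP v hv
      rw [hy]; dsimp only
      rcases hx.2.1 u hu with h | h | h <;> rcases hx.2.1 v hv with h' | h' | h' <;>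
        rw [h, h'] at h1 ⊢ <;>
        first | (exfalso; linarith) | (norm_num; done) | (norm_num; linarith)
  have := hx.2.2 _ hfeas
  rw [hx.sum_eq, hx.sum_eq] at this
  have e0 : ∑ v ∈ levelSet U x 0, I.cost v * y v = (R * ∑ v ∈ levelSet U x 0, I.cost v * q v -
      ∑ v ∈ levelSet U x 0, I.cost v * p v) / 2 := by
    rw [Finset.mul_sum, ← Finset.sum_sub_distrib, Finset.sum_div]
    exact Finset.sum_congr rfl fun v hv => by
      simp only [hy, (mem_levelSet.1 hv).2, if_true]; ring
  have e1 : ∑ v ∈ levelSet U x 1, I.cost v * y v = (∑ v ∈ levelSet U x 1, I.cost v +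
      R * ∑ v ∈ levelSet U x 1, I.cost v * q v) / 2 := by
    rw [Finset.mul_sum, ← Finset.sum_add_distrib, Finset.sum_div]
    exact Finset.sum_congr rfl fun v hv => by
      simp only [hy, (mem_levelSet.1 hv).2, if_true, one_ne_zero, if_false]; ring
  have e2 : ∑ v ∈ levelSet U x (1 / 2), I.cost v * y v =
      ∑ v ∈ levelSet U x (1 / 2), I.cost v * x v := by
    refine Finset.sum_congr rfl fun v hv => ?_
    simp only [hy, (mem_levelSet.1 hv).2]
    norm_num
  have e3 : ∑ v ∈ levelSet U x 0, I.cost v * x v = 0 :=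
    Finset.sum_eq_zero fun v hv => by rw [(mem_levelSet.1 hv).2, mul_zero]
  have e4 : ∑ v ∈ levelSet U x 1, I.cost v * x v = ∑ v ∈ levelSet U x 1, I.cost v :=
    Finset.sum_congr rfl fun v hv => by rw [(mem_levelSet.1 hv).2, mul_one]
  rw [e0, e1, e2, e3, e4] at this
  linarith

/-- The cost of a set that contains `M` and `V₁`, plus the expected cost of the mandatory vertices
outside it, compared with a fractional solution `q` that dominates the probabilities `p`. -/
theorem threshold_cost_le {M X : Finset (Fin n)} {x p q : Fin n → ℝ} {α ε : ℝ}
    (h1 : 1 ≤ α) (h2 : α ≤ 2) (hε : 0 < ε) (hx : I.IsHalfIntegralOptimum Mᶜ x)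
    (hq : I.LPFeasible Mᶜ q) (hpq : ∀ v, p v ≤ q v) (hp1 : ∀ v, p v ≤ 1)
    (hM : ∀ v ∈ M, 1 / ratio α ε ≤ p v) (hM' : ∀ v ∉ M, p v ≤ 1 / ratio α ε + 2 * ε)
    (hX : X ⊆ levelSet Mᶜ x (1 / 2))
    (hXq : ∑ v ∈ X, I.cost v ≤ α * ∑ v ∈ levelSet Mᶜ x (1 / 2), I.cost v * q v) :
    I.setCost (M ∪ levelSet Mᶜ x 1 ∪ X) +
      ∑ v ∈ (M ∪ levelSet Mᶜ x 1 ∪ X)ᶜ, I.cost v * p v ≤ ratio α ε * ∑ v, I.cost v * q v := by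
  classical
  obtain ⟨hR1, hReq⟩ := ratio_spec h1 h2 hε
  set R := ratio α ε
  have hRpos : 0 < R := by linarith
  -- The truncation at `1` matters: `1 + P ≤ α + (2 - α) * P` is the statement `0 ≤ (α - 1) * (1 -
  -- P)`, and `1 - P` later serves as a nonnegative weight.
  set P := min (1 / R + 2 * ε) 1 with hPdef
  have hP0 : 0 ≤ P := le_min (by positivity) zero_le_one
  have hP1 : P ≤ 1 := min_le_right _ _
  have hRP : α + (2 - α) * P ≤ R := by
    have : P ≤ 1 / R + 2 * ε := min_le_left _ _
    rw [hReq]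
    nlinarith
  have hRP' : 1 + P ≤ R := by nlinarith
  have hhalf := hx.half_le hq
  have hint := hx.integral_part_le (P := P) hq hRP' hR1 hpq fun v hv =>
    le_min (hM' v (by simpa using hv)) (hp1 v)
  have hMsum : ∑ v ∈ M, I.cost v ≤ R * ∑ v ∈ M, I.cost v * q v := by
    rw [Finset.mul_sum]
    refine Finset.sum_le_sum fun v hv => ?_
    have h3 : 1 ≤ R * q v := by
      have := (hM v hv).trans (hpq v)
      rw [div_le_iff₀ hRpos] at this
      linarith
    have := I.cost_nonneg v
    nlinarith
  set Q := M ∪ levelSet Mᶜ x 1 ∪ X with hQ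
  set g : Fin n → ℝ := fun v => if v ∈ Q then I.cost v else I.cost v * p v with hg
  have hlhs : I.setCost Q + ∑ v ∈ Qᶜ, I.cost v * p v = ∑ v, g v := by
    rw [← Finset.sum_add_sum_compl Q g, setCost]
    congr 1
    · exact Finset.sum_congr rfl fun v hv => by simp [hg, hv]
    · exact Finset.sum_congr rfl fun v hv => by simp [hg, Finset.mem_compl.1 hv]
  rw [hlhs, ← Finset.sum_add_sum_compl M, ← Finset.sum_add_sum_compl M (fun v => I.cost v * q v),
    hx.sum_eq, hx.sum_eq (fun v => I.cost v * q v)]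
  have e0 : ∑ v ∈ M, g v = ∑ v ∈ M, I.cost v :=
    Finset.sum_congr rfl fun v hv => by simp [hg, hQ, hv]
  have e1 : ∑ v ∈ levelSet Mᶜ x 1, g v = ∑ v ∈ levelSet Mᶜ x 1, I.cost v :=
    Finset.sum_congr rfl fun v hv => by simp [hg, hQ, hv]
  have e2 : ∑ v ∈ levelSet Mᶜ x 0, g v = ∑ v ∈ levelSet Mᶜ x 0, I.cost v * p v := by
    refine Finset.sum_congr rfl fun v hv => ?_
    have h3 := mem_levelSet.1 hv
    have h4 : v ∉ X := fun h => by
      have := (mem_levelSet.1 (hX h)).2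
      rw [h3.2] at this
      norm_num at this
    have h5 : v ∉ levelSet Mᶜ x 1 := fun h => by
      have := (mem_levelSet.1 h).2
      rw [h3.2] at this
      norm_num at this
    have : v ∉ Q := by
      rw [hQ, Finset.mem_union, Finset.mem_union]
      have := Finset.mem_compl.1 h3.1
      tauto
    simp [hg, this]
  -- A vertex of `X` is charged its full cost and any other half-integral vertex at most the
  -- fraction `P`. Written as a combination with weights `1 - P` and `P`, the first sum is
  -- controlled by the black box and the second by the LP.
  have e3 : ∑ v ∈ levelSet Mᶜ x (1 / 2), g v ≤
      (1 - P) * ∑ v ∈ X, I.cost v + P * ∑ v ∈ levelSet Mᶜ x (1 / 2), I.cost v := by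
    have : ∑ v ∈ X, I.cost v = ∑ v ∈ levelSet Mᶜ x (1 / 2), if v ∈ X then I.cost v else 0 := by
      rw [Finset.sum_ite_mem, Finset.inter_eq_right.2 hX]
    rw [this, Finset.mul_sum, Finset.mul_sum, ← Finset.sum_add_distrib]
    refine Finset.sum_le_sum fun v hv => ?_
    have h3 := mem_levelSet.1 hv
    have hc := I.cost_nonneg v
    by_cases hvX : v ∈ X
    · simp only [hg, hQ, Finset.mem_union, hvX, or_true, if_true]
      linarith
    · have h5 : v ∉ levelSet Mᶜ x 1 := fun h => by
        have := (mem_levelSet.1 h).2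
        rw [h3.2] at this
        norm_num at this
      have hvM := Finset.mem_compl.1 h3.1
      simp only [hg, hQ, Finset.mem_union, hvX, hvM, h5, or_self, if_false]
      have : p v ≤ P := le_min (hM' v hvM) (hp1 v)
      nlinarith
  rw [e0, e1, e2]
  set q0 := ∑ v ∈ levelSet Mᶜ x 0, I.cost v * q v
  set q1 := ∑ v ∈ levelSet Mᶜ x 1, I.cost v * q v
  set qh := ∑ v ∈ levelSet Mᶜ x (1 / 2), I.cost v * q v with hqh
  have hqh0 : 0 ≤ qh := Finset.sum_nonneg fun v hv =>
    mul_nonneg (I.cost_nonneg v) (hq.1 v (mem_levelSet.1 hv).1)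
  -- The factors `α` and `2` combine to `(1 - P) * α + 2 * P = α + (2 - α) * P ≤ R`.
  have hfin : (1 - P) * ∑ v ∈ X, I.cost v + P * ∑ v ∈ levelSet Mᶜ x (1 / 2), I.cost v ≤ R * qh := by
    have h3 : (1 - P) * ∑ v ∈ X, I.cost v ≤ (1 - P) * (α * qh) :=
      mul_le_mul_of_nonneg_left hXq (by linarith)
    have h4 : P * ∑ v ∈ levelSet Mᶜ x (1 / 2), I.cost v ≤ P * (2 * qh) :=
      mul_le_mul_of_nonneg_left (by linarith) hP0
    nlinarith
  linarith

end Instance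
end HypOrient

/-! ### Expected costs -/

namespace HypOrient

/-- Costs depend on the weights only through sets of vertices or families of such sets, which take
finitely many values; boundedness is then automatic and only measurable fibres remain to be checked.
-/
theorem integrable_comp_of_finite {Ω γ : Type*} [MeasurableSpace Ω] {μ : Measure Ω}
    [IsFiniteMeasure μ] [Finite γ] {Φ : Ω → γ} (hΦ : ∀ c, MeasurableSet (Φ ⁻¹' {c})) (g : γ → ℝ) :
    Integrable (fun w => g (Φ w)) μ := by
  let _ : MeasurableSpace γ := ⊤
  have hm : Measurable Φ := measurable_to_countable' hΦ
  obtain ⟨C, hC⟩ := (Set.finite_range fun c => ‖g c‖).bddAbove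
  refine Integrable.of_bound ((measurable_from_top (f := g)).comp hm).aestronglyMeasurable C ?_
  exact Filter.Eventually.of_forall fun w => hC ⟨Φ w, rfl⟩

variable {n m : ℕ}

namespace Instance

variable {I : Instance n m}

theorem measurable_lower (Q : Finset (Fin n)) (u : Fin n) :
    Measurable fun w : Fin n → ℝ => I.lower w Q u := by
  unfold lower
  split_ifs <;> fun_prop

theorem measurable_upper (Q : Finset (Fin n)) (u : Fin n) :
    Measurable fun w : Fin n → ℝ => I.upper w Q u := by
  unfold upper
  split_ifs <;> fun_prop

theorem measurableSet_feasible (Q : Finset (Fin n)) : MeasurableSet {w | I.Feasible w Q} := by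
  simp only [Feasible, identifies_iff]
  simp only [Set.ofPred_forall, Set.ofPred_exists, Set.ofPred_and]
  refine MeasurableSet.iInter fun j => MeasurableSet.iUnion fun v => ?_
  refine MeasurableSet.inter (MeasurableSet.const _) ?_
  refine MeasurableSet.iInter fun u => MeasurableSet.iInter fun _ => MeasurableSet.iInter fun _ => ?_
  exact measurableSet_le (measurable_upper Q v) (measurable_lower Q u)

/-- The family of feasible sets is the finite-valued statistic through which the optimum, the
optimal set and the mandatory vertices all depend on the weights. -/
theorem measurableSet_feasible_eq (c : Set (Finset (Fin n))) :
    MeasurableSet ((fun w => {Q | I.Feasible w Q}) ⁻¹' {c}) := by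
  have : (fun w => {Q | I.Feasible w Q}) ⁻¹' {c} =
      ⋂ Q, {w | I.Feasible w Q ↔ Q ∈ c} := by
    ext w
    simp [Set.ext_iff]
  rw [this]
  refine MeasurableSet.iInter fun Q => ?_
  by_cases hQ : Q ∈ c
  · simpa [hQ] using measurableSet_feasible Q
  · simp only [hQ, iff_false]
    exact (measurableSet_feasible Q).compl

theorem ae_realization : ∀ᵐ w ∂I.weightLaw, I.Realization w := by
  have : ∀ v, ∀ᵐ w ∂I.weightLaw, w v ∈ I.interval v := by
    intro v
    have h : ∀ᵐ x ∂I.law v, x ∈ I.interval v := by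
      rw [ae_iff]
      refine measure_mono_null (fun x hx => ?_)
        (measure_union_null (I.lo_spec v).1 (I.hi_spec v).1)
      simp only [interval, Set.mem_ofPred_eq, Set.mem_Ioo, not_and_or, not_lt] at hx
      exact hx
    exact (measurePreserving_eval I.law v).quasiMeasurePreserving.ae h
  exact ae_all_iff.2 this

theorem exists_optimal (w : Fin n → ℝ) : ∃ Q, I.Feasible w Q ∧ I.setCost Q = I.opt w := by
  have hne : (I.setCost '' {Q | I.Feasible w Q}).Nonempty := ⟨_, _, feasible_univ w, rfl⟩
  obtain ⟨Q, hQ, h⟩ := hne.csInf_mem (Set.toFinite _)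
  exact ⟨Q, hQ, h⟩

open Classical in
/-- A cheapest member of a family of sets. -/
def cheapest (I : Instance n m) (S : Set (Finset (Fin n))) : Finset (Fin n) :=
  if h : ∃ Q ∈ S, I.setCost Q = sInf (I.setCost '' S) then h.choose else ∅

/-- An optimal feasible query set. -/
def optimalSet (I : Instance n m) (w : Fin n → ℝ) : Finset (Fin n) :=
  I.cheapest {Q | I.Feasible w Q}

theorem optimalSet_spec (w : Fin n → ℝ) :
    I.Feasible w (I.optimalSet w) ∧ I.setCost (I.optimalSet w) = I.opt w := by
  have h : ∃ Q ∈ {Q | I.Feasible w Q}, I.setCost Q = sInf (I.setCost '' {Q | I.Feasible w Q}) :=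
    I.exists_optimal w
  unfold optimalSet cheapest
  rw [dif_pos h]
  exact h.choose_spec

theorem integrable_opt : Integrable I.opt I.weightLaw :=
  integrable_comp_of_finite (Φ := fun w => {Q | I.Feasible w Q}) measurableSet_feasible_eq
    fun S => sInf (I.setCost '' S)

theorem measurableSet_feasible_prop (p : Set (Finset (Fin n)) → Prop) :
    MeasurableSet {w | p {Q | I.Feasible w Q}} := by
  let _ : MeasurableSpace (Set (Finset (Fin n))) := ⊤
  exact measurable_to_countable' (measurableSet_feasible_eq (I := I))
    (MeasurableSpace.measurableSet_top (s := {S | p S}))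

theorem measurableSet_mandatory (v : Fin n) : MeasurableSet {w | I.Mandatory w v} :=
  measurableSet_feasible_prop fun S => ∀ Q ∈ S, v ∈ Q

/-- The optimal set is chosen as a function of the family of feasible sets rather than of `w`, so
even an arbitrary choice is measurable. -/
theorem measurableSet_mem_optimalSet (v : Fin n) : MeasurableSet {w | v ∈ I.optimalSet w} :=
  measurableSet_feasible_prop fun S => v ∈ I.cheapest S

theorem integral_sum_mem (T : Finset (Fin n)) {A : Fin n → Set (Fin n → ℝ)}
    (hA : ∀ v, MeasurableSet (A v)) :
    Integrable (fun w => ∑ v ∈ T, I.cost v * (A v).indicator 1 w) I.weightLaw ∧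
    ∫ w, ∑ v ∈ T, I.cost v * (A v).indicator 1 w ∂I.weightLaw =
      ∑ v ∈ T, I.cost v * I.weightLaw.real (A v) := by
  have hi : ∀ v, Integrable ((A v).indicator (1 : (Fin n → ℝ) → ℝ)) I.weightLaw := fun v =>
    (integrable_const (1 : ℝ)).indicator (hA v)
  constructor
  · exact integrable_finsetSum _ fun v _ => (hi v).const_mul _
  · rw [integral_finsetSum _ fun v _ => (hi v).const_mul _]
    refine Finset.sum_congr rfl fun v _ => ?_
    rw [integral_const_mul, integral_indicator_one (hA v)]

theorem setCost_eq_sum_indicator (T Q : Finset (Fin n)) :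
    ∑ v ∈ T, I.cost v * (if v ∈ Q then 1 else 0) = I.setCost (T ∩ Q) := by
  simp [setCost, Finset.sum_ite_mem]

/-- The competitive ratio of an algorithm that queries the threshold vertices, a half-integral
vertex cover rounded with an approximate vertex cover, and then only mandatory vertices. -/
theorem expected_cost_le {α ε : ℝ} (h1 : 1 ≤ α) (h2 : α ≤ 2) (hε : 0 < ε) {Y x : Fin n → ℝ}
    {X : Finset (Fin n)} (hY : ∀ v, |Y v - I.mandatoryProb v| ≤ ε)
    (hx : I.IsHalfIntegralOptimum (overThreshold (1 / ratio α ε + ε) Y)ᶜ x)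
    (hX : (I.coverInput (levelSet (overThreshold (1 / ratio α ε + ε) Y)ᶜ x
      (1 / 2))).IsApproxCover α X)
    {alg : (Fin n → ℝ) → Finset (Fin n)} (halg : ∀ Q, MeasurableSet {w | alg w = Q})
    (hsub : ∀ w, I.Realization w → ∀ v ∈ alg w,
      v ∈ overThreshold (1 / ratio α ε + ε) Y ∪
        levelSet (overThreshold (1 / ratio α ε + ε) Y)ᶜ x 1 ∪ X ∨ I.Mandatory w v) :
    Integrable (fun w => I.setCost (alg w)) I.weightLaw ∧
    ∫ w, I.setCost (alg w) ∂I.weightLaw ≤ ratio α ε * ∫ w, I.opt w ∂I.weightLaw := by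
  classical
  set M := overThreshold (1 / ratio α ε + ε) Y with hMdef
  set Q0 := M ∪ levelSet Mᶜ x 1 ∪ X
  have hint : Integrable (fun w => I.setCost (alg w)) I.weightLaw :=
    integrable_comp_of_finite (Φ := alg) halg I.setCost
  refine ⟨hint, ?_⟩
  set q : Fin n → ℝ := fun v => I.weightLaw.real {w | v ∈ I.optimalSet w} with hq
  have hopt : ∀ T : Finset (Fin n),
      ∫ w, I.setCost (T ∩ I.optimalSet w) ∂I.weightLaw = ∑ v ∈ T, I.cost v * q v := by
    intro T
    rw [← (integral_sum_mem T measurableSet_mem_optimalSet).2]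
    simp only [← setCost_eq_sum_indicator, Set.indicator_apply, Set.mem_ofPred_eq, Pi.one_apply]
  have hopt_int : ∀ T : Finset (Fin n),
      Integrable (fun w => I.setCost (T ∩ I.optimalSet w)) I.weightLaw := fun T =>
    integrable_comp_of_finite (Φ := fun w => {Q | I.Feasible w Q}) measurableSet_feasible_eq
      fun S => I.setCost (T ∩ I.cheapest S)
  -- Almost surely the optimal set covers the edge, so the probabilities of containing its two ends
  -- add up to at least `1`.
  have hqfeas : ∀ U, I.LPFeasible U q := by
    refine fun U => ⟨fun v _ => measureReal_nonneg, fun u _ v _ huv => ?_⟩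
    have hun : I.weightLaw.real ({w | u ∈ I.optimalSet w} ∪ {w | v ∈ I.optimalSet w}) = 1 := by
      rw [measureReal_def, measure_congr (Filter.eventuallyEq_univ.2 ?_), measure_univ,
        ENNReal.toReal_one]
      filter_upwards [I.ae_realization] with w hw
      exact Feasible.covers hw (optimalSet_spec w).1 huv
    rw [← hun]
    exact measureReal_union_le _ _
  have hpq : ∀ v, I.mandatoryProb v ≤ q v := fun v =>
    measureReal_mono fun w hw => hw _ (optimalSet_spec w).1
  have hcover := threshold_cost_le (I := I) (M := M) (X := X) (x := x) (p := I.mandatoryProb)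
    (q := q) h1 h2 hε hx (hqfeas _) hpq (fun v => measureReal_le_one)
    -- An error of at most `ε` turns the threshold `1 / R + ε` into `p ≥ 1 / R` on `M` and `p ≤ 1 /
    -- R + 2 * ε` outside.
    (fun v hv => by
      have := mem_overThreshold.1 hv
      linarith [(abs_le.1 (hY v)).2])
    (fun v hv => by
      have := mt mem_overThreshold.2 hv
      linarith [(abs_le.1 (hY v)).1])
    -- For almost every `w`, the optimal set cut down to the half-integral vertices is a cover of
    -- the input of the black box. Its guarantee therefore holds pointwise and can be integrated.
    hX.1.1 (by
      rw [← hopt, ← integral_const_mul]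
      calc ∑ v ∈ X, I.cost v = ∫ w, ∑ v ∈ X, I.cost v ∂I.weightLaw := by simp
        _ ≤ _ := by
          refine integral_mono_ae (integrable_const _) ((hopt_int _).const_mul _) ?_
          filter_upwards [I.ae_realization] with w hw
          refine hX.2 (levelSet Mᶜ x (1 / 2) ∩ I.optimalSet w)
            ⟨Finset.inter_subset_left, fun u hu v hv huv => ?_⟩
          rcases Feasible.covers hw (optimalSet_spec w).1 huv.1 with h | h
          · exact Or.inl (Finset.mem_inter.2 ⟨hu, h⟩)
          · exact Or.inr (Finset.mem_inter.2 ⟨hv, h⟩))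
  have hopt' : ∫ w, I.opt w ∂I.weightLaw = ∑ v, I.cost v * q v := by
    rw [← hopt]
    refine integral_congr_ae (Filter.Eventually.of_forall fun w => ?_)
    simp [(optimalSet_spec w).2]
  rw [hopt']
  refine le_trans ?_ hcover
  obtain ⟨hi, hs⟩ := integral_sum_mem (I := I) Q0ᶜ measurableSet_mandatory
  calc ∫ w, I.setCost (alg w) ∂I.weightLaw ≤
      ∫ w, (I.setCost Q0 + ∑ v ∈ Q0ᶜ, I.cost v * {w | I.Mandatory w v}.indicator 1 w)
        ∂I.weightLaw := by
        refine integral_mono_ae hint ((integrable_const _).add hi) ?_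
        filter_upwards [I.ae_realization] with w hw
        -- Only nonnegativity of the costs is needed: the algorithm may query fewer vertices than
        -- this set, never others.
        have h3 : I.setCost (alg w) ≤ I.setCost (Q0 ∪ Q0ᶜ.filter (I.Mandatory w)) := by
          refine Finset.sum_le_sum_of_subset_of_nonneg (fun v hv => ?_) fun v _ _ => I.cost_nonneg v
          rw [Finset.mem_union, Finset.mem_filter, Finset.mem_compl]
          have := hsub w hw v hv
          tauto
        refine h3.trans ?_
        rw [setCost, Finset.sum_union]
        · simp only [setCost, Finset.sum_filter, Set.indicator_apply, Set.mem_ofPred_eq,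
            Pi.one_apply, mul_ite, mul_one, mul_zero]
          exact le_rfl
        · rw [Finset.disjoint_left]
          intro v hv hv'
          exact Finset.mem_compl.1 (Finset.mem_filter.1 hv').1 hv
    _ = _ := by
        rw [integral_add (integrable_const _) hi, hs]
        simp only [integral_const, probReal_univ, one_smul]
        rfl

end Instance
end HypOrient

/-! ### Estimation of probabilities from independent samples -/

namespace HypOrient

open ProbabilityTheory in
-- Each centred summand is sub-Gaussian with parameter `1 / 4`. Only the length of the range is
-- fixed, so that the same bound applies to indicators with values in `[0, 1]` and to their
-- negatives in `[-1, 0]`, which give the two tails.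
theorem hoeffding_one_sided {Ω : Type*} [MeasurableSpace Ω] {μ : Measure Ω}
    [IsProbabilityMeasure μ] {k : ℕ} {X : Fin k → Ω → ℝ} (hm : ∀ i, Measurable (X i))
    (hind : iIndepFun X μ) {a b p : ℝ} (hab : b - a = 1) (hX : ∀ i ω, X i ω ∈ Set.Icc a b)
    (hp : ∀ i, μ[X i] = p) {ε : ℝ} (hε : 0 < ε) (hk : 0 < k) :
    μ.real {ω | k * ε ≤ ∑ i, X i ω - k * p} ≤ Real.exp (-(2 * k * ε ^ 2)) := by
  have hsub : ∀ i ∈ Finset.univ, HasSubgaussianMGF (fun ω => X i ω - p)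
      ((fun _ : Fin k => (‖b - a‖₊ / 2) ^ 2) i) μ := fun i _ => by
    rw [← hp i]
    exact hasSubgaussianMGF_of_mem_Icc (hm i).aemeasurable
      (Filter.Eventually.of_forall (hX i))
  have hind' : iIndepFun (fun i ω => X i ω - p) μ :=
    hind.comp (fun _ x => x - p) fun _ => by fun_prop
  have hk' : (0 : ℝ) < k := by exact_mod_cast hk
  have := HasSubgaussianMGF.measure_sum_ge_le_of_iIndepFun hind' hsub
    (show 0 ≤ k * ε by positivity)
  simp only [Finset.sum_sub_distrib, Finset.sum_const, Finset.card_univ, Fintype.card_fin,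
    nsmul_eq_mul, hab] at this
  refine this.trans (Real.exp_le_exp.2 (le_of_eq ?_))
  push_cast
  norm_num
  field_simp
  ring

open Classical in
/-- The fraction of the entries of `r` that belong to `S`. -/
def frequency {β : Type*} {k : ℕ} (S : Set β) (r : Fin k → β) : ℝ :=
  (∑ i, S.indicator (fun _ => (1 : ℝ)) (r i)) / k

theorem measurable_frequency {β : Type*} [MeasurableSpace β] {k : ℕ} {S : Set β}
    (hS : MeasurableSet S) : Measurable (frequency (k := k) S) := by
  unfold frequency
  refine Measurable.div_const (Finset.measurable_sum _ fun i _ => ?_) _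
  exact (measurable_const.indicator hS).comp (measurable_pi_apply i)

open ProbabilityTheory in
theorem frequency_close {β : Type*} [MeasurableSpace β] (μ : Measure β) [IsProbabilityMeasure μ]
    {k : ℕ} (hk : 0 < k) {S : Set β} (hS : MeasurableSet S) {ε : ℝ} (hε : 0 < ε) :
    1 - 2 * Real.exp (-(2 * k * ε ^ 2)) ≤
      (Measure.pi fun _ : Fin k => μ).real {r | |frequency S r - μ.real S| ≤ ε} := by
  set ν := Measure.pi fun _ : Fin k => μ with hν
  set X : Fin k → (Fin k → β) → ℝ := fun i r => S.indicator (fun _ => (1 : ℝ)) (r i) with hXdef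
  have hfm : Measurable (S.indicator (fun _ => (1 : ℝ))) := measurable_const.indicator hS
  have hm : ∀ i, Measurable (X i) := fun i => hfm.comp (measurable_pi_apply i)
  have hind : iIndepFun X ν := iIndepFun_pi (X := fun _ => S.indicator (fun _ => (1 : ℝ)))
    fun _ => hfm.aemeasurable
  have hX : ∀ i r, X i r ∈ Set.Icc (0 : ℝ) 1 := fun i r => by
    by_cases h : r i ∈ S <;> simp [hXdef, h]
  have hp : ∀ i, ν[X i] = μ.real S := fun i => by
    have h := integral_map (measurable_pi_apply i).aemeasurable (μ := ν)
      (f := S.indicator (fun _ => (1 : ℝ))) hfm.aestronglyMeasurable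
    rw [(measurePreserving_eval (fun _ : Fin k => μ) i).map_eq] at h
    rw [← integral_indicator_one hS]
    exact h.symm
  have hk' : (0 : ℝ) < k := by exact_mod_cast hk
  have hup := hoeffding_one_sided hm hind (by norm_num) hX hp hε hk
  have hdown := hoeffding_one_sided (X := fun i r => -X i r) (p := -μ.real S) (a := -1) (b := 0)
    (fun i => (hm i).neg) (hind.comp (fun _ x => -x) fun _ => by fun_prop) (by norm_num)
    (fun i r => by
      have := hX i r
      rw [Set.mem_Icc] at this ⊢
      constructor <;> linarith)
    (fun i => by rw [integral_neg, hp i]) hε hk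
  have hcompl : {r : Fin k → β | |frequency S r - μ.real S| ≤ ε}ᶜ ⊆
      {r | k * ε ≤ ∑ i, X i r - k * μ.real S} ∪
      {r | k * ε ≤ ∑ i, -X i r - k * -μ.real S} := by
    intro r hr
    simp only [Set.mem_compl_iff, Set.mem_ofPred_eq, abs_le, not_and_or, not_le] at hr
    have hsum : ∑ i, X i r = k * frequency S r := by
      rw [frequency, mul_div_cancel₀ _ hk'.ne']
    simp only [Set.mem_union, Set.mem_ofPred_eq, Finset.sum_neg_distrib, hsum]
    rcases hr with hr | hr
    · right; nlinarith
    · left; nlinarith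
  have hmeas : MeasurableSet {r : Fin k → β | |frequency S r - μ.real S| ≤ ε} :=
    measurableSet_le (measurable_norm.comp ((measurable_frequency hS).sub_const _)) measurable_const
  have h1 := measureReal_mono (μ := ν) hcompl
  rw [probReal_compl_eq_one_sub hmeas] at h1
  have h2 := measureReal_union_le (μ := ν) {r | k * ε ≤ ∑ i, X i r - k * μ.real S}
      {r | k * ε ≤ ∑ i, -X i r - k * -μ.real S}
  linarith

/-- With `t = (1 - δ) ^ (1 / n)`, the number of samples is the least natural number with `2 * exp
(-2 * k * ε ^ 2) ≤ 1 - t`, and `t ^ n = 1 - δ`. The last identity is where `n > 0` enters, since `1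
/ 0 = 0` would make `t = 1`. -/
theorem sampleCount_spec {n : ℕ} (hn : 0 < n) {ε δ : ℝ} (hε : 0 < ε) (hδ : 0 < δ) (hδ' : δ < 1) :
    0 < sampleCount n ε δ ∧ 0 ≤ 1 - 2 * Real.exp (-(2 * sampleCount n ε δ * ε ^ 2)) ∧
    1 - δ ≤ (1 - 2 * Real.exp (-(2 * sampleCount n ε δ * ε ^ 2))) ^ n := by
  set t := (1 - δ) ^ (1 / (n : ℝ)) with ht
  have hn' : (0 : ℝ) < n := by exact_mod_cast hn
  have ht0 : 0 < t := Real.rpow_pos_of_pos (by linarith) _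
  have ht1 : t < 1 := Real.rpow_lt_one (by linarith) (by linarith) (by positivity)
  have htn : t ^ n = 1 - δ := by
    rw [ht, ← Real.rpow_natCast, ← Real.rpow_mul (by linarith), one_div_mul_cancel hn'.ne',
      Real.rpow_one]
  have hlog : 0 < Real.log (2 / (1 - t)) :=
    Real.log_pos (by rw [lt_div_iff₀ (by linarith)]; linarith)
  have hle : Real.log (2 / (1 - t)) / (2 * ε ^ 2) ≤ sampleCount n ε δ := Nat.le_ceil _
  suffices h : t ≤ 1 - 2 * Real.exp (-(2 * sampleCount n ε δ * ε ^ 2)) from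
    ⟨Nat.ceil_pos.2 (by positivity), ht0.le.trans h, htn ▸ pow_le_pow_left₀ ht0.le h n⟩
  rw [div_le_iff₀ (by positivity)] at hle
  have : Real.exp (-(2 * sampleCount n ε δ * ε ^ 2)) ≤ Real.exp (-Real.log (2 / (1 - t))) :=
    Real.exp_le_exp.2 (by linarith)
  rw [Real.exp_neg (Real.log _), Real.exp_log (by apply div_pos <;> linarith)] at this
  have h2 : (2 / (1 - t))⁻¹ = (1 - t) / 2 := by rw [inv_div]
  linarith

namespace Instance

variable {n m : ℕ} (I : Instance n m)

/-- Realization number `i` for the estimate of vertex `v`, if each estimate uses `k` realizations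
and each single weight is taken from a new entry of the source. -/
def sampled (k : ℕ) (ω : ℕ → Fin n → ℝ) (v i : ℕ) : Fin n → ℝ := fun u => ω ((v * k + i) * n + u) u

/-- The estimates of the mandatory probabilities. -/
def estimate (k : ℕ) (ω : ℕ → Fin n → ℝ) (v : Fin n) : ℝ :=
  frequency {r | I.SomeOtherMinInside r v} fun i : Fin k => sampled k ω v i

theorem measurableSet_someOtherMinInside (v : Fin n) :
    MeasurableSet {r | I.SomeOtherMinInside r v} := by
  simp only [SomeOtherMinInside, Set.ofPred_forall, Set.ofPred_exists, Set.ofPred_and, ne_eq]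
  refine MeasurableSet.iUnion fun j => (MeasurableSet.const _).inter (MeasurableSet.inter ?_ ?_)
  · refine MeasurableSet.iUnion fun u => (MeasurableSet.const (u ∈ I.edge j)).inter
      (MeasurableSet.inter ?_ ?_)
    · exact MeasurableSet.iInter fun _ => MeasurableSet.const False
    exact measurableSet_lt (measurable_pi_apply u) measurable_const
  · refine MeasurableSet.iInter fun u => MeasurableSet.iInter fun _ => MeasurableSet.iInter fun _ => ?_
    exact measurableSet_lt measurable_const (measurable_pi_apply u)

/-- Samples may lie outside the intervals, where the tested event and mandatoriness can disagree,
but this has probability zero. -/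
theorem weightLaw_someOtherMinInside (v : Fin n) :
    I.weightLaw.real {r | I.SomeOtherMinInside r v} = I.mandatoryProb v := by
  refine measureReal_congr ?_
  filter_upwards [I.ae_realization] with w hw
  exact propext (mandatory_iff hw).symm

open ProbabilityTheory in
-- Distinct triples `(v, i, u)` read distinct entries of the tape, and the entry for `u` is read at
-- coordinate `u`. Hence all single weights are independent with the right laws; it remains to curry
-- the product measure twice.
theorem measurePreserving_sampled (k : ℕ) :
    MeasurePreserving (fun ω (v : Fin n) (i : Fin k) => sampled k ω v i) I.tapeLaw
      (Measure.pi fun _ => Measure.pi fun _ => I.weightLaw) := by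
  have hmeas : Measurable fun ω (v : Fin n) (i : Fin k) => sampled (n := n) k ω v i := by
    unfold sampled
    fun_prop
  refine ⟨hmeas, ?_⟩
  -- Without vertices the target is a one-point space, on which two probability measures agree;
  -- residues modulo `n` would make no sense there.
  rcases Nat.eq_zero_or_pos n with hn | hn
  · subst hn
    have : IsProbabilityMeasure I.tapeLaw := by unfold tapeLaw; infer_instance
    have := Measure.isProbabilityMeasure_map (μ := I.tapeLaw) hmeas.aemeasurable
    ext S -
    rcases S.eq_empty_or_nonempty with rfl | hS
    · simp
    · rw [Subsingleton.eq_univ_of_nonempty hS, measure_univ, measure_univ]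
  have hmod : ∀ t, t % n < n := fun t => Nat.mod_lt t hn
  set g : (Fin n × Fin k) × Fin n → ℕ := fun p => (p.1.1 * k + p.1.2) * n + p.2 with hg
  have hginj : Function.Injective g := by
    rintro ⟨⟨v, i⟩, u⟩ ⟨⟨v', i'⟩, u'⟩ h
    simp only [hg] at h
    have h1 : (u : ℕ) = u' := by
      have := congrArg (· % n) h
      simpa [Nat.mod_eq_of_lt u.2, Nat.mod_eq_of_lt u'.2] using this
    have h2 : (v * k + i : ℕ) = v' * k + i' := by
      rw [h1] at h
      exact Nat.eq_of_mul_eq_mul_right hn (Nat.add_right_cancel h)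
    have h3 : (i : ℕ) = i' := by
      have := congrArg (· % k) h2
      simpa [Nat.mod_eq_of_lt i.2, Nat.mod_eq_of_lt i'.2] using this
    have h4 : (v : ℕ) = v' := by
      rw [h3] at h2
      exact Nat.eq_of_mul_eq_mul_right i.pos (Nat.add_right_cancel h2)
    simp [Fin.ext_iff, h1, h3, h4]
  have hgmod : ∀ p, (⟨g p % n, hmod _⟩ : Fin n) = p.2 := fun p => by
    ext
    simp [hg, Nat.mod_eq_of_lt p.2.2]
  -- Independence over the tape needs one function for each entry `t`. Reading coordinate `t % n`
  -- works because `g p` has residue `p.2` modulo `n`.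
  have hind : iIndepFun (fun t (ω : ℕ → Fin n → ℝ) => ω t ⟨t % n, hmod t⟩) I.tapeLaw :=
    iIndepFun_infinitePi (X := fun t (r : Fin n → ℝ) => r ⟨t % n, hmod t⟩) fun t => by fun_prop
  have hmap := (hind.precomp hginj).map_fun_eq_infinitePi_map fun p => by fun_prop
  have hlaw : ∀ p, I.tapeLaw.map (fun ω => ω (g p) ⟨g p % n, hmod _⟩) = I.law p.2 := fun p => by
    rw [hgmod]
    exact ((measurePreserving_eval I.law p.2).comp
      (measurePreserving_eval_infinitePi (fun _ : ℕ => I.weightLaw) (g p))).map_eq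
  simp only [hlaw] at hmap
  have h1 := Measure.infinitePi_map_curry (fun (_ : Fin n × Fin k) (u : Fin n) => I.law u)
  have h2 := Measure.infinitePi_map_curry
    (fun (_ : Fin n) (_ : Fin k) => Measure.infinitePi fun u : Fin n => I.law u)
  rw [← h1, ← hmap, Measure.map_map (by fun_prop) (by fun_prop),
    Measure.map_map (by fun_prop) (by fun_prop)] at h2
  simp only [Measure.infinitePi_eq_pi] at h2
  refine Eq.trans ?_ h2
  congr 1
  ext ω v i u
  simp only [Function.comp, hgmod]
  rfl

/-- The estimates are functions of separate factors of a product measure, so the probability that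
all are accurate is a product of `n` factors, each at least the `n`-th root of `1 - δ`. -/
theorem estimates_close {k : ℕ} {ε δ : ℝ} (hε : 0 < ε) (hδ : 0 < δ) (hδ' : δ < 1)
    (hk : k = sampleCount n ε δ) :
    MeasurableSet {ω | ∀ v, |I.estimate k ω v - I.mandatoryProb v| ≤ ε} ∧
    1 - δ ≤ I.tapeLaw.real {ω | ∀ v, |I.estimate k ω v - I.mandatoryProb v| ≤ ε} := by
  set E : Fin n → Set (Fin k → Fin n → ℝ) := fun v =>
    {r | |frequency {r | I.SomeOtherMinInside r v} r - I.mandatoryProb v| ≤ ε} with hE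
  have hEm : ∀ v, MeasurableSet (E v) := fun v =>
    measurableSet_le (measurable_norm.comp
      ((measurable_frequency (I.measurableSet_someOtherMinInside v)).sub_const _)) measurable_const
  have heq : {ω | ∀ v, |I.estimate k ω v - I.mandatoryProb v| ≤ ε} =
      (fun ω (v : Fin n) (i : Fin k) => sampled k ω v i) ⁻¹' (Set.univ.pi E) := by
    ext ω
    simp [hE, estimate]
  have hpi : MeasurableSet (Set.univ.pi E) := MeasurableSet.univ_pi hEm
  rw [heq]
  have hmp := I.measurePreserving_sampled k
  refine ⟨hmp.measurable hpi, ?_⟩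
  rw [measureReal_def, hmp.measure_preimage hpi.nullMeasurableSet, Measure.pi_pi,
    ENNReal.toReal_prod]
  rcases Nat.eq_zero_or_pos n with hn | hn
  · subst hn
    simp [hδ.le]
  obtain ⟨hk0, hc, hb⟩ := sampleCount_spec hn hε hδ hδ'
  rw [← hk] at hk0 hc hb
  refine hb.trans ?_
  rw [← Fin.prod_const]
  refine Finset.prod_le_prod (fun _ _ => hc) fun v _ => ?_
  have := frequency_close I.weightLaw hk0 (I.measurableSet_someOtherMinInside v) hε
  rwa [weightLaw_someOtherMinInside] at this

end Instance
end HypOrient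

namespace HypOrient

/-! ### Which parts of the memory a program changes -/

/-- Whether a program may change natural array `a`. -/
def Cmd.writesNat : Cmd → ℕ → Bool
  | .skip, _ => false
  | .seq p q, a => p.writesNat a || q.writesNat a
  | .setNat b _ _ _, a => b == a
  | .setReal _ _ _ _, _ => false
  | .cond _ p q, a => p.writesNat a || q.writesNat a
  | .loop b _ p, a => b == a || p.writesNat a
  | .sample _ _ _ _, _ => false
  | .query _ _ _ _, _ => false
  | .cover _ _ _ t, a => t == a

/-- Whether a program may change real array `a`. -/
def Cmd.writesReal : Cmd → ℕ → Bool
  | .skip, _ => false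
  | .seq p q, a => p.writesReal a || q.writesReal a
  | .setNat _ _ _ _, _ => false
  | .setReal b _ _ _, a => b == a
  | .cond _ p q, a => p.writesReal a || q.writesReal a
  | .loop _ _ p, a => p.writesReal a
  | .sample b _ _ _, a => b == a
  | .query b _ _ _, a => b == a
  | .cover _ _ _ _, _ => false

def Cmd.noQuery : Cmd → Bool
  | .seq p q => p.noQuery && q.noQuery
  | .cond _ p q => p.noQuery && q.noQuery
  | .loop _ _ p => p.noQuery
  | .query _ _ _ _ => false
  | _ => true

def Cmd.noSample : Cmd → Bool
  | .seq p q => p.noSample && q.noSample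
  | .cond _ p q => p.noSample && q.noSample
  | .loop _ _ p => p.noSample
  | .sample _ _ _ _ => false
  | _ => true

def Cmd.noCover : Cmd → Bool
  | .seq p q => p.noCover && q.noCover
  | .cond _ p q => p.noCover && q.noCover
  | .loop _ _ p => p.noCover
  | .cover _ _ _ _ => false
  | _ => true

variable {n m : ℕ}

/-- The state at the start of pass `t` of a loop with counter `a`. -/
def State.enter (s : State n) (a t : ℕ) : State n :=
  { s with nat := put s.nat a 0 0 t, time := s.time + 1 }

/-- The state before pass `t` of a loop. -/
def Cmd.loopState (env : Env n) (a : ℕ) (p : Cmd) (s : State n) : ℕ → State n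
  | 0 => s.tick 1
  | t + 1 => p.exec env ((loopState env a p s t).enter a t)

theorem exec_loop (env : Env n) (a : ℕ) (e : NExp) (p : Cmd) (s : State n) :
    (Cmd.loop a e p).exec env s = p.loopState env a s (e.eval s) := by
  rw [Cmd.exec]
  generalize e.eval s = N
  induction N with
  | zero => rfl
  | succ N ih => rw [Cmd.loopState, ← ih]; rfl

/-- The states `s` and `s'` differ only in what the program `p` may change. -/
structure Frame (p : Cmd) (s s' : State n) : Prop where
  nat : ∀ a, p.writesNat a = false → s'.nat a = s.nat a
  real : ∀ a, p.writesReal a = false → s'.real a = s.real a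
  queries : p.noQuery = true → s'.queries = s.queries
  draws : p.noSample = true → s'.draws = s.draws
  calls : p.noCover = true → s'.calls = s.calls

theorem Frame.refl (p : Cmd) (s : State n) : Frame p s s :=
  ⟨fun _ _ => rfl, fun _ _ => rfl, fun _ => rfl, fun _ => rfl, fun _ => rfl⟩

theorem Frame.trans {p : Cmd} {s s' s'' : State n} (h : Frame p s s') (h' : Frame p s' s'') :
    Frame p s s'' :=
  ⟨fun a ha => (h'.nat a ha).trans (h.nat a ha), fun a ha => (h'.real a ha).trans (h.real a ha),
    fun hq => (h'.queries hq).trans (h.queries hq), fun hq => (h'.draws hq).trans (h.draws hq),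
    fun hq => (h'.calls hq).trans (h.calls hq)⟩

theorem put_of_ne {β : Type} (f : ℕ → ℕ → ℕ → β) {a a' : ℕ} (i j : ℕ) (y : β) (h : a' ≠ a) :
    put f a i j y a' = f a' := by
  funext i' j'
  simp [put, h]

theorem put_self {β : Type} (f : ℕ → ℕ → ℕ → β) (a i j : ℕ) (y : β) (i' j' : ℕ) :
    put f a i j y a i' j' = if i' = i ∧ j' = j then y else f a i' j' := by
  simp [put]

theorem frame_loopState {env : Env n} {a : ℕ} {e : NExp} {p : Cmd}
    (hp : ∀ s, Frame p s (p.exec env s)) (s : State n) (t : ℕ) :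
    Frame (.loop a e p) s (p.loopState env a s t) := by
  induction t with
  | zero => exact ⟨fun _ _ => rfl, fun _ _ => rfl, fun _ => rfl, fun _ => rfl, fun _ => rfl⟩
  | succ t ih =>
    refine ih.trans ?_
    have h := hp ((p.loopState env a s t).enter a t)
    refine ⟨fun b hb => ?_, fun b hb => ?_, fun hq => ?_, fun hq => ?_, fun hq => ?_⟩
    · simp only [Cmd.writesNat, Bool.or_eq_false_iff, beq_eq_false_iff_ne] at hb
      exact (h.nat b hb.2).trans (put_of_ne _ _ _ _ hb.1.symm)
    · exact h.real b hb
    · exact h.queries hq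
    · exact h.draws hq
    · exact h.calls hq

/-- What a command leaves alone is decided by computation on its text; for concrete commands the
side conditions below are closed by `rfl`. -/
theorem frame (env : Env n) (p : Cmd) (s : State n) : Frame p s (p.exec env s) := by
  induction p generalizing s with
  | skip => exact Frame.refl _ _
  | seq p q ihp ihq =>
    have h1 := ihp s
    have h2 := ihq (p.exec env s)
    refine ⟨fun a ha => ?_, fun a ha => ?_, fun hq => ?_, fun hq => ?_, fun hq => ?_⟩
    · simp only [Cmd.writesNat, Bool.or_eq_false_iff] at ha
      exact (h2.nat a ha.2).trans (h1.nat a ha.1)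
    · simp only [Cmd.writesReal, Bool.or_eq_false_iff] at ha
      exact (h2.real a ha.2).trans (h1.real a ha.1)
    · simp only [Cmd.noQuery, Bool.and_eq_true] at hq
      exact (h2.queries hq.2).trans (h1.queries hq.1)
    · simp only [Cmd.noSample, Bool.and_eq_true] at hq
      exact (h2.draws hq.2).trans (h1.draws hq.1)
    · simp only [Cmd.noCover, Bool.and_eq_true] at hq
      exact (h2.calls hq.2).trans (h1.calls hq.1)
  | setNat b i j e =>
    refine ⟨fun a ha => ?_, fun _ _ => rfl, fun _ => rfl, fun _ => rfl, fun _ => rfl⟩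
    simp only [Cmd.writesNat, beq_eq_false_iff_ne] at ha
    exact put_of_ne _ _ _ _ ha.symm
  | setReal b i j e =>
    refine ⟨fun _ _ => rfl, fun a ha => ?_, fun _ => rfl, fun _ => rfl, fun _ => rfl⟩
    simp only [Cmd.writesReal, beq_eq_false_iff_ne] at ha
    exact put_of_ne _ _ _ _ ha.symm
  | cond b p q ihp ihq =>
    rw [Cmd.exec]
    split_ifs
    · have h1 := ihp (s.tick 1)
      refine ⟨fun a ha => ?_, fun a ha => ?_, fun hq => ?_, fun hq => ?_, fun hq => ?_⟩
      · simp only [Cmd.writesNat, Bool.or_eq_false_iff] at ha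
        exact h1.nat a ha.1
      · simp only [Cmd.writesReal, Bool.or_eq_false_iff] at ha
        exact h1.real a ha.1
      · simp only [Cmd.noQuery, Bool.and_eq_true] at hq
        exact h1.queries hq.1
      · simp only [Cmd.noSample, Bool.and_eq_true] at hq
        exact h1.draws hq.1
      · simp only [Cmd.noCover, Bool.and_eq_true] at hq
        exact h1.calls hq.1
    · have h1 := ihq (s.tick 1)
      refine ⟨fun a ha => ?_, fun a ha => ?_, fun hq => ?_, fun hq => ?_, fun hq => ?_⟩
      · simp only [Cmd.writesNat, Bool.or_eq_false_iff] at ha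
        exact h1.nat a ha.2
      · simp only [Cmd.writesReal, Bool.or_eq_false_iff] at ha
        exact h1.real a ha.2
      · simp only [Cmd.noQuery, Bool.and_eq_true] at hq
        exact h1.queries hq.2
      · simp only [Cmd.noSample, Bool.and_eq_true] at hq
        exact h1.draws hq.2
      · simp only [Cmd.noCover, Bool.and_eq_true] at hq
        exact h1.calls hq.2
  | loop a e p ih =>
    rw [exec_loop]
    exact frame_loopState ih s _
  | sample a i j v =>
    rw [Cmd.exec]
    split_ifs
    · refine ⟨fun _ _ => rfl, fun a ha => ?_, fun _ => rfl, fun h => ?_, fun _ => rfl⟩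
      · simp only [Cmd.writesReal, beq_eq_false_iff_ne] at ha
        exact put_of_ne _ _ _ _ ha.symm
      · simp [Cmd.noSample] at h
    · exact ⟨fun _ _ => rfl, fun _ _ => rfl, fun _ => rfl, fun _ => rfl, fun _ => rfl⟩
  | query a i j v =>
    rw [Cmd.exec]
    split_ifs
    · refine ⟨fun _ _ => rfl, fun a ha => ?_, fun h => ?_, fun _ => rfl, fun _ => rfl⟩
      · simp only [Cmd.writesReal, beq_eq_false_iff_ne] at ha
        exact put_of_ne _ _ _ _ ha.symm
      · simp [Cmd.noQuery] at h
    · exact ⟨fun _ _ => rfl, fun _ _ => rfl, fun _ => rfl, fun _ => rfl, fun _ => rfl⟩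
  | cover S G C T =>
    refine ⟨fun a ha => ?_, fun _ _ => rfl, fun _ => rfl, fun _ => rfl, fun h => ?_⟩
    · simp only [Cmd.writesNat, beq_eq_false_iff_ne] at ha
      funext i j
      simp [Cmd.exec, ha.symm]
    · simp [Cmd.noCover] at h

/-- The step receives the frame of the whole loop relative to the state before it, so invariants
need to mention only what the body changes. The number of passes is evaluated once, before the loop.
-/
theorem loop_rule {env : Env n} {a : ℕ} {e : NExp} {p : Cmd} {s : State n} {N : ℕ}
    (I : ℕ → State n → Prop) (hN : e.eval s = N) (h0 : I 0 (s.tick 1))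
    (step : ∀ t < N, ∀ s', Frame (.loop a e p) s s' → I t s' →
      I (t + 1) (p.exec env (s'.enter a t))) :
    I N ((Cmd.loop a e p).exec env s) := by
  rw [exec_loop, hN]
  have : ∀ t ≤ N, I t (p.loopState env a s t) := by
    intro t
    induction t with
    | zero => exact fun _ => h0
    | succ t ih =>
      exact fun ht => step t ht _ (frame_loopState (frame env p) s t) (ih (Nat.le_of_succ_le ht))
  exact this N le_rfl

/-! ### Searching -/

theorem NExp.eval_congr {s s' : State n} (h : s'.nat = s.nat) (e : NExp) :
    e.eval s' = e.eval s := by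
  induction e with
  | const k => rfl
  | cell a i j ihi ihj => rw [NExp.eval, NExp.eval, ihi, ihj, h]
  | add e f ihe ihf => rw [NExp.eval, NExp.eval, ihe, ihf]
  | sub e f ihe ihf => rw [NExp.eval, NExp.eval, ihe, ihf]

theorem RExp.eval_congr {s s' : State n} (h : s'.nat = s.nat) (h' : s'.real = s.real) (e : RExp) :
    e.eval s' = e.eval s := by
  induction e with
  | const k => rfl
  | cell a i j => rw [RExp.eval, RExp.eval, NExp.eval_congr h, NExp.eval_congr h, h']
  | add e f ihe ihf => rw [RExp.eval, RExp.eval, ihe, ihf]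
  | sub e f ihe ihf => rw [RExp.eval, RExp.eval, ihe, ihf]
  | mul e f ihe ihf => rw [RExp.eval, RExp.eval, ihe, ihf]
  | div e f ihe ihf => rw [RExp.eval, RExp.eval, ihe, ihf]

theorem Test.eval_congr {s s' : State n} (h : s'.nat = s.nat) (h' : s'.real = s.real) (b : Test) :
    b.eval s' ↔ b.eval s := by
  induction b with
  | natLE e f => rw [Test.eval, Test.eval, NExp.eval_congr h, NExp.eval_congr h]
  | realLE e f => rw [Test.eval, Test.eval, RExp.eval_congr h h', RExp.eval_congr h h']
  | neg b ih => rw [Test.eval, Test.eval, ih]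
  | both b c ihb ihc => rw [Test.eval, Test.eval, ihb, ihc]

/-- Set the flag `(0, 0)` of array `f` to `1` if, for some value of the counter `c` below `e`, the
test holds after running `pre`, and to `0` otherwise. -/
def Cmd.search (f c : ℕ) (e : NExp) (pre : Cmd) (b : Test) : Cmd :=
  .seq (.setNat f (.const 0) (.const 0) (.const 0))
    (.loop c e (.seq pre (.cond b (.setNat f (.const 0) (.const 0) (.const 1)) .skip)))

/-- The test is analysed once, for an arbitrary state that agrees with the initial one on all arrays
the loop does not touch. Uses of the lemma therefore need no induction, and searches can be nested
through `pre`. -/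
theorem search_spec {env : Env n} {f c N : ℕ} {e : NExp} {pre : Cmd} {b : Test} {s : State n}
    (T : Fin N → Prop) (hfc : f ≠ c) (hf : f ≠ 0) (hpf : pre.writesNat f = false)
    (hN : ∀ s' : State n, s'.nat 0 = s.nat 0 → e.eval s' = N)
    (hT : ∀ (t : Fin N) (s' : State n),
      (∀ a, a ≠ f → a ≠ c → pre.writesNat a = false → s'.nat a = s.nat a) →
      (∀ a, pre.writesReal a = false → s'.real a = s.real a) → s'.nat c 0 0 = t →
      (b.eval (pre.exec env s') ↔ T t)) :
    1 ≤ (((Cmd.search f c e pre b).exec env s).nat f 0 0) ↔ ∃ t, T t := by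
  have key := loop_rule (env := env) (a := c) (e := e)
    (p := .seq pre (.cond b (.setNat f (.const 0) (.const 0) (.const 1)) .skip))
    (s := (Cmd.setNat f (.const 0) (.const 0) (.const 0)).exec env s) (N := N)
    (fun t s' => 1 ≤ s'.nat f 0 0 ↔ ∃ i : Fin N, i < t ∧ T i)
    (hN _ (put_of_ne _ _ _ _ hf.symm))
    (by simp [State.tick, Cmd.exec, NExp.eval, put_self])
    (by
      intro t ht s' hF hI
      have hb := hT ⟨t, ht⟩ ((s'.enter c t)) (fun a h1 h2 h3 => by
          have h4 := hF.nat a (by simp [Cmd.writesNat, h2.symm, h1.symm, h3])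
          rw [Cmd.exec] at h4
          simp only [put_of_ne _ _ _ _ h1] at h4
          simp only [State.enter, put_of_ne _ _ _ _ h2, h4])
        (fun a ha => hF.real a (by simp [Cmd.writesReal, ha])) (by simp [State.enter, put_self])
      have hle : (∃ i : Fin N, (i : ℕ) < t + 1 ∧ T i) ↔
          (∃ i : Fin N, (i : ℕ) < t ∧ T i) ∨ T ⟨t, ht⟩ := by
        constructor
        · rintro ⟨i, hi, hTi⟩
          rcases Nat.lt_succ_iff_lt_or_eq.1 hi with h | h
          · exact Or.inl ⟨i, h, hTi⟩
          · have : i = ⟨t, ht⟩ := Fin.ext h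
            exact Or.inr (this ▸ hTi)
        · rintro (⟨i, hi, hTi⟩ | h)
          · exact ⟨i, by omega, hTi⟩
          · exact ⟨⟨t, ht⟩, by simp, h⟩
      have hpre : (pre.exec env (s'.enter c t)).nat f = s'.nat f := by
        rw [(frame env pre _).nat f hpf]
        simp [State.enter, put_of_ne _ _ _ _ hfc]
      rw [hle, ← hb, Cmd.exec, Cmd.exec]
      by_cases hbe : b.eval (pre.exec env (s'.enter c t))
      · rw [if_pos hbe]
        simp [Cmd.exec, NExp.eval, put_self, hbe]
      · rw [if_neg hbe]
        simp only [hbe, or_false, ← hI, Cmd.exec, State.tick, hpre])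
  refine Iff.trans (show _ ↔ _ from key) ?_
  constructor
  · rintro ⟨i, -, h⟩; exact ⟨i, h⟩
  · rintro ⟨i, h⟩; exact ⟨i, i.2, h⟩

/-! ### Tests -/

/-- The flag `(0, 0)` of array `a` is set. -/
def Test.flag (a : ℕ) : Test := .natLE (.const 1) (.cell a (.const 0) (.const 0))

def Test.natEq (e f : NExp) : Test := .both (.natLE e f) (.natLE f e)

def Test.realLT (e f : RExp) : Test := .neg (.realLE f e)

def Test.either (b c : Test) : Test := .neg (.both (.neg b) (.neg c))

theorem Test.eval_flag (s : State n) (a : ℕ) : (Test.flag a).eval s ↔ 1 ≤ s.nat a 0 0 := Iff.rfl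

theorem Test.eval_natEq (s : State n) (e f : NExp) :
    (Test.natEq e f).eval s ↔ e.eval s = f.eval s := by
  simp only [Test.natEq, Test.eval]
  omega

theorem Test.eval_realLT (s : State n) (e f : RExp) :
    (Test.realLT e f).eval s ↔ e.eval s < f.eval s := by
  simp only [Test.realLT, Test.eval, not_le]

theorem Test.eval_either (s : State n) (b c : Test) :
    (Test.either b c).eval s ↔ b.eval s ∨ c.eval s := by
  simp only [Test.either, Test.eval]
  tauto

/-! ### Repeating steps until nothing changes -/

/-- A step from `c` to `c'` that does nothing if `G c`, and decreases the potential otherwise. -/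
def Improves {γ : Type*} (Φ : γ → ℤ) (G : γ → Prop) (c c' : γ) : Prop :=
  (G c ∧ c' = c) ∨ (¬ G c ∧ Φ c' < Φ c)

theorem Improves.le {γ : Type*} {Φ : γ → ℤ} {G : γ → Prop} {c c' : γ} (h : Improves Φ G c c') :
    Φ c' ≤ Φ c := by
  rcases h with ⟨-, rfl⟩ | ⟨-, h⟩
  · exact le_rfl
  · exact h.le

/-- Either both steps are idle, and then both conditions were checked on the same core, or one step
decreases the potential and the other cannot undo this. -/
theorem Improves.trans {γ : Type*} {Φ : γ → ℤ} {G G' : γ → Prop} {c c' c'' : γ}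
    (h : Improves Φ G c c') (h' : Improves Φ G' c' c'') :
    Improves Φ (fun c => G c ∧ G' c) c c'' := by
  have hle := h'.le
  rcases h with ⟨hG, rfl⟩ | ⟨hG, h⟩
  · rcases h' with ⟨hG', rfl⟩ | ⟨hG', h'⟩
    · exact Or.inl ⟨⟨hG, hG'⟩, rfl⟩
    · exact Or.inr ⟨fun h => hG' h.2, h'⟩
  · exact Or.inr ⟨fun h => hG h.1, by omega⟩

theorem Improves.congr {γ : Type*} {Φ : γ → ℤ} {G G' : γ → Prop} {c c' : γ}
    (h : Improves Φ G c c') (hG : G c ↔ G' c) : Improves Φ G' c c' := by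
  unfold Improves at *
  rwa [← hG]

/-- From states that satisfy `Inv`, the program keeps `Inv` and makes a step on the core. -/
def Cmd.Steps (env : Env n) (Inv : State n → Prop) {γ : Type*} (core : State n → γ) (Φ : γ → ℤ)
    (G : γ → Prop) (p : Cmd) (s : State n) : Prop :=
  Inv s → Inv (p.exec env s) ∧ Improves Φ G (core s) (core (p.exec env s))

theorem Cmd.Steps.seq {env : Env n} {Inv : State n → Prop} {γ : Type*} {core : State n → γ}
    {Φ : γ → ℤ} {G G' : γ → Prop} {p q : Cmd} {s : State n} (hp : p.Steps env Inv core Φ G s)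
    (hq : q.Steps env Inv core Φ G' (p.exec env s)) :
    (Cmd.seq p q).Steps env Inv core Φ (fun c => G c ∧ G' c) s := by
  intro h
  obtain ⟨h1, h2⟩ := hp h
  obtain ⟨h3, h4⟩ := hq h1
  exact ⟨h3, h2.trans h4⟩

theorem Cmd.Steps.loop {env : Env n} {Inv : State n → Prop} {γ : Type*} {core : State n → γ}
    {Φ : γ → ℤ} {N : ℕ} {G : Fin N → γ → Prop} {a : ℕ} {e : NExp} {p : Cmd} {s : State n}
    (hN : Inv s → e.eval s = N) (htick : ∀ s, Inv s → Inv (s.tick 1))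
    (htick' : ∀ s : State n, core (s.tick 1) = core s)
    (henter : ∀ s t, Inv s → Inv (s.enter a t)) (henter' : ∀ (s : State n) t, core (s.enter a t) = core s)
    (hp : ∀ (t : Fin N) (s : State n), s.nat a 0 0 = t → p.Steps env Inv core Φ (G t) s) :
    (Cmd.loop a e p).Steps env Inv core Φ (fun c => ∀ t, G t c) s := by
  intro hs
  have := loop_rule (env := env) (a := a) (e := e) (p := p) (s := s) (N := N)
    (fun t s' => Inv s' ∧ Improves Φ (fun c => ∀ i : Fin N, (i : ℕ) < t → G i c)
      (core s) (core s')) (hN hs)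
    ⟨htick s hs, Or.inl ⟨fun i hi => absurd hi (Nat.not_lt_zero _), htick' s⟩⟩
    (by
      rintro t ht s' - ⟨h1, h2⟩
      obtain ⟨h3, h4⟩ := hp ⟨t, ht⟩ (s'.enter a t) (by simp [State.enter, put_self])
        (henter _ _ h1)
      rw [henter'] at h4
      refine ⟨h3, (h2.trans h4).congr ?_⟩
      constructor
      · rintro ⟨h5, h6⟩ i hi
        rcases Nat.lt_succ_iff_lt_or_eq.1 hi with h | h
        · exact h5 i h
        · have : i = ⟨t, ht⟩ := Fin.ext h
          exact this ▸ h6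
      · exact fun h => ⟨fun i hi => h i (by omega), h _ (Nat.lt_succ_self t)⟩)
  refine ⟨this.1, this.2.congr ?_⟩
  exact ⟨fun h i => h i i.2, fun h i _ => h i⟩

/-- The program keeps `Inv`, and either it decreases the potential by `r`, or afterwards nothing
can change any more. -/
def Cmd.Settles (env : Env n) (Inv : State n → Prop) {γ : Type*} (core : State n → γ) (Φ : γ → ℤ)
    (G : γ → Prop) (r : ℕ) (p : Cmd) : Prop :=
  ∀ s, Inv s → Inv (p.exec env s) ∧ (G (core s) → core (p.exec env s) = core s) ∧
    (Φ (core (p.exec env s)) + r ≤ Φ (core s) ∨ G (core (p.exec env s)))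

/-- An idle step certifies that nothing can change; any other step lowers an integer, hence by at
least one. -/
theorem Cmd.Steps.settles {env : Env n} {Inv : State n → Prop} {γ : Type*} {core : State n → γ}
    {Φ : γ → ℤ} {G : γ → Prop} {p : Cmd} (hp : ∀ s, p.Steps env Inv core Φ G s) :
    p.Settles env Inv core Φ G 1 := by
  intro s hs
  obtain ⟨h1, h2⟩ := hp s hs
  refine ⟨h1, fun hG => ?_, ?_⟩
  · rcases h2 with h | h
    · exact h.2
    · exact absurd hG h.1
  · rcases h2 with h | h
    · rw [h.2]; exact Or.inr h.1
    · left; push_cast; linarith [h.2]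

/-- Once `G` holds the core is frozen, and until then every pass gains `r`. Since gains multiply
under nesting, nested loops with linear bounds realize a polynomial number of repetitions on a
machine whose index arithmetic has no multiplication. -/
theorem Cmd.Settles.loop {env : Env n} {Inv : State n → Prop} {γ : Type*} {core : State n → γ}
    {Φ : γ → ℤ} {N r : ℕ} {G : γ → Prop} {a : ℕ} {e : NExp} {p : Cmd}
    (hp : p.Settles env Inv core Φ G r)
    (hN : ∀ s, Inv s → e.eval s = N) (htick : ∀ s, Inv s → Inv (s.tick 1))
    (htick' : ∀ s : State n, core (s.tick 1) = core s)
    (henter : ∀ s t, Inv s → Inv (s.enter a t))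
    (henter' : ∀ (s : State n) t, core (s.enter a t) = core s) :
    (Cmd.loop a e p).Settles env Inv core Φ G (N * r) := by
  intro s hs
  exact loop_rule (env := env) (a := a) (e := e) (p := p) (s := s) (N := N)
    (fun t s' => Inv s' ∧ (G (core s) → core s' = core s) ∧
      (Φ (core s') + (t * r : ℕ) ≤ Φ (core s) ∨ G (core s'))) (hN s hs)
    ⟨htick s hs, fun _ => htick' s, Or.inl (by simp [htick'])⟩
    (by
      rintro t ht s' - ⟨h1, h2, h3⟩
      obtain ⟨h4, h5, h6⟩ := hp (s'.enter a t) (henter _ _ h1)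
      rw [henter'] at h5 h6
      refine ⟨h4, fun hG => ?_, ?_⟩
      · have := h2 hG
        rw [h5 (this ▸ hG), this]
      · rcases h3 with h3 | h3
        · rcases h6 with h6 | h6
          · left
            push_cast at h3 ⊢
            linarith
          · exact Or.inr h6
        · right
          rw [h5 h3]; exact h3)

/-! ### Running time -/

/-- The value of an expression that reads only natural array `0`, whose content is `D`. -/
def NExp.val (D : ℕ → ℕ → ℕ) : NExp → ℕ
  | .const k => k
  | .cell _ i j => D (i.val D) (j.val D)
  | .add e f => e.val D + f.val D
  | .sub e f => e.val D - f.val D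

/-- The expression reads only natural array `0`. -/
def NExp.static : NExp → Bool
  | .const _ => true
  | .cell a i j => a == 0 && i.static && j.static
  | .add e f => e.static && f.static
  | .sub e f => e.static && f.static

theorem NExp.eval_eq_val (s : State n) (e : NExp) (h : e.static = true) :
    e.eval s = e.val (s.nat 0) := by
  induction e with
  | const k => rfl
  | cell a i j ihi ihj =>
    simp only [NExp.static, Bool.and_eq_true, beq_iff_eq] at h
    rw [NExp.eval, NExp.val, ihi h.1.2, ihj h.2, h.1.1]
  | add e f ihe ihf =>
    simp only [NExp.static, Bool.and_eq_true] at h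
    rw [NExp.eval, NExp.val, ihe h.1, ihf h.2]
  | sub e f ihe ihf =>
    simp only [NExp.static, Bool.and_eq_true] at h
    rw [NExp.eval, NExp.val, ihe h.1, ihf h.2]

/-- The program makes no call of the vertex cover procedure and the numbers of passes of its loops
depend only on natural array `0`. -/
def Cmd.bounded : Cmd → Bool
  | .seq p q => p.bounded && q.bounded
  | .cond _ p q => p.bounded && q.bounded
  | .loop _ e p => e.static && p.bounded
  | .cover _ _ _ _ => false
  | _ => true

/-- An upper bound on the number of steps of a bounded program. -/
def Cmd.cost (D : ℕ → ℕ → ℕ) : Cmd → ℕ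
  | .skip => 0
  | .seq p q => p.cost D + q.cost D
  | .cond _ p q => 1 + p.cost D + q.cost D
  | .loop _ e p => 1 + e.val D * (1 + p.cost D)
  | _ => 1

/-- Natural array `0` is never written, so all loop bounds keep the values they have at the start.
The bound charges both branches of a conditional. -/
theorem time_le (env : Env n) (D : ℕ → ℕ → ℕ) (p : Cmd) (hp : p.bounded = true)
    (hw : p.writesNat 0 = false) (s : State n) (hs : s.nat 0 = D) :
    (p.exec env s).time ≤ s.time + p.cost D := by
  induction p generalizing s with
  | skip => exact Nat.le_refl _
  | seq p q ihp ihq =>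
    simp only [Cmd.bounded, Bool.and_eq_true] at hp
    simp only [Cmd.writesNat, Bool.or_eq_false_iff] at hw
    have h1 := ihp hp.1 hw.1 s hs
    have h2 := ihq hp.2 hw.2 (p.exec env s) (((frame env p s).nat 0 hw.1).trans hs)
    simp only [Cmd.exec, Cmd.cost]
    omega
  | setNat b i j e => exact Nat.le_refl _
  | setReal b i j e => exact Nat.le_refl _
  | cond b p q ihp ihq =>
    simp only [Cmd.bounded, Bool.and_eq_true] at hp
    simp only [Cmd.writesNat, Bool.or_eq_false_iff] at hw
    rw [Cmd.exec, Cmd.cost]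
    split_ifs
    · have h1 := ihp hp.1 hw.1 (s.tick 1) hs
      simp only [State.tick] at h1 ⊢
      omega
    · have h1 := ihq hp.2 hw.2 (s.tick 1) hs
      simp only [State.tick] at h1 ⊢
      omega
  | loop a e p ih =>
    have hp' := hp
    have hw' := hw
    simp only [Cmd.bounded, Bool.and_eq_true] at hp
    simp only [Cmd.writesNat, Bool.or_eq_false_iff, beq_eq_false_iff_ne] at hw
    refine (loop_rule (env := env) (a := a) (e := e) (p := p) (s := s)
      (fun t s' => s'.time ≤ s.time + (1 + t * (1 + p.cost D))) rfl
      (by simp [State.tick]) ?_).trans ?_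
    · intro t ht s' hF hI
      have h0 : (s'.enter a t).nat 0 = D := by
        simp only [State.enter]
        rw [put_of_ne _ _ _ _ hw.1.symm, hF.nat 0 hw', hs]
      have := ih hp.2 hw.2 (s'.enter a t) h0
      have h2 : (s'.enter a t).time = s'.time + 1 := rfl
      rw [h2] at this
      have h3 : (t + 1) * (1 + p.cost D) = t * (1 + p.cost D) + (1 + p.cost D) := by ring
      omega
    · rw [NExp.eval_eq_val s e hp.1, hs, Cmd.cost]
  | sample a i j v =>
    rw [Cmd.exec]
    split_ifs <;> exact Nat.le_refl _
  | query a i j v =>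
    rw [Cmd.exec]
    split_ifs <;> exact Nat.le_refl _
  | cover S G C T => simp [Cmd.bounded] at hp

/-! ### Dependence on the precise weights -/

/-- Precise weights enter the memory only through queries. This makes the estimates and the LP
solution independent of `w`. -/
theorem exec_congr_weight {tape : ℕ → Fin n → ℝ} {w w' : Fin n → ℝ} {B : BlackBox n} (p : Cmd)
    (hp : p.noQuery = true) (s : State n) :
    p.exec ⟨tape, w, B⟩ s = p.exec ⟨tape, w', B⟩ s := by
  induction p generalizing s with
  | seq p q ihp ihq =>
    simp only [Cmd.noQuery, Bool.and_eq_true] at hp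
    simp only [Cmd.exec]
    rw [ihp hp.1, ihq hp.2]
  | cond b p q ihp ihq =>
    simp only [Cmd.noQuery, Bool.and_eq_true] at hp
    simp only [Cmd.exec]
    rw [ihp hp.1, ihq hp.2]
  | loop a e p ih =>
    rw [exec_loop, exec_loop]
    generalize e.eval s = N
    induction N with
    | zero => rfl
    | succ N ihN => rw [Cmd.loopState, Cmd.loopState, ihN, ih hp]
  | query a i j v => simp [Cmd.noQuery] at hp
  | _ => rfl

end HypOrient

namespace HypOrient

variable {n m : ℕ}

/-! ### The input -/

/-- The input is still in memory. -/
structure Inputs (I : Instance n m) (k : ℕ) (d : ℝ) (s : State n) : Prop where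
  nat0 : s.nat 0 = (I.start k d).nat 0
  nat1 : s.nat 1 = (I.start k d).nat 1
  real0 : s.real 0 = (I.start k d).real 0
  real1 : s.real 1 = (I.start k d).real 1

/-- The program does not change the input. -/
def Cmd.keepsInputs (p : Cmd) : Bool :=
  !p.writesNat 0 && !p.writesNat 1 && !p.writesReal 0 && !p.writesReal 1

namespace Inputs

variable {I : Instance n m} {k : ℕ} {d : ℝ} {s s' : State n} (h : Inputs I k d s)
include h

theorem num_vertices : s.nat 0 0 0 = n := by rw [h.nat0]; simp [Instance.start]

theorem num_edges : s.nat 0 1 0 = m := by rw [h.nat0]; simp [Instance.start]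

theorem num_samples : s.nat 0 2 0 = k := by rw [h.nat0]; simp [Instance.start]

theorem incidence (j : Fin m) (v : Fin n) : 1 ≤ s.nat 1 j v ↔ v ∈ I.edge j := by
  rw [h.nat1]
  by_cases hv : v ∈ I.edge j <;> simp [Instance.start, hv]

theorem lo (v : Fin n) : s.real 0 v 0 = I.lo v := by rw [h.real0]; simp [Instance.start]

theorem hi (v : Fin n) : s.real 0 v 1 = I.hi v := by rw [h.real0]; simp [Instance.start]

theorem cost (v : Fin n) : s.real 0 v 2 = I.cost v := by rw [h.real0]; simp [Instance.start]

theorem threshold : s.real 1 0 0 = d := by rw [h.real1]; simp [Instance.start]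

theorem congr (h0 : s'.nat 0 = s.nat 0) (h1 : s'.nat 1 = s.nat 1) (h2 : s'.real 0 = s.real 0)
    (h3 : s'.real 1 = s.real 1) : Inputs I k d s' :=
  ⟨h0.trans h.nat0, h1.trans h.nat1, h2.trans h.real0, h3.trans h.real1⟩

theorem of_frame {p : Cmd} (hF : Frame p s s') (hp : p.keepsInputs = true) : Inputs I k d s' := by
  simp only [Cmd.keepsInputs, Bool.and_eq_true, Bool.not_eq_true'] at hp
  exact h.congr (hF.nat 0 hp.1.1.1) (hF.nat 1 hp.1.1.2) (hF.real 0 hp.1.2) (hF.real 1 hp.2)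

theorem exec {p : Cmd} (env : Env n) (hp : p.keepsInputs = true) : Inputs I k d (p.exec env s) :=
  h.of_frame (frame env p s) hp

theorem tick (t : ℕ) : Inputs I k d (s.tick t) := h.congr rfl rfl rfl rfl

theorem enter {a : ℕ} (ha : 2 ≤ a) (t : ℕ) : Inputs I k d (s.enter a t) :=
  h.congr (put_of_ne _ _ _ _ (by omega)) (put_of_ne _ _ _ _ (by omega)) rfl rfl

end Inputs

/-- Entry `(0, 0)` of a natural array. -/
abbrev NExp.var (a : ℕ) : NExp := .cell a (.const 0) (.const 0)

/-- Entry `(i, 0)` of a natural array. -/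
abbrev NExp.entry (a : ℕ) (i : NExp) : NExp := .cell a i (.const 0)

/-- Entry `(i, 0)` of a real array. -/
abbrev RExp.entry (a : ℕ) (i : NExp) : RExp := .cell a i (.const 0)

/-- The number of vertices. -/
abbrev NExp.vertices : NExp := .cell 0 (.const 0) (.const 0)

/-- The number of hyperedges. -/
abbrev NExp.edges : NExp := .cell 0 (.const 1) (.const 0)

/-- Hyperedge `j` contains vertex `v`. -/
abbrev Test.inc (j v : NExp) : Test := .natLE (.const 1) (.cell 1 j v)

abbrev RExp.lo (v : NExp) : RExp := .cell 0 v (.const 0)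

abbrev RExp.hi (v : NExp) : RExp := .cell 0 v (.const 1)

abbrev RExp.cost (v : NExp) : RExp := .cell 0 v (.const 2)

theorem Inputs.eval_vertices {I : Instance n m} {k : ℕ} {d : ℝ} {s : State n}
    (h : Inputs I k d s) (s' : State n) (h' : s'.nat 0 = s.nat 0) : NExp.vertices.eval s' = n := by
  simp only [NExp.eval, h', h.num_vertices]

theorem Inputs.eval_edges {I : Instance n m} {k : ℕ} {d : ℝ} {s : State n}
    (h : Inputs I k d s) (s' : State n) (h' : s'.nat 0 = s.nat 0) : NExp.edges.eval s' = m := by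
  simp only [NExp.eval, h', h.num_edges]

theorem exec_sample {env : Env n} {a : ℕ} {i j v : NExp} {s : State n} (u : Fin n)
    (hu : v.eval s = u) : (Cmd.sample a i j v).exec env s =
      { s with
        real := put s.real a (i.eval s) (j.eval s) (env.tape s.draws u)
        time := s.time + 1
        draws := s.draws + 1 } := by
  rw [Cmd.exec, dif_pos (by rw [hu]; exact u.2)]
  congr! 3
  exact Fin.ext hu

theorem exec_query {env : Env n} {a : ℕ} {i j v : NExp} {s : State n} (u : Fin n)
    (hu : v.eval s = u) : (Cmd.query a i j v).exec env s =
      { s with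
        real := put s.real a (i.eval s) (j.eval s) (env.weight u)
        time := s.time + 1
        queries := s.queries ++ [u] } := by
  have : (⟨v.eval s, by rw [hu]; exact u.2⟩ : Fin n) = u := Fin.ext hu
  rw [Cmd.exec, dif_pos (by rw [hu]; exact u.2), this]

theorem enter_nat_self (s : State n) (a t : ℕ) : (s.enter a t).nat a 0 0 = t := by
  simp [State.enter, put_self]

theorem enter_nat_of_ne (s : State n) {a b : ℕ} (h : b ≠ a) (t : ℕ) :
    (s.enter a t).nat b = s.nat b := put_of_ne _ _ _ _ h

/-! ### Estimates of the mandatory probabilities -/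

/-- Draw a sample of each weight. -/
def drawCmd : Cmd := .loop 22 .vertices (.sample 2 (.var 22) (.const 0) (.var 22))

theorem drawCmd_spec {I : Instance n m} {k : ℕ} {d : ℝ} {s : State n} (env : Env n)
    (h : Inputs I k d s) : (drawCmd.exec env s).draws = s.draws + n ∧
      ∀ u : Fin n, (drawCmd.exec env s).real 2 u 0 = env.tape (s.draws + u) u := by
  have := loop_rule (env := env) (a := 22) (e := .vertices)
    (p := .sample 2 (.var 22) (.const 0) (.var 22)) (s := s) (N := n)
    (fun t s' => s'.draws = s.draws + t ∧
      ∀ u : Fin n, (u : ℕ) < t → s'.real 2 u 0 = env.tape (s.draws + u) u)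
    h.num_vertices ⟨rfl, fun u hu => absurd hu (Nat.not_lt_zero _)⟩ (by
      rintro t ht s' - ⟨h1, h2⟩
      have hv : (NExp.var 22).eval (s'.enter 22 t) = (⟨t, ht⟩ : Fin n) := enter_nat_self s' 22 t
      rw [exec_sample _ hv]
      refine ⟨by simp only [State.enter]; omega, fun u hu => ?_⟩
      simp only [put_self, NExp.eval, enter_nat_self]
      rcases Nat.lt_succ_iff_lt_or_eq.1 hu with h | h
      · rw [if_neg (by omega)]
        exact h2 u h
      · subst h
        simp [State.enter, h1])
  exact ⟨this.1, fun u => this.2 u u.2⟩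

/-- Vertex `24` of hyperedge `23` is not vertex `20`. -/
def otherVertex : Test := .both (.inc (.var 23) (.var 24)) (.neg (.natEq (.var 24) (.var 20)))

/-- Decide whether the sampled weights make vertex `20` mandatory. -/
def hitCmd : Cmd :=
  .search 14 23 .edges
    (.seq
      (.search 12 24 .vertices .skip
        (.both otherVertex (.realLT (.entry 2 (.var 24)) (.hi (.var 20)))))
      (.search 13 24 .vertices .skip
        (.both otherVertex (.realLE (.entry 2 (.var 24)) (.lo (.var 20))))))
    (.both (.inc (.var 23) (.var 20)) (.both (.flag 12) (.neg (.flag 13))))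

/-- For each hyperedge, flag `12` records that some other sampled weight is below `hi v`, and flag
`13` that some other sampled weight is at most `lo v`; the hyperedge counts when the first is set
and the second is not. -/
theorem hitCmd_spec {I : Instance n m} {k : ℕ} {d : ℝ} {s : State n} (env : Env n)
    (h : Inputs I k d s) {v : Fin n} (hv : s.nat 20 0 0 = v) {r : Fin n → ℝ}
    (hr : ∀ u : Fin n, s.real 2 u 0 = r u) :
    1 ≤ (hitCmd.exec env s).nat 14 0 0 ↔ I.SomeOtherMinInside r v := by
  refine search_spec (fun j => v ∈ I.edge j ∧ (∃ u ∈ I.edge j, u ≠ v ∧ r u < I.hi v) ∧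
    ∀ u ∈ I.edge j, u ≠ v → I.lo v < r u) (by decide) (by decide) rfl h.eval_edges ?_
  intro j s' hn hR hj
  have h' : Inputs I k d s' := h.congr (hn 0 (by decide) (by decide) rfl)
    (hn 1 (by decide) (by decide) rfl) (hR 0 rfl) (hR 1 rfl)
  have hv' : s'.nat 20 0 0 = v := by rw [hn 20 (by decide) (by decide) rfl, hv]
  have hr' : ∀ u : Fin n, s'.real 2 u 0 = r u := fun u => by rw [hR 2 rfl, hr]
  rw [Cmd.exec]
  set p₁ := Cmd.search 12 24 .vertices .skip
        (.both otherVertex (.realLT (.entry 2 (.var 24)) (.hi (.var 20)))) with hp1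
  set p₂ := Cmd.search 13 24 .vertices .skip
        (.both otherVertex (.realLE (.entry 2 (.var 24)) (.lo (.var 20)))) with hp2
  have hF1 := frame env p₁ s'
  have hF2 := frame env p₂ (p₁.exec env s')
  have hi1 : Inputs I k d (p₁.exec env s') := h'.exec env rfl
  have hi2 : Inputs I k d (p₂.exec env (p₁.exec env s')) := hi1.exec env rfl
  have h12 : 1 ≤ (p₁.exec env s').nat 12 0 0 ↔ ∃ u, u ∈ I.edge j ∧ u ≠ v ∧ r u < I.hi v := by
    refine search_spec (fun u => u ∈ I.edge j ∧ u ≠ v ∧ r u < I.hi v) (by decide) (by decide) rfl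
      h'.eval_vertices ?_
    intro u s'' hn' hR' hu
    have h'' : Inputs I k d s'' := h'.congr (hn' 0 (by decide) (by decide) rfl)
      (hn' 1 (by decide) (by decide) rfl) (hR' 0 rfl) (hR' 1 rfl)
    simp only [Cmd.exec, Test.eval, otherVertex, Test.eval_natEq, Test.eval_realLT, NExp.eval,
      RExp.eval, hu, hn' 20 (by decide) (by decide) rfl, hn' 23 (by decide) (by decide) rfl,
      hv', hj, h''.incidence, h''.hi, hR' 2 rfl, hr', Fin.val_inj, and_assoc, ne_eq]
  have h13 : 1 ≤ (p₂.exec env (p₁.exec env s')).nat 13 0 0 ↔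
      ∃ u, u ∈ I.edge j ∧ u ≠ v ∧ r u ≤ I.lo v := by
    refine search_spec (fun u => u ∈ I.edge j ∧ u ≠ v ∧ r u ≤ I.lo v) (by decide) (by decide) rfl
      hi1.eval_vertices ?_
    intro u s'' hn' hR' hu
    have h'' : Inputs I k d s'' := hi1.congr (hn' 0 (by decide) (by decide) rfl)
      (hn' 1 (by decide) (by decide) rfl) (hR' 0 rfl) (hR' 1 rfl)
    simp only [Cmd.exec, Test.eval, otherVertex, Test.eval_natEq, NExp.eval,
      RExp.eval, hu, hn' 20 (by decide) (by decide) rfl, hn' 23 (by decide) (by decide) rfl,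
      hF1.nat 20 rfl, hF1.nat 23 rfl, hF1.real 2 rfl,
      hv', hj, h''.incidence, h''.lo, hR' 2 rfl, hr', Fin.val_inj, and_assoc, ne_eq]
  simp only [Test.eval, Test.eval_flag, NExp.eval, h13, hF2.nat 12 rfl, h12, hF2.nat 23 rfl,
    hF1.nat 23 rfl, hF2.nat 20 rfl, hF1.nat 20 rfl, hv', hj, hi2.incidence]
  push Not
  rfl

end HypOrient

namespace HypOrient

variable {n m : ℕ}

abbrev NExp.samples : NExp := .cell 0 (.const 2) (.const 0)

/-- Count in real array `4` the realizations that make vertex `20` mandatory. -/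
def countHitsCmd : Cmd :=
  .loop 21 .samples (.seq drawCmd (.seq hitCmd (.cond (.flag 14)
    (.setReal 4 (.var 20) (.const 0) (.add (.entry 4 (.var 20)) (.const 1))) .skip)))

/-- Before pass `t` exactly `(v * k + t) * n` samples have been drawn, so the draw for vertex `u`
reads entry `(v * k + t) * n + u`, in agreement with `Instance.sampled`. -/
theorem countHitsCmd_spec {I : Instance n m} {k : ℕ} {d : ℝ} {s : State n} (env : Env n)
    (h : Inputs I k d s) {v : Fin n} (hv : s.nat 20 0 0 = v) (hd : s.draws = v * k * n)
    (h0 : s.real 4 v 0 = 0) : (countHitsCmd.exec env s).draws = (v + 1) * k * n ∧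
      (countHitsCmd.exec env s).real 4 v 0 = ∑ i : Fin k,
        {r | I.SomeOtherMinInside r v}.indicator (fun _ => (1 : ℝ))
          (Instance.sampled k env.tape v i) := by
  have := loop_rule (env := env) (a := 21) (e := .samples)
    (p := .seq drawCmd (.seq hitCmd (.cond (.flag 14)
      (.setReal 4 (.var 20) (.const 0) (.add (.entry 4 (.var 20)) (.const 1))) .skip)))
    (s := s) (N := k)
    (fun t s' => s'.draws = (v * k + t) * n ∧
      s'.real 4 v 0 = ∑ i ∈ Finset.range t,
        {r | I.SomeOtherMinInside r v}.indicator (fun _ => (1 : ℝ))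
          (Instance.sampled k env.tape v i))
    h.num_samples ⟨by simpa [State.tick] using hd, by simpa [State.tick] using h0⟩ (by
      rintro t ht s' hF ⟨h1, h2⟩
      have hi0 : Inputs I k d (s'.enter 21 t) := (h.of_frame hF rfl).enter (by decide) t
      have hv0 : (s'.enter 21 t).nat 20 0 0 = v := by
        rw [enter_nat_of_ne _ (by decide), hF.nat 20 rfl, hv]
      obtain ⟨hd1, hr1⟩ := drawCmd_spec env hi0
      have hF1 := frame env drawCmd (s'.enter 21 t)
      set s1 := drawCmd.exec env (s'.enter 21 t) with hs1
      have hi1 : Inputs I k d s1 := hi0.exec env rfl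
      have hv1 : s1.nat 20 0 0 = v := by rw [hF1.nat 20 rfl, hv0]
      have hit := hitCmd_spec env hi1 hv1 (r := Instance.sampled k env.tape v t) (fun u => by
        rw [hr1]
        show env.tape (s'.draws + u) u = _
        rw [h1]
        rfl)
      have hF2 := frame env hitCmd s1
      set s2 := hitCmd.exec env s1 with hs2
      have hv2 : s2.nat 20 0 0 = v := by rw [hF2.nat 20 rfl, hv1]
      have hd2 : s2.draws = (v * k + (t + 1)) * n := by
        rw [hF2.draws rfl, hd1]
        show s'.draws + n = _
        rw [h1]; ring
      have hc2 : s2.real 4 v 0 = s'.real 4 v 0 := by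
        rw [hF2.real 4 rfl, hF1.real 4 rfl]; rfl
      rw [Cmd.exec, ← hs1, Cmd.exec, ← hs2, Cmd.exec, Finset.sum_range_succ]
      by_cases hflag : (Test.flag 14).eval s2
      · rw [if_pos hflag]
        rw [Test.eval_flag, hit] at hflag
        rw [Set.indicator_of_mem (show Instance.sampled k env.tape v t ∈ _ from hflag)]
        exact ⟨hd2, by simp [Cmd.exec, put_self, NExp.eval, RExp.eval, State.tick, hv2, hc2, h2]⟩
      · rw [if_neg hflag]
        rw [Test.eval_flag, hit] at hflag
        rw [Set.indicator_of_notMem (show Instance.sampled k env.tape v t ∉ _ from hflag)]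
        exact ⟨hd2, by simp [Cmd.exec, State.tick, hc2, h2]⟩)
  refine ⟨this.1.trans (by ring), this.2.trans ?_⟩
  rw [Finset.sum_range]

/-- Store the number of samples as a real number. -/
def samplesCmd : Cmd :=
  .seq (.setReal 3 (.const 0) (.const 0) (.const 0))
    (.loop 21 .samples (.setReal 3 (.const 0) (.const 0)
      (.add (.entry 3 (.const 0)) (.const 1))))

/-- Expressions offer no conversion of stored naturals to reals, so `k` is built by adding one `k`
times. -/
theorem samplesCmd_spec {I : Instance n m} {k : ℕ} {d : ℝ} {s : State n} (env : Env n)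
    (h : Inputs I k d s) : (samplesCmd.exec env s).real 3 0 0 = k := by
  have h' : Inputs I k d ((Cmd.setReal 3 (.const 0) (.const 0) (.const 0)).exec env s) :=
    h.exec env rfl
  exact loop_rule (env := env) (a := 21) (e := .samples) (N := k)
    (fun t s' => s'.real 3 0 0 = t) h'.num_samples
    (by simp [Cmd.exec, State.tick, put_self, RExp.eval, NExp.eval])
    (fun t _ s' _ h => by
      simp [Cmd.exec, put_self, RExp.eval, NExp.eval, State.enter, h])

/-- Mark in array `4` the vertices whose estimated mandatory probability is at least the
threshold. -/
def thresholdCmd : Cmd :=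
  .seq samplesCmd (.loop 20 .vertices
    (.seq (.setReal 4 (.var 20) (.const 0) (.const 0)) (.seq countHitsCmd
      (.cond (.realLE (.entry 1 (.const 0)) (.div (.entry 4 (.var 20)) (.entry 3 (.const 0))))
        (.setNat 4 (.var 20) (.const 0) (.const 1))
        (.setNat 4 (.var 20) (.const 0) (.const 0))))))

theorem thresholdCmd_spec {I : Instance n m} {k : ℕ} {d : ℝ} {s : State n} (env : Env n)
    (h : Inputs I k d s) (hd : s.draws = 0) : (thresholdCmd.exec env s).draws = n * k * n ∧
      ∀ v : Fin n, (thresholdCmd.exec env s).nat 4 v 0 =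
        if v ∈ overThreshold d (I.estimate k env.tape) then 1 else 0 := by
  have hi : Inputs I k d (samplesCmd.exec env s) := h.exec env rfl
  have hK := samplesCmd_spec env h
  have hd' : (samplesCmd.exec env s).draws = 0 := ((frame env samplesCmd s).draws rfl).trans hd
  set s₀ := samplesCmd.exec env s with hs0
  have := loop_rule (env := env) (a := 20) (e := .vertices)
    (p := .seq (.setReal 4 (.var 20) (.const 0) (.const 0)) (.seq countHitsCmd
      (.cond (.realLE (.entry 1 (.const 0)) (.div (.entry 4 (.var 20)) (.entry 3 (.const 0))))
        (.setNat 4 (.var 20) (.const 0) (.const 1))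
        (.setNat 4 (.var 20) (.const 0) (.const 0))))) (s := s₀) (N := n)
    (fun t s' => s'.draws = t * k * n ∧ ∀ v : Fin n, (v : ℕ) < t → s'.nat 4 v 0 =
        if v ∈ overThreshold d (I.estimate k env.tape) then 1 else 0)
    hi.num_vertices ⟨by simpa [State.tick] using hd', fun v hv => absurd hv (Nat.not_lt_zero _)⟩ (by
      rintro t ht s' hF ⟨h1, h2⟩
      have hF1 := frame env (.setReal 4 (.var 20) (.const 0) (.const 0)) (s'.enter 20 t)
      have h01 : ((Cmd.setReal 4 (.var 20) (.const 0) (.const 0)).exec env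
          (s'.enter 20 t)).real 4 t 0 = 0 := by
        simp [Cmd.exec, put_self, NExp.eval, RExp.eval, enter_nat_self]
      set s1 := (Cmd.setReal 4 (.var 20) (.const 0) (.const 0)).exec env (s'.enter 20 t) with hs1
      have hi1 : Inputs I k d s1 :=
        ((hi.of_frame hF rfl).enter (by decide) t).of_frame hF1 rfl
      have hv1 : s1.nat 20 0 0 = (⟨t, ht⟩ : Fin n) := by rw [hF1.nat 20 rfl, enter_nat_self]
      obtain ⟨hd2, hc2⟩ := countHitsCmd_spec env hi1 hv1 ((hF1.draws rfl).trans h1) h01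
      have hF2 := frame env countHitsCmd s1
      have hi2 : Inputs I k d (countHitsCmd.exec env s1) := hi1.exec env rfl
      set s2 := countHitsCmd.exec env s1 with hs2
      have hv2 : s2.nat 20 0 0 = t := by rw [hF2.nat 20 rfl, hv1]
      have h42 : ∀ v : Fin n, (v : ℕ) < t → s2.nat 4 v 0 =
          if v ∈ overThreshold d (I.estimate k env.tape) then 1 else 0 := fun v hv => by
        rw [hF2.nat 4 rfl, hF1.nat 4 rfl, enter_nat_of_ne _ (by decide), h2 v hv]
      have hK2 : s2.real 3 0 0 = k := by
        rw [hF2.real 3 rfl, hF1.real 3 rfl]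
        show s'.real 3 0 0 = k
        rw [hF.real 3 rfl, hK]
      have htest : (Test.realLE (.entry 1 (.const 0))
          (.div (.entry 4 (.var 20)) (.entry 3 (.const 0)))).eval s2 ↔
          (⟨t, ht⟩ : Fin n) ∈ overThreshold d (I.estimate k env.tape) := by
        simp only [Test.eval, RExp.eval, NExp.eval, hi2.threshold, hK2, hv2, mem_overThreshold]
        rw [show s2.real 4 t 0 = _ from hc2]
        rfl
      rw [Cmd.exec, ← hs1, Cmd.exec, ← hs2, Cmd.exec]
      have hstep : ∀ b : ℕ, b = (if (⟨t, ht⟩ : Fin n) ∈ overThreshold d (I.estimate k env.tape)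
          then 1 else 0) → ((Cmd.setNat 4 (.var 20) (.const 0) (.const b)).exec env
            (s2.tick 1)).draws = (t + 1) * k * n ∧ ∀ v : Fin n, (v : ℕ) < t + 1 →
            ((Cmd.setNat 4 (.var 20) (.const 0) (.const b)).exec env (s2.tick 1)).nat 4 v 0 =
              if v ∈ overThreshold d (I.estimate k env.tape) then 1 else 0 := by
        intro b hb
        refine ⟨hd2, fun v hv => ?_⟩
        simp only [Cmd.exec, put_self, NExp.eval, State.tick, hv2, and_true]
        rcases Nat.lt_succ_iff_lt_or_eq.1 hv with h | h
        · rw [if_neg (by omega), h42 v h]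
        · have : v = ⟨t, ht⟩ := Fin.ext h
          rw [if_pos h, this, hb]
      by_cases hb : (Test.realLE (.entry 1 (.const 0))
          (.div (.entry 4 (.var 20)) (.entry 3 (.const 0)))).eval s2
      · rw [if_pos hb]
        exact hstep 1 (by rw [if_pos (htest.1 hb)])
      · rw [if_neg hb]
        exact hstep 0 (by rw [if_neg (mt htest.2 hb)]))
  exact ⟨this.1, fun v => this.2 v v.2⟩

end HypOrient

namespace HypOrient

variable {n m : ℕ}

/-! ### Tabulating predicates -/

/-- Store in the entries `(v, i)` of array `a`, for all vertices `v`, whether the test holds after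
running `pre`. -/
def Cmd.mark (a c : ℕ) (i : NExp) (pre : Cmd) (b : Test) : Cmd :=
  .loop c .vertices (.seq pre (.cond b (.setNat a (.var c) i (.const 1))
    (.setNat a (.var c) i (.const 0))))

open Classical in
-- The second conclusion, that other columns survive, is what allows a matrix to be filled column by
-- column.
theorem mark_spec {I : Instance n m} {k : ℕ} {d : ℝ} {a c x : ℕ} {i : NExp} {pre : Cmd} {b : Test}
    {s : State n} (env : Env n) (h : Inputs I k d s) (T : Fin n → Prop) (hac : a ≠ c)
    (hpa : pre.writesNat a = false) (hpc : pre.writesNat c = false)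
    (hT : ∀ (v : Fin n) (s' : State n),
      (∀ a', a' ≠ a → a' ≠ c → pre.writesNat a' = false → s'.nat a' = s.nat a') →
      (∀ a', pre.writesReal a' = false → s'.real a' = s.real a') → s'.nat c 0 0 = v →
      (b.eval (pre.exec env s') ↔ T v) ∧ i.eval (pre.exec env s') = x) :
    (∀ v : Fin n, ((Cmd.mark a c i pre b).exec env s).nat a v x = if T v then 1 else 0) ∧
    ∀ v y : ℕ, y ≠ x → ((Cmd.mark a c i pre b).exec env s).nat a v y = s.nat a v y := by
  have := loop_rule (env := env) (a := c) (e := .vertices)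
    (p := .seq pre (.cond b (.setNat a (.var c) i (.const 1)) (.setNat a (.var c) i (.const 0))))
    (s := s) (N := n)
    (fun t s' => (∀ v : Fin n, (v : ℕ) < t → s'.nat a v x = if T v then 1 else 0) ∧
      ∀ v y : ℕ, y ≠ x → s'.nat a v y = s.nat a v y)
    h.num_vertices ⟨fun v hv => absurd hv (Nat.not_lt_zero _), fun _ _ _ => rfl⟩ (by
      rintro t ht s' hF ⟨h1, h2⟩
      obtain ⟨hb, hi⟩ := hT ⟨t, ht⟩ (s'.enter c t) (fun a' h3 h4 h5 => by
          rw [enter_nat_of_ne _ h4]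
          exact hF.nat a' (by simp [Cmd.writesNat, h3.symm, h4.symm, h5]))
        (fun a' h3 => hF.real a' (by simp [Cmd.writesReal, h3])) (enter_nat_self _ _ _)
      have hF1 := frame env pre (s'.enter c t)
      rw [Cmd.exec]
      set s1 := pre.exec env (s'.enter c t) with hs1
      have hc1 : s1.nat c 0 0 = t := by rw [hF1.nat c hpc, enter_nat_self]
      have ha1 : s1.nat a = s'.nat a := by rw [hF1.nat a hpa, enter_nat_of_ne _ hac]
      have hi' : i.eval (s1.tick 1) = x := (NExp.eval_congr (s := s1) (s' := s1.tick 1) rfl i).trans hi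
      have hstep : ∀ y : ℕ, y = (if T ⟨t, ht⟩ then 1 else 0) →
          (∀ v : Fin n, (v : ℕ) < t + 1 → ((Cmd.setNat a (.var c) i (.const y)).exec env
            (s1.tick 1)).nat a v x = if T v then 1 else 0) ∧
          ∀ v z : ℕ, z ≠ x → ((Cmd.setNat a (.var c) i (.const y)).exec env
            (s1.tick 1)).nat a v z = s.nat a v z := by
        intro y hy
        simp only [Cmd.exec, put_self, hi', NExp.eval]
        simp only [State.tick, hc1, ha1]
        refine ⟨fun v hv => ?_, fun v z hz => ?_⟩
        · rcases Nat.lt_succ_iff_lt_or_eq.1 hv with h | h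
          · rw [if_neg (by omega), h1 v h]
          · have : v = ⟨t, ht⟩ := Fin.ext h
            rw [if_pos ⟨h, trivial⟩, this, hy]
        · rw [if_neg (fun h => hz h.2), h2 v z hz]
      rw [Cmd.exec]
      by_cases hbe : b.eval s1
      · rw [if_pos hbe]
        exact hstep 1 (by rw [if_pos (hb.1 hbe)])
      · rw [if_neg hbe]
        exact hstep 0 (by rw [if_neg (mt hb.2 hbe)]))
  exact ⟨fun v => this.1 v v.2, this.2⟩

/-! ### The vertex cover instance -/

/-- Search for a hyperedge that makes vertices `20` and `21` adjacent. -/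
def adjacentCmd : Cmd :=
  .search 14 23 .edges
    (.seq
      (.search 12 24 .vertices .skip
        (.both (.inc (.var 23) (.var 24)) (.realLT (.lo (.var 24)) (.lo (.var 20)))))
      (.search 13 24 .vertices .skip
        (.both (.inc (.var 23) (.var 24)) (.realLT (.lo (.var 24)) (.lo (.var 21))))))
    (.both (.inc (.var 23) (.var 20)) (.both (.inc (.var 23) (.var 21))
      (.both (.either (.neg (.flag 12)) (.neg (.flag 13)))
        (.both (.realLT (.lo (.var 20)) (.hi (.var 21)))
          (.realLT (.lo (.var 21)) (.hi (.var 20)))))))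

/-- Flags `12` and `13` report a strictly smaller left end point in the hyperedge, so an unset flag
means that the corresponding vertex is leftmost. Intersection of the intervals becomes two
comparisons of end points, as in `coverGraph_adj`. -/
theorem adjacentCmd_spec {I : Instance n m} {k : ℕ} {d : ℝ} {s : State n} (env : Env n)
    (h : Inputs I k d s) {u v : Fin n} (hu : s.nat 20 0 0 = u) (hv : s.nat 21 0 0 = v) :
    1 ≤ (adjacentCmd.exec env s).nat 14 0 0 ↔ ∃ j, u ∈ I.edge j ∧ v ∈ I.edge j ∧
      (I.Leftmost j u ∨ I.Leftmost j v) ∧ I.lo u < I.hi v ∧ I.lo v < I.hi u := by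
  refine search_spec (fun j => u ∈ I.edge j ∧ v ∈ I.edge j ∧
      (I.Leftmost j u ∨ I.Leftmost j v) ∧ I.lo u < I.hi v ∧ I.lo v < I.hi u)
      (by decide) (by decide) rfl h.eval_edges ?_
  intro j s' hn hR hj
  have h' : Inputs I k d s' := h.congr (hn 0 (by decide) (by decide) rfl)
    (hn 1 (by decide) (by decide) rfl) (hR 0 rfl) (hR 1 rfl)
  have hu' : s'.nat 20 0 0 = u := by rw [hn 20 (by decide) (by decide) rfl, hu]
  have hv' : s'.nat 21 0 0 = v := by rw [hn 21 (by decide) (by decide) rfl, hv]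
  rw [Cmd.exec]
  set p₁ := Cmd.search 12 24 .vertices .skip
    (.both (.inc (.var 23) (.var 24)) (.realLT (.lo (.var 24)) (.lo (.var 20))))
  set p₂ := Cmd.search 13 24 .vertices .skip
    (.both (.inc (.var 23) (.var 24)) (.realLT (.lo (.var 24)) (.lo (.var 21))))
  have hF1 := frame env p₁ s'
  have hF2 := frame env p₂ (p₁.exec env s')
  have hi1 : Inputs I k d (p₁.exec env s') := h'.exec env rfl
  have hi2 : Inputs I k d (p₂.exec env (p₁.exec env s')) := hi1.exec env rfl
  have h12 : 1 ≤ (p₁.exec env s').nat 12 0 0 ↔ ∃ z, z ∈ I.edge j ∧ I.lo z < I.lo u := by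
    refine search_spec (fun z => z ∈ I.edge j ∧ I.lo z < I.lo u) (by decide) (by decide) rfl
      h'.eval_vertices ?_
    intro z s'' hn' hR' hz
    have h'' : Inputs I k d s'' := h'.congr (hn' 0 (by decide) (by decide) rfl)
      (hn' 1 (by decide) (by decide) rfl) (hR' 0 rfl) (hR' 1 rfl)
    simp only [Cmd.exec, Test.eval, Test.eval_realLT, NExp.eval,
      RExp.eval, hz, hn' 20 (by decide) (by decide) rfl, hn' 23 (by decide) (by decide) rfl,
      hu', hj, h''.incidence, h''.lo]
  have h13 : 1 ≤ (p₂.exec env (p₁.exec env s')).nat 13 0 0 ↔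
      ∃ z, z ∈ I.edge j ∧ I.lo z < I.lo v := by
    refine search_spec (fun z => z ∈ I.edge j ∧ I.lo z < I.lo v) (by decide) (by decide) rfl
      hi1.eval_vertices ?_
    intro z s'' hn' hR' hz
    have h'' : Inputs I k d s'' := hi1.congr (hn' 0 (by decide) (by decide) rfl)
      (hn' 1 (by decide) (by decide) rfl) (hR' 0 rfl) (hR' 1 rfl)
    simp only [Cmd.exec, Test.eval, Test.eval_realLT, NExp.eval,
      RExp.eval, hz, hn' 21 (by decide) (by decide) rfl, hn' 23 (by decide) (by decide) rfl,
      hF1.nat 21 rfl, hF1.nat 23 rfl, hv', hj, h''.incidence, h''.lo]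
  simp only [Test.eval, Test.eval_flag, Test.eval_either, Test.eval_realLT, NExp.eval, RExp.eval,
    h13, hF2.nat 12 rfl, h12, hF2.nat 23 rfl, hF1.nat 23 rfl, hF2.nat 20 rfl, hF1.nat 20 rfl,
    hF2.nat 21 rfl, hF1.nat 21 rfl, hu', hv', hj, hi2.incidence, hi2.lo, hi2.hi]
  push Not
  simp only [Instance.Leftmost]
  tauto

/-- Store in array `3` the adjacency matrix of the vertex cover instance on the vertices that are
not marked in array `4`. -/
def graphCmd : Cmd :=
  .loop 20 .vertices (.mark 3 21 (.var 20) adjacentCmd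
    (.both (.flag 14) (.both (.neg (.natEq (.var 20) (.var 21)))
      (.both (.natLE (.entry 4 (.var 20)) (.const 0)) (.natLE (.entry 4 (.var 21)) (.const 0))))))

open Classical in
theorem graphCmd_spec {I : Instance n m} {k : ℕ} {d : ℝ} {s : State n} (env : Env n)
    (h : Inputs I k d s) {M : Finset (Fin n)}
    (hM : ∀ v : Fin n, s.nat 4 v 0 = if v ∈ M then 1 else 0) (u v : Fin n) :
    (graphCmd.exec env s).nat 3 u v = if (restrict I.coverGraph Mᶜ).Adj u v then 1 else 0 := by
  refine loop_rule (env := env) (a := 20) (e := .vertices) (s := s) (N := n)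
    (fun t s' => ∀ v u : Fin n, (v : ℕ) < t → s'.nat 3 u v =
      if (restrict I.coverGraph Mᶜ).Adj u v then 1 else 0) h.num_vertices
    (fun _ _ h => absurd h (Nat.not_lt_zero _)) ?_ v u v.2
  intro t ht s' hF hI
  obtain ⟨z, rfl⟩ : ∃ z : Fin n, (z : ℕ) = t := ⟨⟨t, ht⟩, rfl⟩
  have hi1 : Inputs I k d (s'.enter 20 z) := (h.of_frame hF rfl).enter (by decide) z
  have hspec := mark_spec (a := 3) (c := 21) (i := .var 20) (x := z) (pre := adjacentCmd)
    (b := .both (.flag 14) (.both (.neg (.natEq (.var 20) (.var 21)))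
      (.both (.natLE (.entry 4 (.var 20)) (.const 0)) (.natLE (.entry 4 (.var 21)) (.const 0)))))
    env hi1 (fun u => (restrict I.coverGraph Mᶜ).Adj u z) (by decide) rfl rfl (by
      intro u s1 hn hR hu
      have hi2 : Inputs I k d s1 := hi1.congr (hn 0 (by decide) (by decide) rfl)
        (hn 1 (by decide) (by decide) rfl) (hR 0 rfl) (hR 1 rfl)
      have h20 : s1.nat 20 0 0 = z := by
        rw [hn 20 (by decide) (by decide) rfl, enter_nat_self]
      have h4 : ∀ v : Fin n, s1.nat 4 v 0 = if v ∈ M then 1 else 0 := fun v => by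
        rw [hn 4 (by decide) (by decide) rfl, enter_nat_of_ne _ (by decide), hF.nat 4 rfl, hM]
      have h4' : ∀ v : Fin n, s1.nat 4 v 0 ≤ 0 ↔ v ∉ M := fun v => by
        rw [h4]; split_ifs with hv <;> simp [hv]
      have hF2 := frame env adjacentCmd s1
      refine ⟨?_, by simp only [NExp.eval, hF2.nat 20 rfl, h20]⟩
      simp only [Test.eval, Test.eval_flag, Test.eval_natEq, NExp.eval,
        adjacentCmd_spec env hi2 h20 hu, hF2.nat 20 rfl, hF2.nat 21 rfl, hF2.nat 4 rfl, h20, hu,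
        h4', Fin.val_inj]
      simp only [restrict, Instance.coverGraph_adj, Finset.mem_compl]
      constructor
      · rintro ⟨⟨j, h5, h6, h7, h8, h9⟩, h10, h11, h12⟩
        exact ⟨⟨fun h => h10 h.symm, j, h6, h5, h7.symm, h9, h8⟩, h12, h11⟩
      · rintro ⟨⟨h10, j, h6, h5, h7, h9, h8⟩, h12, h11⟩
        exact ⟨⟨j, h5, h6, h7.symm, h8, h9⟩, fun h => h10 h.symm, h11, h12⟩)
  intro v u hv
  rcases Nat.lt_succ_iff_lt_or_eq.1 hv with h | h
  · rw [hspec.2 u v (by omega), enter_nat_of_ne _ (by decide), hI v u h]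
  · have : v = z := Fin.ext h
    rw [this]
    exact hspec.1 u

end HypOrient

/-! ### Half-integral optimal vertex covers by push-relabel -/

namespace HypOrient

variable {n : ℕ}

/-- A preflow in the bipartite double cover of a graph, with the label of each vertex on either
side. The amounts `eL u` at the left vertices are still to be sent, and `eR v` is the excess of
the flow into the right vertex `v` over its capacity. -/
@[ext]
structure Preflow (n : ℕ) where
  f : Fin n → Fin n → ℝ
  eL : Fin n → ℝ
  eR : Fin n → ℝ
  a : Fin n → ℕ
  b : Fin n → ℕ

namespace Preflow

/-- The invariants of the push-relabel algorithm with labels at most `V`. -/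
structure Valid (adj : Fin n → Fin n → Prop) (c : Fin n → ℝ) (V : ℕ) (F : Preflow n) : Prop where
  nonneg : ∀ u v, 0 ≤ F.f u v
  supp : ∀ u v, 0 < F.f u v → adj u v
  left : ∀ u, F.eL u = c u - ∑ v, F.f u v
  right : ∀ v, F.eR v = ∑ u, F.f u v - c v
  left_nonneg : ∀ u, 0 ≤ F.eL u
  -- The next three conditions say that a label drops by at most one along a residual arc: from `u`
  -- to `v` always, from `v` back to `u` if there is flow, and from a right vertex with spare
  -- capacity to a sink of label `0`.
  label : ∀ u v, adj u v → F.a u ≤ F.b v + 1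
  label' : ∀ u v, 0 < F.f u v → F.b v ≤ F.a u + 1
  deficit : ∀ v, F.eR v < 0 → F.b v ≤ 1
  a_le : ∀ u, F.a u ≤ V
  b_le : ∀ v, F.b v ≤ V

/-- Send `δ` more along the edge `uv`. -/
def shift (F : Preflow n) (u v : Fin n) (δ : ℝ) : Preflow n where
  f u' v' := if u' = u ∧ v' = v then F.f u v + δ else F.f u' v'
  eL u' := if u' = u then F.eL u - δ else F.eL u'
  eR v' := if v' = v then F.eR v + δ else F.eR v'
  a := F.a
  b := F.b

def raiseL (F : Preflow n) (u : Fin n) : Preflow n :=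
  { F with a := fun u' => if u' = u then F.a u + 1 else F.a u' }

def raiseR (F : Preflow n) (v : Fin n) : Preflow n :=
  { F with b := fun v' => if v' = v then F.b v + 1 else F.b v' }

/-- The condition for a push from the left vertex `u` to the right vertex `v`. -/
def CanPushL (adj : Fin n → Fin n → Prop) (u v : Fin n) (F : Preflow n) : Prop :=
  adj u v ∧ F.a u = F.b v + 1 ∧ 0 < F.eL u

/-- The condition for a push from the right vertex `v` to the left vertex `u`. -/
def CanPushR (u v : Fin n) (F : Preflow n) : Prop :=
  0 < F.f u v ∧ F.b v = F.a u + 1 ∧ 0 < F.eR v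

def CanRaiseL (adj : Fin n → Fin n → Prop) (V : ℕ) (u : Fin n) (F : Preflow n) : Prop :=
  0 < F.eL u ∧ F.a u < V ∧ ¬ ∃ v, adj u v ∧ F.a u = F.b v + 1

def CanRaiseR (V : ℕ) (v : Fin n) (F : Preflow n) : Prop :=
  0 < F.eR v ∧ F.b v < V ∧ ¬ ∃ u, 0 < F.f u v ∧ F.b v = F.a u + 1

/-- A quantity that every push and every relabelling decreases. -/
def potential (V : ℕ) (F : Preflow n) : ℤ :=
  ∑ u, (if 0 < F.eL u then (F.a u : ℤ) else 0) + ∑ v, (if 0 < F.eR v then (F.b v : ℤ) else 0) -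
    (V + 1) * ∑ u, ∑ v, (if 0 < F.f u v then (F.a u : ℤ) else F.b v) -
    2 * ∑ u, (F.a u : ℤ) - 2 * ∑ v, (F.b v : ℤ)

theorem sum_le_sum_add {g g' : Fin n → ℤ} (u : Fin n) (x : ℤ) (h : ∀ w, w ≠ u → g' w ≤ g w)
    (hu : g' u ≤ g u + x) : ∑ w, g' w ≤ ∑ w, g w + x := by
  rw [← Finset.add_sum_erase _ _ (Finset.mem_univ u), ← Finset.add_sum_erase _ g (Finset.mem_univ u)]
  have := Finset.sum_le_sum fun w (hw : w ∈ Finset.univ.erase u) => h w (Finset.ne_of_mem_erase hw)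
  linarith

variable {adj : Fin n → Fin n → Prop} {c : Fin n → ℝ} {V : ℕ} {F : Preflow n}

theorem Valid.shift (h : F.Valid adj c V) {u v : Fin n} {δ : ℝ} (hadj : adj u v)
    (hf : 0 ≤ F.f u v + δ) (hL : 0 ≤ F.eL u - δ) (hR : F.eR v + δ < 0 → F.b v ≤ 1)
    (hlabel : F.b v ≤ F.a u + 1) : (F.shift u v δ).Valid adj c V where
  nonneg u' v' := by
    simp only [Preflow.shift]
    split_ifs
    · exact hf
    · exact h.nonneg _ _
  supp u' v' := by
    simp only [Preflow.shift]
    split_ifs with h1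
    · exact fun _ => h1.1 ▸ h1.2 ▸ hadj
    · exact h.supp _ _
  left u' := by
    simp only [Preflow.shift]
    by_cases hu : u' = u
    · subst hu
      have : ∀ v', (if v' = v then F.f u' v + δ else F.f u' v') =
          F.f u' v' + if v' = v then δ else 0 := fun v' => by
        by_cases h1 : v' = v <;> simp [h1]
      simp only [true_and, this, Finset.sum_add_distrib, Finset.sum_ite_eq', Finset.mem_univ, if_true]
      rw [h.left]; ring
    · simp only [hu, false_and, if_false]
      exact h.left u'
  right v' := by
    simp only [Preflow.shift]
    by_cases hv : v' = v
    · subst hv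
      have : ∀ u', (if u' = u then F.f u v' + δ else F.f u' v') =
          F.f u' v' + if u' = u then δ else 0 := fun u' => by
        by_cases h1 : u' = u <;> simp [h1]
      simp only [and_true, this, Finset.sum_add_distrib, Finset.sum_ite_eq', Finset.mem_univ, if_true]
      rw [h.right]; ring
    · simp only [hv, and_false, if_false]
      exact h.right v'
  left_nonneg u' := by
    simp only [Preflow.shift]
    split_ifs
    · exact hL
    · exact h.left_nonneg _
  label := h.label
  label' u' v' := by
    simp only [Preflow.shift]
    split_ifs with h1
    · exact fun _ => h1.1 ▸ h1.2 ▸ hlabel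
    · exact h.label' _ _
  deficit v' := by
    simp only [Preflow.shift]
    split_ifs with h1
    · exact fun h2 => h1 ▸ hR h2
    · exact h.deficit _
  a_le := h.a_le
  b_le := h.b_le

/-- The numbers `x` and `y` bound the growth of the active terms at `u` and `v`, and `-z` is a
guaranteed gain of the edge term. A push that exhausts the excess of a vertex moves activity to a
label lower by one. A push that empties an edge raises its term from `a u` to `b v = a u + 1`, which
is worth `V + 1` and so outweighs a newly active vertex of label at most `V`. -/
theorem potential_shift_lt {u v : Fin n} {δ : ℝ} {x y z : ℤ}
    (hx : (if 0 < F.eL u - δ then (F.a u : ℤ) else 0) ≤ (if 0 < F.eL u then (F.a u : ℤ) else 0) + x)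
    (hy : (if 0 < F.eR v + δ then (F.b v : ℤ) else 0) ≤ (if 0 < F.eR v then (F.b v : ℤ) else 0) + y)
    (hz : (if 0 < F.f u v then (F.a u : ℤ) else F.b v) ≤
      (if 0 < F.f u v + δ then (F.a u : ℤ) else F.b v) + z) (hneg : x + y + (V + 1) * z < 0) :
    (F.shift u v δ).potential V < F.potential V := by
  have h1 := sum_le_sum_add (g := fun u => if 0 < F.eL u then (F.a u : ℤ) else 0)
    (g' := fun u' => if 0 < (F.shift u v δ).eL u' then ((F.shift u v δ).a u' : ℤ) else 0) u x
    (fun w hw => by simp [Preflow.shift, hw]) (by simpa [Preflow.shift] using hx)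
  have h2 := sum_le_sum_add (g := fun v => if 0 < F.eR v then (F.b v : ℤ) else 0)
    (g' := fun v' => if 0 < (F.shift u v δ).eR v' then ((F.shift u v δ).b v' : ℤ) else 0) v y
    (fun w hw => by simp [Preflow.shift, hw]) (by simpa [Preflow.shift] using hy)
  have h3 := sum_le_sum_add (g' := fun u => ∑ v, if 0 < F.f u v then (F.a u : ℤ) else F.b v)
    (g := fun u' => ∑ v', if 0 < (F.shift u v δ).f u' v' then ((F.shift u v δ).a u' : ℤ)
      else (F.shift u v δ).b v') u z
    (fun w hw => by simp [Preflow.shift, hw])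
    (sum_le_sum_add v z (fun w hw => by simp [Preflow.shift, hw])
      (by simpa [Preflow.shift] using hz))
  unfold potential
  have ha : (F.shift u v δ).a = F.a := rfl
  have hb : (F.shift u v δ).b = F.b := rfl
  simp only [ha, hb] at h1 h2 h3 ⊢
  have h4 : (0 : ℤ) ≤ V + 1 := by positivity
  nlinarith [mul_le_mul_of_nonneg_left h3 h4]

/-- Edges have no capacity, so the whole excess is sent and `u` becomes inactive, while `v` has a
label lower by one. If the edge was empty, its term rises, which only helps. -/
theorem Valid.pushL (h : F.Valid adj c V) {u v : Fin n} (hp : F.CanPushL adj u v) :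
    (F.shift u v (F.eL u)).Valid adj c V ∧
      (F.shift u v (F.eL u)).potential V < F.potential V := by
  obtain ⟨hadj, hl, he⟩ := hp
  have hf := h.nonneg u v
  refine ⟨h.shift hadj (by linarith) (by simp) (fun h1 => h.deficit v (by linarith)) (by omega), ?_⟩
  refine potential_shift_lt (x := -F.a u) (y := F.b v) (z := 0) ?_ ?_ ?_ ?_
  · simp [he]
  · split_ifs <;> omega
  · rw [if_pos (show 0 < F.f u v + F.eL u by linarith)]
    split_ifs <;> omega
  · rw [hl]; push_cast; linarith

/-- If all flow on the edge is returned, the edge term pays for the activation of `u`; otherwise `v`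
loses its excess and activity passes to the lower label `a u`. -/
theorem Valid.pushR (h : F.Valid adj c V) {u v : Fin n} (hp : F.CanPushR u v) :
    (F.shift u v (-min (F.f u v) (F.eR v))).Valid adj c V ∧
      (F.shift u v (-min (F.f u v) (F.eR v))).potential V < F.potential V := by
  obtain ⟨hf, hl, he⟩ := hp
  have hm1 := min_le_left (F.f u v) (F.eR v)
  have hm2 := min_le_right (F.f u v) (F.eR v)
  have hm : 0 < min (F.f u v) (F.eR v) := lt_min hf he
  have hle := h.left_nonneg u
  refine ⟨h.shift (h.supp u v hf) (by linarith) (by linarith)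
    (fun h1 => absurd h1 (by linarith)) hl.le, ?_⟩
  have haV := h.a_le u
  rcases le_total (F.f u v) (F.eR v) with h1 | h1
  · rw [min_eq_left h1]
    refine potential_shift_lt (x := V) (y := 0) (z := -1) ?_ ?_ ?_ ?_
    · split_ifs <;> omega
    · rw [if_pos he]
      split_ifs <;> omega
    · rw [if_pos hf, if_neg (by simp), hl]
      push_cast; linarith
    · linarith
  · rw [min_eq_right h1]
    refine potential_shift_lt (x := F.a u) (y := -F.b v) (z := if F.f u v = F.eR v then -1 else 0)
      ?_ ?_ ?_ ?_
    · split_ifs <;> omega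
    · simp [he]
    · rw [if_pos hf]
      by_cases h2 : F.f u v = F.eR v
      · rw [if_neg (by linarith), if_pos h2, hl]
        push_cast; linarith
      · rw [if_pos (by have := lt_of_le_of_ne h1 (Ne.symm h2); linarith), if_neg h2]
        linarith
    · have : (0 : ℤ) ≤ V := by positivity
      rw [hl]
      push_cast
      split_ifs <;> linarith

/-- The active sum grows by one and the term `-2 * ∑ a` falls by two; edge terms can only increase,
which lowers the potential. The label condition survives because no edge at `u` was tight. -/
theorem Valid.raiseL (h : F.Valid adj c V) {u : Fin n} (hp : F.CanRaiseL adj V u) :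
    (F.raiseL u).Valid adj c V ∧ (F.raiseL u).potential V < F.potential V := by
  obtain ⟨he, hV, hno⟩ := hp
  have ha : ∀ w, F.a w ≤ (F.raiseL u).a w := fun w => by
    by_cases hw : w = u <;> simp [Preflow.raiseL, hw]
  constructor
  · refine ⟨h.nonneg, h.supp, h.left, h.right, h.left_nonneg, fun u' v' hadj => ?_,
      fun u' v' hf => (h.label' u' v' hf).trans (by have := ha u'; omega), h.deficit, fun u' => ?_,
      h.b_le⟩
    · have := h.label u' v' hadj
      simp only [Preflow.raiseL]
      split_ifs with hu
      · subst hu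
        have : F.a u' ≠ F.b v' + 1 := fun h => hno ⟨v', hadj, h⟩
        omega
      · exact this
    · simp only [Preflow.raiseL]
      split_ifs
      · exact hV
      · exact h.a_le u'
  · have h1 := sum_le_sum_add (g := fun u => if 0 < F.eL u then (F.a u : ℤ) else 0)
      (g' := fun u' => if 0 < F.eL u' then ((F.raiseL u).a u' : ℤ) else 0) u 1
      (fun w hw => by simp [Preflow.raiseL, hw]) (by simp [Preflow.raiseL, he])
    have h2 := sum_le_sum_add (g' := fun u => (F.a u : ℤ))
      (g := fun u' => ((F.raiseL u).a u' : ℤ)) u (-1)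
      (fun w hw => by simp [Preflow.raiseL, hw]) (by simp [Preflow.raiseL])
    have h3 : ∑ u', ∑ v, (if 0 < F.f u' v then (F.a u' : ℤ) else F.b v) ≤
        ∑ u', ∑ v, (if 0 < F.f u' v then ((F.raiseL u).a u' : ℤ) else F.b v) :=
      Finset.sum_le_sum fun u' _ => Finset.sum_le_sum fun v _ => by
        have := ha u'
        split_ifs <;> omega
    unfold potential
    have e1 : (F.raiseL u).f = F.f := rfl
    have e2 : (F.raiseL u).b = F.b := rfl
    have e3 : (F.raiseL u).eL = F.eL := rfl
    have e4 : (F.raiseL u).eR = F.eR := rfl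
    rw [e1, e2, e3, e4]
    have h4 : (0 : ℤ) ≤ V + 1 := by positivity
    nlinarith [mul_le_mul_of_nonneg_left h3 h4]

theorem Valid.raiseR (h : F.Valid adj c V) {v : Fin n} (hp : F.CanRaiseR V v) :
    (F.raiseR v).Valid adj c V ∧ (F.raiseR v).potential V < F.potential V := by
  obtain ⟨he, hV, hno⟩ := hp
  have hb : ∀ w, F.b w ≤ (F.raiseR v).b w := fun w => by
    by_cases hw : w = v <;> simp [Preflow.raiseR, hw]
  constructor
  · refine ⟨h.nonneg, h.supp, h.left, h.right, h.left_nonneg,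
      fun u' v' hadj => (h.label u' v' hadj).trans (by have := hb v'; omega),
      fun u' v' hf => ?_, fun v' hd => ?_, h.a_le, fun v' => ?_⟩
    · have := h.label' u' v' hf
      simp only [Preflow.raiseR]
      split_ifs with hu
      · subst hu
        have : F.b v' ≠ F.a u' + 1 := fun h => hno ⟨u', hf, h⟩
        omega
      · exact this
    · simp only [Preflow.raiseR] at hd ⊢
      split_ifs with hv
      · subst hv
        linarith
      · exact h.deficit v' hd
    · simp only [Preflow.raiseR]
      split_ifs
      · exact hV
      · exact h.b_le v'
  · have h1 := sum_le_sum_add (g := fun v => if 0 < F.eR v then (F.b v : ℤ) else 0)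
      (g' := fun v' => if 0 < F.eR v' then ((F.raiseR v).b v' : ℤ) else 0) v 1
      (fun w hw => by simp [Preflow.raiseR, hw]) (by simp [Preflow.raiseR, he])
    have h2 := sum_le_sum_add (g' := fun v => (F.b v : ℤ))
      (g := fun v' => ((F.raiseR v).b v' : ℤ)) v (-1)
      (fun w hw => by simp [Preflow.raiseR, hw]) (by simp [Preflow.raiseR])
    have h3 : ∑ u', ∑ v', (if 0 < F.f u' v' then (F.a u' : ℤ) else F.b v') ≤
        ∑ u', ∑ v', (if 0 < F.f u' v' then (F.a u' : ℤ) else (F.raiseR v).b v') :=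
      Finset.sum_le_sum fun u' _ => Finset.sum_le_sum fun v' _ => by
        have := hb v'
        split_ifs <;> omega
    unfold potential
    have e1 : (F.raiseR v).f = F.f := rfl
    have e2 : (F.raiseR v).a = F.a := rfl
    have e3 : (F.raiseR v).eL = F.eL := rfl
    have e4 : (F.raiseR v).eR = F.eR := rfl
    rw [e1, e2, e3, e4]
    have h4 : (0 : ℤ) ≤ V + 1 := by positivity
    nlinarith [mul_le_mul_of_nonneg_left h3 h4]

theorem Valid.potential_ge (h : F.Valid adj c V) :
    -((V + 1) * (n * (n * V)) + 4 * (n * V) : ℤ) ≤ F.potential V := by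
  have h1 : (0 : ℤ) ≤ ∑ u, (if 0 < F.eL u then (F.a u : ℤ) else 0) :=
    Finset.sum_nonneg fun u _ => by split_ifs <;> positivity
  have h2 : (0 : ℤ) ≤ ∑ v, (if 0 < F.eR v then (F.b v : ℤ) else 0) :=
    Finset.sum_nonneg fun u _ => by split_ifs <;> positivity
  have h3 : ∑ u, ∑ v, (if 0 < F.f u v then (F.a u : ℤ) else F.b v) ≤ n * (n * V) := by
    have : ∀ u, ∑ v, (if 0 < F.f u v then (F.a u : ℤ) else F.b v) ≤ n * V := fun u => by
      refine (Finset.sum_le_card_nsmul _ _ (V : ℤ) fun v _ => ?_).trans (by simp)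
      have := h.a_le u
      have := h.b_le v
      split_ifs <;> omega
    exact (Finset.sum_le_card_nsmul _ _ _ fun u _ => this u).trans (by simp)
  have h4 : ∑ u, (F.a u : ℤ) ≤ n * V :=
    (Finset.sum_le_card_nsmul _ _ (V : ℤ) fun u _ => by exact_mod_cast h.a_le u).trans (by simp)
  have h5 : ∑ v, (F.b v : ℤ) ≤ n * V :=
    (Finset.sum_le_card_nsmul _ _ (V : ℤ) fun u _ => by exact_mod_cast h.b_le u).trans (by simp)
  have h6 := mul_le_mul_of_nonneg_left h3 (show (0 : ℤ) ≤ V + 1 by positivity)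
  unfold potential
  linarith

/-- The preflow at the start. -/
def initial (c : Fin n → ℝ) : Preflow n := ⟨fun _ _ => 0, c, fun v => -c v, fun _ => 0, fun _ => 1⟩

theorem initial_valid (hc : ∀ v, 0 ≤ c v) (hV : 1 ≤ V) : (initial c).Valid adj c V := by
  refine ⟨?_, ?_, ?_, ?_, ?_, ?_, ?_, ?_, ?_, ?_⟩ <;> simp [initial, hc, hV]

theorem initial_potential (hc : ∀ v, 0 ≤ c v) : (initial c).potential V ≤ 0 := by
  have : ∀ v, ¬ c v < 0 := fun v => not_lt.2 (hc v)
  simp only [potential, initial, Left.neg_pos_iff, this, lt_self_iff_false, if_false]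
  simp only [ite_self, Finset.sum_const_zero, Finset.sum_const, Finset.card_univ, Fintype.card_fin,
    nsmul_eq_mul, Nat.cast_zero, Nat.cast_one, ite_self]
  have h1 : (0 : ℤ) ≤ (V + 1) * (n * n) := by positivity
  have h2 : (0 : ℤ) ≤ n := by positivity
  linarith

/-- No push and no relabelling is possible. -/
def Stable (adj : Fin n → Fin n → Prop) (V : ℕ) (F : Preflow n) : Prop :=
  ∀ u, (∀ v, ¬ F.CanPushL adj u v ∧ ¬ F.CanPushR u v) ∧ ¬ F.CanRaiseL adj V u ∧ ¬ F.CanRaiseR V u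

theorem Stable.left (h : F.Stable adj V) {u : Fin n} (hu : 0 < F.eL u) : V ≤ F.a u := by
  by_contra! hlt
  refine (h u).2.1 ⟨hu, hlt, ?_⟩
  rintro ⟨v, h1, h2⟩
  exact ((h u).1 v).1 ⟨h1, h2, hu⟩

theorem Stable.right (h : F.Stable adj V) {v : Fin n} (hv : 0 < F.eR v) : V ≤ F.b v := by
  by_contra! hlt
  refine (h v).2.2 ⟨hv, hlt, ?_⟩
  rintro ⟨u, h1, h2⟩
  exact ((h u).1 v).2 ⟨h1, h2, hv⟩

/-- No vertex has the label `g`. -/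
def IsGap (F : Preflow n) (g : ℕ) : Prop := 1 ≤ g ∧ ∀ v, F.a v ≠ g ∧ F.b v ≠ g

/-- The `2 * n` vertex copies cannot use all of the at least `2 * n + 1` values from `1` to `V - 1`.
-/
theorem exists_gap (F : Preflow n) (hV : 2 * n + 2 ≤ V) : ∃ g < V, F.IsGap g := by
  by_contra! h
  have hsub : Finset.Ico 1 V ⊆ Finset.univ.image F.a ∪ Finset.univ.image F.b := by
    intro g hg
    rw [Finset.mem_Ico] at hg
    have := h g hg.2
    simp only [IsGap, hg.1, true_and, not_forall, not_and_or, not_not] at this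
    obtain ⟨v, hv | hv⟩ := this
    · exact Finset.mem_union_left _ (Finset.mem_image.2 ⟨v, Finset.mem_univ v, hv⟩)
    · exact Finset.mem_union_right _ (Finset.mem_image.2 ⟨v, Finset.mem_univ v, hv⟩)
  have h1 := Finset.card_le_card hsub
  have h2 := Finset.card_union_le (Finset.univ.image F.a) (Finset.univ.image F.b)
  have h3 : (Finset.univ.image F.a).card ≤ n := Finset.card_image_le.trans (by simp)
  have h4 : (Finset.univ.image F.b).card ≤ n := Finset.card_image_le.trans (by simp)
  simp only [Nat.card_Ico] at h1
  omega

/-- Twice the half-integral solution that belongs to the gap `g`. -/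
def twiceSolution (F : Preflow n) (g : ℕ) (v : Fin n) : ℕ :=
  (if F.a v < g then 1 else 0) + if g < F.b v then 1 else 0

/-- For an edge `uv`, if `a u` is not below the gap it is above it, so `b v ≥ a u - 1 ≥ g`, and `b
v` differs from `g`. Thus one copy of the edge is covered; symmetry of `adj` covers the other copy.
-/
theorem twiceSolution_feasible (h : F.Valid adj c V) (hadj : ∀ u v, adj u v → adj v u) {g : ℕ}
    (hg : F.IsGap g) {u v : Fin n} (huv : adj u v) :
    2 ≤ F.twiceSolution g u + F.twiceSolution g v := by
  have h1 := h.label u v huv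
  have h2 := h.label v u (hadj u v huv)
  have h3 := hg.2 u
  have h4 := hg.2 v
  unfold twiceSolution
  split_ifs <;> omega

/-- This is weak duality with complementary slackness. Stability leaves excess only at labels at
least `V`, above the gap. Hence left copies below the gap send everything, and right copies below
the gap are not overloaded; right copies above the gap have no deficit and are overloaded at worst,
and scaling by `θ` makes them exactly full. Flow never runs from below the gap to above it, so the
scaling does not disturb the left copies that must stay tight. The scaled flow is thus a fractional
matching that is tight wherever the cover is positive. -/
theorem twiceSolution_optimal (h : F.Valid adj c V) (hc : ∀ v, 0 ≤ c v) (hs : F.Stable adj V)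
    {g : ℕ} (hgV : g < V) (hg : F.IsGap g) {y : Fin n → ℝ} (hy : ∀ v, 0 ≤ y v)
    (hy' : ∀ u v, adj u v → 1 ≤ y u + y v) :
    ∑ v, c v * (F.twiceSolution g v / 2 : ℝ) ≤ ∑ v, c v * y v := by
  set xL : Fin n → ℝ := fun v => if F.a v < g then 1 else 0 with hxL
  set xR : Fin n → ℝ := fun v => if g < F.b v then 1 else 0 with hxR
  set col : Fin n → ℝ := fun v => ∑ u, F.f u v with hcol
  -- If `col v = 0` above the gap, then `c v = 0` as well, so the default value of the quotient is
  -- harmless.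
  set θ : Fin n → ℝ := fun v => if g < F.b v then c v / col v else 1 with hθ
  have hcol0 : ∀ v, 0 ≤ col v := fun v => Finset.sum_nonneg fun u _ => h.nonneg u v
  have hcolR : ∀ v, g < F.b v → c v ≤ col v := fun v hv => by
    by_contra! hlt
    have := h.deficit v (by rw [h.right]; linarith [hlt])
    have := hg.1
    omega
  have hcolR' : ∀ v, ¬ g < F.b v → col v ≤ c v := fun v hv => by
    by_contra! hlt
    have := hs.right (v := v) (by rw [h.right]; linarith [hlt])
    omega
  have hθ0 : ∀ v, 0 ≤ θ v := fun v => by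
    simp only [hθ]
    split_ifs
    · exact div_nonneg (hc v) (hcol0 v)
    · exact zero_le_one
  have hθ1 : ∀ v, θ v ≤ 1 := fun v => by
    simp only [hθ]
    split_ifs with hv
    · exact div_le_one_of_le₀ (hcolR v hv) (hcol0 v)
    · exact le_rfl
  have hcol' : ∀ v, ∑ u, F.f u v * θ v = col v * θ v := fun v => by rw [← Finset.sum_mul]
  have hcolle : ∀ v, col v * θ v ≤ c v := fun v => by
    simp only [hθ]
    split_ifs with hv
    · rcases eq_or_ne (col v) 0 with h0 | h0
      · rw [h0, zero_mul]; exact hc v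
      · rw [mul_div_cancel₀ _ h0]
    · rw [mul_one]; exact hcolR' v hv
  have hcoleq : ∀ v, c v * xR v = col v * θ v * xR v := fun v => by
    simp only [hθ, hxR]
    split_ifs with hv
    · rcases eq_or_ne (col v) 0 with h0 | h0
      · have := hcolR v hv
        rw [h0] at this ⊢
        rw [le_antisymm this (hc v)]; simp
      · rw [mul_div_cancel₀ _ h0]
    · simp
  have hrowle : ∀ u, ∑ v, F.f u v * θ v ≤ c u := fun u => by
    have h1 : ∑ v, F.f u v * θ v ≤ ∑ v, F.f u v :=
      Finset.sum_le_sum fun v _ => mul_le_of_le_one_right (h.nonneg u v) (hθ1 v)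
    have h2 := h.left_nonneg u
    rw [h.left] at h2
    linarith
  -- Flow on `uv` forces `b v ≤ a u + 1 ≤ g`.
  have hgap : ∀ u v, 0 < F.f u v → F.a u < g → ¬ g < F.b v := fun u v hf hu => by
    have := h.label' u v hf
    have := (hg.2 v).2
    omega
  have hroweq : ∀ u, c u * xL u = (∑ v, F.f u v * θ v) * xL u := fun u => by
    simp only [hxL]
    split_ifs with hu
    · have h0 : F.eL u = 0 := by
        refine le_antisymm (not_lt.1 fun h0 => ?_) (h.left_nonneg u)
        have := hs.left h0
        omega
      have h1 : ∑ v, F.f u v * θ v = ∑ v, F.f u v := by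
        refine Finset.sum_congr rfl fun v _ => ?_
        rcases (h.nonneg u v).eq_or_lt with h2 | h2
        · rw [← h2, zero_mul]
        · simp only [hθ]
          rw [if_neg (hgap u v h2 hu), mul_one]
      rw [h.left] at h0
      rw [h1]; linarith
    · simp
  have hx1 : ∀ u v, 0 < F.f u v → xL u + xR v ≤ 1 := fun u v hf => by
    simp only [hxL, hxR]
    have := hgap u v hf
    split_ifs with h1 h2 h2
    · exact absurd h2 (this h1)
    all_goals norm_num
  have htwice : ∀ v, (F.twiceSolution g v : ℝ) = xL v + xR v := fun v => by
    simp [twiceSolution, hxL, hxR]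
  have hmain : ∑ v, c v * xL v + ∑ v, c v * xR v ≤ ∑ v, c v * y v + ∑ v, c v * y v := by
    calc ∑ v, c v * xL v + ∑ v, c v * xR v
        = ∑ u, ∑ v, F.f u v * θ v * (xL u + xR v) := by
          simp only [mul_add, Finset.sum_add_distrib]
          congr 1
          · exact Finset.sum_congr rfl fun u _ => by rw [hroweq, Finset.sum_mul]
          · rw [Finset.sum_comm]
            exact Finset.sum_congr rfl fun v _ => by rw [hcoleq, ← hcol', Finset.sum_mul]
      _ ≤ ∑ u, ∑ v, F.f u v * θ v * (y u + y v) := by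
          refine Finset.sum_le_sum fun u _ => Finset.sum_le_sum fun v _ => ?_
          rcases (h.nonneg u v).eq_or_lt with h2 | h2
          · simp [← h2]
          · exact mul_le_mul_of_nonneg_left
              ((hx1 u v h2).trans (hy' u v (h.supp u v h2))) (mul_nonneg h2.le (hθ0 v))
      _ = ∑ u, (∑ v, F.f u v * θ v) * y u + ∑ v, (col v * θ v) * y v := by
          simp only [mul_add, Finset.sum_add_distrib]
          congr 1
          · exact Finset.sum_congr rfl fun u _ => by rw [Finset.sum_mul]
          · rw [Finset.sum_comm]
            exact Finset.sum_congr rfl fun v _ => by rw [← hcol', Finset.sum_mul]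
      _ ≤ _ := by
          refine add_le_add (Finset.sum_le_sum fun u _ => ?_) (Finset.sum_le_sum fun v _ => ?_)
          · exact mul_le_mul_of_nonneg_right (hrowle u) (hy u)
          · exact mul_le_mul_of_nonneg_right (hcolle v) (hy v)
  have : ∑ v, c v * (F.twiceSolution g v / 2 : ℝ) = (∑ v, c v * xL v + ∑ v, c v * xR v) / 2 := by
    rw [← Finset.sum_add_distrib, Finset.sum_div]
    exact Finset.sum_congr rfl fun v _ => by rw [htwice]; ring
  linarith

end Preflow
end HypOrient

/-! ### The push-relabel algorithm as a program -/

namespace HypOrient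

variable {n m : ℕ}

/-- The preflow that is stored in real arrays `5`, `6`, `7` and natural arrays `5`, `6`. -/
def State.preflow (s : State n) : Preflow n :=
  ⟨fun u v => s.real 5 u v, fun u => s.real 6 u 0, fun v => s.real 7 v 0,
    fun u => s.nat 5 u 0, fun v => s.nat 6 v 0⟩

theorem State.preflow_congr {s s' : State n} (h5 : s'.real 5 = s.real 5)
    (h6 : s'.real 6 = s.real 6) (h7 : s'.real 7 = s.real 7) (h5' : s'.nat 5 = s.nat 5)
    (h6' : s'.nat 6 = s.nat 6) : s'.preflow = s.preflow := by
  simp only [State.preflow, h5, h6, h7, h5', h6']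

open Classical in
/-- The invariant of the push-relabel loop. -/
structure FlowInv (I : Instance n m) (k : ℕ) (d : ℝ) (adj : Fin n → Fin n → Prop) (s : State n) :
    Prop where
  inputs : Inputs I k d s
  graph : ∀ u v : Fin n, s.nat 3 u v = if adj u v then 1 else 0
  valid : s.preflow.Valid adj I.cost (2 * n + 2)

namespace FlowInv

variable {I : Instance n m} {k : ℕ} {d : ℝ} {adj : Fin n → Fin n → Prop} {s s' : State n}

theorem adj_iff (h : FlowInv I k d adj s) (u v : Fin n) : 1 ≤ s.nat 3 u v ↔ adj u v := by
  rw [h.graph]; split_ifs with h1 <;> simp [h1]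

theorem congr (h : FlowInv I k d adj s) (h0 : Inputs I k d s') (h3 : s'.nat 3 = s.nat 3)
    (hp : s'.preflow = s.preflow) : FlowInv I k d adj s' :=
  ⟨h0, fun u v => by rw [h3, h.graph], hp ▸ h.valid⟩

theorem tick (h : FlowInv I k d adj s) (t : ℕ) : FlowInv I k d adj (s.tick t) :=
  h.congr (h.inputs.tick t) rfl rfl

theorem enter (h : FlowInv I k d adj s) {a : ℕ} (ha : 8 ≤ a) (t : ℕ) :
    FlowInv I k d adj (s.enter a t) :=
  h.congr (h.inputs.enter (by omega) t) (enter_nat_of_ne _ (by omega) _)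
    (State.preflow_congr rfl rfl rfl (enter_nat_of_ne _ (by omega) _)
      (enter_nat_of_ne _ (by omega) _))

end FlowInv

theorem State.preflow_enter (s : State n) {a : ℕ} (ha : 8 ≤ a) (t : ℕ) :
    (s.enter a t).preflow = s.preflow :=
  State.preflow_congr rfl rfl rfl (enter_nat_of_ne _ (by omega) _) (enter_nat_of_ne _ (by omega) _)

/-- The number of labels. -/
abbrev NExp.labels : NExp := .add (.add .vertices .vertices) (.const 2)

/-- Send more flow from the left vertex `20` to the right vertex `21`; the amount is stored in
real array `10`. -/
def shiftCmd : Cmd :=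
  .seq (.setReal 5 (.var 20) (.var 21)
      (.add (.cell 5 (.var 20) (.var 21)) (.entry 10 (.const 0))))
    (.seq (.setReal 6 (.var 20) (.const 0) (.sub (.entry 6 (.var 20)) (.entry 10 (.const 0))))
      (.setReal 7 (.var 21) (.const 0) (.add (.entry 7 (.var 21)) (.entry 10 (.const 0)))))

/-- Keeping the amount in a separate array matters, because it is computed from entries that the
three updates overwrite. -/
theorem shiftCmd_preflow (env : Env n) {s : State n} {u v : Fin n} (hu : s.nat 20 0 0 = u)
    (hv : s.nat 21 0 0 = v) :
    (shiftCmd.exec env s).preflow = s.preflow.shift u v (s.real 10 0 0) := by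
  ext x y
  · simp [State.preflow, Preflow.shift, shiftCmd, Cmd.exec, put_self, put_of_ne, NExp.eval,
      RExp.eval, hu, hv, Fin.val_inj]
  · simp [State.preflow, Preflow.shift, shiftCmd, Cmd.exec, put_self, put_of_ne, NExp.eval,
      RExp.eval, hu, hv, Fin.val_inj]
  · simp [State.preflow, Preflow.shift, shiftCmd, Cmd.exec, put_self, put_of_ne, NExp.eval,
      RExp.eval, hu, hv, Fin.val_inj]
  · rfl
  · rfl

def pushLCmd : Cmd :=
  .cond (.both (.natLE (.const 1) (.cell 3 (.var 20) (.var 21)))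
      (.both (.natEq (.entry 5 (.var 20)) (.add (.entry 6 (.var 21)) (.const 1)))
        (.realLT (.const 0) (.entry 6 (.var 20)))))
    (.seq (.setReal 10 (.const 0) (.const 0) (.entry 6 (.var 20))) shiftCmd) .skip

def pushRCmd : Cmd :=
  .cond (.both (.realLT (.const 0) (.cell 5 (.var 20) (.var 21)))
      (.both (.natEq (.entry 6 (.var 21)) (.add (.entry 5 (.var 20)) (.const 1)))
        (.realLT (.const 0) (.entry 7 (.var 21)))))
    (.seq (.cond (.realLE (.cell 5 (.var 20) (.var 21)) (.entry 7 (.var 21)))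
        (.setReal 10 (.const 0) (.const 0) (.sub (.const 0) (.cell 5 (.var 20) (.var 21))))
        (.setReal 10 (.const 0) (.const 0) (.sub (.const 0) (.entry 7 (.var 21))))) shiftCmd) .skip

def raiseLCmd : Cmd :=
  .seq (.search 12 22 .vertices .skip (.both (.natLE (.const 1) (.cell 3 (.var 20) (.var 22)))
      (.natEq (.entry 5 (.var 20)) (.add (.entry 6 (.var 22)) (.const 1)))))
    (.cond (.both (.realLT (.const 0) (.entry 6 (.var 20)))
        (.both (.natLE (.add (.entry 5 (.var 20)) (.const 1)) .labels) (.neg (.flag 12))))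
      (.setNat 5 (.var 20) (.const 0) (.add (.entry 5 (.var 20)) (.const 1))) .skip)

def raiseRCmd : Cmd :=
  .seq (.search 12 22 .vertices .skip (.both (.realLT (.const 0) (.cell 5 (.var 22) (.var 20)))
      (.natEq (.entry 6 (.var 20)) (.add (.entry 5 (.var 22)) (.const 1)))))
    (.cond (.both (.realLT (.const 0) (.entry 7 (.var 20)))
        (.both (.natLE (.add (.entry 6 (.var 20)) (.const 1)) .labels) (.neg (.flag 12))))
      (.setNat 6 (.var 20) (.const 0) (.add (.entry 6 (.var 20)) (.const 1))) .skip)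

section steps

variable {I : Instance n m} {k : ℕ} {d : ℝ} {adj : Fin n → Fin n → Prop} {s : State n}

theorem pushLCmd_steps (env : Env n) {u v : Fin n} (hu : s.nat 20 0 0 = u)
    (hv : s.nat 21 0 0 = v) : pushLCmd.Steps env (FlowInv I k d adj) State.preflow
      (Preflow.potential (2 * n + 2)) (fun F => ¬ F.CanPushL adj u v) s := by
  intro h
  have htest : (Test.both (.natLE (.const 1) (.cell 3 (.var 20) (.var 21)))
      (.both (.natEq (.entry 5 (.var 20)) (.add (.entry 6 (.var 21)) (.const 1)))
        (.realLT (.const 0) (.entry 6 (.var 20))))).eval s ↔ s.preflow.CanPushL adj u v := by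
    simp only [Test.eval, Test.eval_natEq, Test.eval_realLT, NExp.eval, RExp.eval, hu, hv,
      h.adj_iff, Nat.cast_zero]
    rfl
  have hF := frame env pushLCmd s
  rw [pushLCmd, Cmd.exec] at hF ⊢
  by_cases hb : s.preflow.CanPushL adj u v
  · rw [if_pos (htest.2 hb)] at hF ⊢
    rw [Cmd.exec] at hF ⊢
    have hF' := frame env (.setReal 10 (.const 0) (.const 0) (.entry 6 (.var 20))) (s.tick 1)
    have hpre := shiftCmd_preflow env (s := (Cmd.setReal 10 (.const 0) (.const 0)
      (.entry 6 (.var 20))).exec env (s.tick 1)) (u := u) (v := v) hu hv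
    have h10 : ((Cmd.setReal 10 (.const 0) (.const 0) (.entry 6 (.var 20))).exec env
        (s.tick 1)).real 10 0 0 = s.preflow.eL u := by
      simp [Cmd.exec, put_self, NExp.eval, RExp.eval, State.tick, hu, State.preflow]
    rw [h10] at hpre
    have hpre' := hpre.trans (congrArg (fun F : Preflow n => F.shift u v (s.preflow.eL u))
      (show _ = s.preflow from State.preflow_congr (hF'.real 5 rfl) (hF'.real 6 rfl)
        (hF'.real 7 rfl) (hF'.nat 5 rfl) (hF'.nat 6 rfl)))
    obtain ⟨h1, h2⟩ := h.valid.pushL hb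
    rw [← hpre'] at h1 h2
    exact ⟨⟨h.inputs.of_frame hF rfl, fun u v => by rw [hF.nat 3 rfl, h.graph], h1⟩,
      Or.inr ⟨fun h => h hb, h2⟩⟩
  · rw [if_neg (mt htest.1 hb)]
    exact ⟨h.tick 1, Or.inl ⟨hb, rfl⟩⟩

theorem pushRCmd_steps (env : Env n) {u v : Fin n} (hu : s.nat 20 0 0 = u)
    (hv : s.nat 21 0 0 = v) : pushRCmd.Steps env (FlowInv I k d adj) State.preflow
      (Preflow.potential (2 * n + 2)) (fun F => ¬ F.CanPushR u v) s := by
  intro h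
  have htest : (Test.both (.realLT (.const 0) (.cell 5 (.var 20) (.var 21)))
      (.both (.natEq (.entry 6 (.var 21)) (.add (.entry 5 (.var 20)) (.const 1)))
        (.realLT (.const 0) (.entry 7 (.var 21))))).eval s ↔ s.preflow.CanPushR u v := by
    simp only [Test.eval, Test.eval_natEq, Test.eval_realLT, NExp.eval, RExp.eval, hu, hv,
      Nat.cast_zero]
    rfl
  have hF := frame env pushRCmd s
  rw [pushRCmd, Cmd.exec] at hF ⊢
  by_cases hb : s.preflow.CanPushR u v
  · rw [if_pos (htest.2 hb)] at hF ⊢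
    rw [Cmd.exec] at hF ⊢
    set p := Cmd.cond (.realLE (.cell 5 (.var 20) (.var 21)) (.entry 7 (.var 21)))
        (.setReal 10 (.const 0) (.const 0) (.sub (.const 0) (.cell 5 (.var 20) (.var 21))))
        (.setReal 10 (.const 0) (.const 0) (.sub (.const 0) (.entry 7 (.var 21)))) with hp
    have hF' := frame env p (s.tick 1)
    have hpre := shiftCmd_preflow env (s := p.exec env (s.tick 1)) (u := u) (v := v)
      (by rw [hF'.nat 20 rfl]; exact hu) (by rw [hF'.nat 21 rfl]; exact hv)
    have h10 : (p.exec env (s.tick 1)).real 10 0 0 = -min (s.preflow.f u v) (s.preflow.eR v) := by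
      rw [hp, Cmd.exec]
      have e1 : (Test.realLE (.cell 5 (.var 20) (.var 21)) (.entry 7 (.var 21))).eval (s.tick 1) ↔
          s.preflow.f u v ≤ s.preflow.eR v := by
        simp only [Test.eval, RExp.eval, NExp.eval, State.tick, hu, hv]
        rfl
      by_cases h1 : s.preflow.f u v ≤ s.preflow.eR v
      · rw [if_pos (e1.2 h1), min_eq_left h1]
        simp [Cmd.exec, put_self, NExp.eval, RExp.eval, State.tick, hu, hv, State.preflow]
      · rw [if_neg (mt e1.1 h1), min_eq_right (not_le.1 h1).le]
        simp [Cmd.exec, put_self, NExp.eval, RExp.eval, State.tick, hv, State.preflow]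
    rw [h10] at hpre
    have hpre' := hpre.trans (congrArg
      (fun F : Preflow n => F.shift u v (-min (s.preflow.f u v) (s.preflow.eR v)))
      (show _ = s.preflow from State.preflow_congr (hF'.real 5 rfl) (hF'.real 6 rfl)
        (hF'.real 7 rfl) (hF'.nat 5 rfl) (hF'.nat 6 rfl)))
    obtain ⟨h1, h2⟩ := h.valid.pushR hb
    rw [← hpre'] at h1 h2
    exact ⟨⟨h.inputs.of_frame hF rfl, fun u v => by rw [hF.nat 3 rfl, h.graph], h1⟩,
      Or.inr ⟨fun h => h hb, h2⟩⟩
  · rw [if_neg (mt htest.1 hb)]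
    exact ⟨h.tick 1, Or.inl ⟨hb, rfl⟩⟩

theorem raiseLCmd_steps (env : Env n) {u : Fin n} (hu : s.nat 20 0 0 = u) :
    raiseLCmd.Steps env (FlowInv I k d adj) State.preflow
      (Preflow.potential (2 * n + 2)) (fun F => ¬ F.CanRaiseL adj (2 * n + 2) u) s := by
  intro h
  have hF := frame env raiseLCmd s
  rw [raiseLCmd, Cmd.exec] at hF ⊢
  set p := Cmd.search 12 22 .vertices .skip (.both (.natLE (.const 1) (.cell 3 (.var 20) (.var 22)))
      (.natEq (.entry 5 (.var 20)) (.add (.entry 6 (.var 22)) (.const 1))))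
  have hF1 := frame env p s
  have hi1 : Inputs I k d (p.exec env s) := h.inputs.exec env rfl
  have hpre : (p.exec env s).preflow = s.preflow := State.preflow_congr (hF1.real 5 rfl)
    (hF1.real 6 rfl) (hF1.real 7 rfl) (hF1.nat 5 rfl) (hF1.nat 6 rfl)
  have hI1 : FlowInv I k d adj (p.exec env s) := h.congr hi1 (hF1.nat 3 rfl) hpre
  have h12 : 1 ≤ (p.exec env s).nat 12 0 0 ↔
      ∃ v, adj u v ∧ s.preflow.a u = s.preflow.b v + 1 := by
    refine search_spec (fun v => adj u v ∧ s.preflow.a u = s.preflow.b v + 1) (by decide)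
      (by decide) rfl h.inputs.eval_vertices ?_
    intro v s' hn hR hv
    simp only [Cmd.exec, Test.eval, Test.eval_natEq, NExp.eval, hv, hu,
      hn 20 (by decide) (by decide) rfl, hn 3 (by decide) (by decide) rfl,
      hn 5 (by decide) (by decide) rfl, hn 6 (by decide) (by decide) rfl, h.adj_iff]
    rfl
  have hu1 : (p.exec env s).nat 20 0 0 = u := by rw [hF1.nat 20 rfl, hu]
  have htest : (Test.both (.realLT (.const 0) (.entry 6 (.var 20)))
        (.both (.natLE (.add (.entry 5 (.var 20)) (.const 1)) .labels)
          (.neg (.flag 12)))).eval (p.exec env s) ↔ s.preflow.CanRaiseL adj (2 * n + 2) u := by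
    simp only [Test.eval, Test.eval_flag, Test.eval_realLT, NExp.eval, RExp.eval, hu1, h12,
      hi1.num_vertices, hF1.real 6 rfl, hF1.nat 5 rfl, Nat.cast_zero, ← two_mul]
    rfl
  rw [Cmd.exec] at hF ⊢
  by_cases hb : s.preflow.CanRaiseL adj (2 * n + 2) u
  · rw [if_pos (htest.2 hb)] at hF ⊢
    have hpre' : ((Cmd.setNat 5 (.var 20) (.const 0) (.add (.entry 5 (.var 20)) (.const 1))).exec
        env ((p.exec env s).tick 1)).preflow = s.preflow.raiseL u := by
      rw [← hpre]
      ext x y <;> simp [State.preflow, Preflow.raiseL, Cmd.exec, put_self, put_of_ne, NExp.eval,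
        State.tick, hu1, Fin.val_inj]
    obtain ⟨h1, h2⟩ := h.valid.raiseL hb
    rw [← hpre'] at h1 h2
    exact ⟨⟨h.inputs.of_frame hF rfl, fun u v => by rw [hF.nat 3 rfl, h.graph], h1⟩,
      Or.inr ⟨fun h => h hb, h2⟩⟩
  · rw [if_neg (mt htest.1 hb)]
    exact ⟨hI1.tick 1, Or.inl ⟨hb, hpre⟩⟩

theorem raiseRCmd_steps (env : Env n) {u : Fin n} (hu : s.nat 20 0 0 = u) :
    raiseRCmd.Steps env (FlowInv I k d adj) State.preflow
      (Preflow.potential (2 * n + 2)) (fun F => ¬ F.CanRaiseR (2 * n + 2) u) s := by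
  intro h
  have hF := frame env raiseRCmd s
  rw [raiseRCmd, Cmd.exec] at hF ⊢
  set p := Cmd.search 12 22 .vertices .skip
    (.both (.realLT (.const 0) (.cell 5 (.var 22) (.var 20)))
      (.natEq (.entry 6 (.var 20)) (.add (.entry 5 (.var 22)) (.const 1))))
  have hF1 := frame env p s
  have hi1 : Inputs I k d (p.exec env s) := h.inputs.exec env rfl
  have hpre : (p.exec env s).preflow = s.preflow := State.preflow_congr (hF1.real 5 rfl)
    (hF1.real 6 rfl) (hF1.real 7 rfl) (hF1.nat 5 rfl) (hF1.nat 6 rfl)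
  have hI1 : FlowInv I k d adj (p.exec env s) := h.congr hi1 (hF1.nat 3 rfl) hpre
  have h12 : 1 ≤ (p.exec env s).nat 12 0 0 ↔
      ∃ v, 0 < s.preflow.f v u ∧ s.preflow.b u = s.preflow.a v + 1 := by
    refine search_spec (fun v => 0 < s.preflow.f v u ∧ s.preflow.b u = s.preflow.a v + 1)
      (by decide) (by decide) rfl h.inputs.eval_vertices ?_
    intro v s' hn hR hv
    simp only [Cmd.exec, Test.eval, Test.eval_natEq, Test.eval_realLT, NExp.eval, RExp.eval, hv,
      hu, hn 20 (by decide) (by decide) rfl, hR 5 rfl, Nat.cast_zero,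
      hn 5 (by decide) (by decide) rfl, hn 6 (by decide) (by decide) rfl]
    rfl
  have hu1 : (p.exec env s).nat 20 0 0 = u := by rw [hF1.nat 20 rfl, hu]
  have htest : (Test.both (.realLT (.const 0) (.entry 7 (.var 20)))
        (.both (.natLE (.add (.entry 6 (.var 20)) (.const 1)) .labels)
          (.neg (.flag 12)))).eval (p.exec env s) ↔ s.preflow.CanRaiseR (2 * n + 2) u := by
    simp only [Test.eval, Test.eval_flag, Test.eval_realLT, NExp.eval, RExp.eval, hu1, h12,
      hi1.num_vertices, hF1.real 7 rfl, hF1.nat 6 rfl, Nat.cast_zero, ← two_mul]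
    rfl
  rw [Cmd.exec] at hF ⊢
  by_cases hb : s.preflow.CanRaiseR (2 * n + 2) u
  · rw [if_pos (htest.2 hb)] at hF ⊢
    have hpre' : ((Cmd.setNat 6 (.var 20) (.const 0) (.add (.entry 6 (.var 20)) (.const 1))).exec
        env ((p.exec env s).tick 1)).preflow = s.preflow.raiseR u := by
      rw [← hpre]
      ext x y <;> simp [State.preflow, Preflow.raiseR, Cmd.exec, put_self, put_of_ne, NExp.eval,
        State.tick, hu1, Fin.val_inj]
    obtain ⟨h1, h2⟩ := h.valid.raiseR hb
    rw [← hpre'] at h1 h2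
    exact ⟨⟨h.inputs.of_frame hF rfl, fun u v => by rw [hF.nat 3 rfl, h.graph], h1⟩,
      Or.inr ⟨fun h => h hb, h2⟩⟩
  · rw [if_neg (mt htest.1 hb)]
    exact ⟨hI1.tick 1, Or.inl ⟨hb, hpre⟩⟩

end steps

end HypOrient

namespace HypOrient

variable {n m : ℕ}

/-- Try every push and every relabelling once. -/
def sweepCmd : Cmd :=
  .loop 20 .vertices (.seq (.loop 21 .vertices (.seq pushLCmd pushRCmd)) (.seq raiseLCmd raiseRCmd))

section sweep

variable {I : Instance n m} {k : ℕ} {d : ℝ} {adj : Fin n → Fin n → Prop}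

theorem pushesCmd_steps (env : Env n) {s : State n} {u : Fin n} (hu : s.nat 20 0 0 = u) :
    (Cmd.loop 21 .vertices (.seq pushLCmd pushRCmd)).Steps env (FlowInv I k d adj) State.preflow
      (Preflow.potential (2 * n + 2))
      (fun F => ∀ v, ¬ F.CanPushL adj u v ∧ ¬ F.CanPushR u v) s := by
  have key := Cmd.Steps.loop (env := env)
    (Inv := fun s => FlowInv I k d adj s ∧ s.nat 20 0 0 = u) (core := State.preflow)
    (Φ := Preflow.potential (2 * n + 2))
    (G := fun v F => ¬ F.CanPushL adj u v ∧ ¬ F.CanPushR u v) (a := 21) (e := .vertices)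
    (p := .seq pushLCmd pushRCmd) (s := s) (fun h => h.1.inputs.num_vertices)
    (fun s h => ⟨h.1.tick 1, h.2⟩) (fun s => rfl)
    (fun s t h => ⟨h.1.enter (by decide) t, by rw [enter_nat_of_ne _ (by decide), h.2]⟩)
    (fun s t => s.preflow_enter (by decide) t)
    (fun v s hv h => by
      have h1 := frame env pushLCmd s
      obtain ⟨h2, h3⟩ := (Cmd.Steps.seq (pushLCmd_steps env h.2 hv)
        (pushRCmd_steps env (by rw [h1.nat 20 rfl, h.2]) (by rw [h1.nat 21 rfl, hv]))) h.1
      exact ⟨⟨h2, by rw [(frame env _ s).nat 20 rfl, h.2]⟩, h3⟩)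
  intro h
  obtain ⟨h1, h2⟩ := key ⟨h, hu⟩
  exact ⟨h1.1, h2⟩

theorem sweepCmd_steps (env : Env n) (s : State n) :
    sweepCmd.Steps env (FlowInv I k d adj) State.preflow
      (Preflow.potential (2 * n + 2)) (Preflow.Stable adj (2 * n + 2)) s :=
  Cmd.Steps.loop (env := env) (Inv := FlowInv I k d adj) (core := State.preflow)
    (Φ := Preflow.potential (2 * n + 2)) (a := 20) (s := s)
    (fun h => h.inputs.num_vertices) (fun s h => h.tick 1) (fun s => rfl)
    (fun s t h => h.enter (by decide) t) (fun s t => s.preflow_enter (by decide) t)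
    (fun u s hu => by
      have h1 := frame env (Cmd.loop 21 .vertices (.seq pushLCmd pushRCmd)) s
      have hu1 : ((Cmd.loop 21 .vertices (.seq pushLCmd pushRCmd)).exec env s).nat 20 0 0 = u := by
        rw [h1.nat 20 rfl, hu]
      exact (pushesCmd_steps env hu).seq ((raiseLCmd_steps env hu1).seq
        (raiseRCmd_steps env (by rw [(frame env raiseLCmd _).nat 20 rfl, hu1]))))

/-- A number of passes such that four nested loops suffice for the push-relabel algorithm. -/
abbrev NExp.passes : NExp := .add .labels (.const 1)

/-- Sweep until nothing changes any more. -/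
def settleCmd : Cmd :=
  .loop 23 .passes (.loop 24 .passes (.loop 25 .passes (.loop 26 .passes sweepCmd)))

/-- If none of the `(2 * n + 3) ^ 4` sweeps were idle, the potential would fall below the lower
bound of `Valid.potential_ge`, which is only of fourth order in `n` with a smaller coefficient. An
idle sweep means stability. -/
theorem settleCmd_spec (env : Env n) {s : State n} (h : FlowInv I k d adj s)
    (h0 : s.preflow.potential (2 * n + 2) ≤ 0) : FlowInv I k d adj (settleCmd.exec env s) ∧
      (settleCmd.exec env s).preflow.Stable adj (2 * n + 2) := by
  have hN : ∀ s : State n, FlowInv I k d adj s → NExp.passes.eval s = 2 * n + 3 := fun s hs => by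
    simp only [NExp.eval, hs.inputs.num_vertices]
    omega
  have hstep : ∀ {p : Cmd} {r : ℕ} (a : ℕ), 8 ≤ a → p.Settles env (FlowInv I k d adj) State.preflow
      (Preflow.potential (2 * n + 2)) (Preflow.Stable adj (2 * n + 2)) r →
      (Cmd.loop a .passes p).Settles env (FlowInv I k d adj) State.preflow
      (Preflow.potential (2 * n + 2)) (Preflow.Stable adj (2 * n + 2)) ((2 * n + 3) * r) :=
    fun a ha hp => hp.loop hN (fun s h => h.tick 1) (fun s => rfl) (fun s t h => h.enter ha t)
      (fun s t => s.preflow_enter ha t)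
  obtain ⟨h1, -, h2⟩ := hstep 23 (by decide) (hstep 24 (by decide) (hstep 25 (by decide)
    (hstep 26 (by decide) (Cmd.Steps.settles (sweepCmd_steps env))))) s h
  refine ⟨h1, h2.resolve_left fun h3 => ?_⟩
  have h4 : _ ≤ (settleCmd.exec env s).preflow.potential (2 * n + 2) := h1.valid.potential_ge
  have h3' : ((settleCmd.exec env s).preflow.potential (2 * n + 2) : ℤ) +
      ((2 * n + 3) * ((2 * n + 3) * ((2 * n + 3) * ((2 * n + 3) * 1))) : ℕ) ≤ 0 := h3.trans h0
  push_cast at h3' h4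
  have hn : (0 : ℤ) ≤ n := by positivity
  have : (0 : ℤ) ≤ n ^ 4 := by positivity
  have : (0 : ℤ) ≤ n ^ 3 := by positivity
  have : (0 : ℤ) ≤ n ^ 2 := by positivity
  nlinarith

end sweep

/-- Store the preflow at the start. -/
def initCmd : Cmd :=
  .loop 20 .vertices
    (.seq (.setReal 6 (.var 20) (.const 0) (.cost (.var 20)))
    (.seq (.setReal 7 (.var 20) (.const 0) (.sub (.const 0) (.cost (.var 20))))
    (.seq (.setNat 5 (.var 20) (.const 0) (.const 0))
    (.seq (.setNat 6 (.var 20) (.const 0) (.const 1))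
      (.loop 21 .vertices (.setReal 5 (.var 20) (.var 21) (.const 0)))))))

theorem initCmd_spec {I : Instance n m} {k : ℕ} {d : ℝ} {s : State n} (env : Env n)
    (h : Inputs I k d s) : (initCmd.exec env s).preflow = Preflow.initial I.cost := by
  have := loop_rule (env := env) (a := 20) (e := .vertices) (s := s) (N := n)
    (p := (.seq (.setReal 6 (.var 20) (.const 0) (.cost (.var 20)))
    (.seq (.setReal 7 (.var 20) (.const 0) (.sub (.const 0) (.cost (.var 20))))
    (.seq (.setNat 5 (.var 20) (.const 0) (.const 0))
    (.seq (.setNat 6 (.var 20) (.const 0) (.const 1))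
      (.loop 21 .vertices (.setReal 5 (.var 20) (.var 21) (.const 0))))))))
    (fun t s' => ∀ u : Fin n, (u : ℕ) < t → s'.real 6 u 0 = I.cost u ∧ s'.real 7 u 0 = -I.cost u ∧
      s'.nat 5 u 0 = 0 ∧ s'.nat 6 u 0 = 1 ∧ ∀ v : Fin n, s'.real 5 u v = 0)
    h.num_vertices (fun u hu => absurd hu (Nat.not_lt_zero _)) (by
      intro t ht s' hF hI u hu
      -- Only sequencing is unfolded, so that the intermediate states can be named.
      simp only [Cmd.exec.eq_2]
      set s1 := (Cmd.setReal 6 (.var 20) (.const 0) (.cost (.var 20))).exec env (s'.enter 20 t)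
        with hs1
      set s2 := (Cmd.setReal 7 (.var 20) (.const 0) (.sub (.const 0) (.cost (.var 20)))).exec env s1
        with hs2
      set s3 := (Cmd.setNat 5 (.var 20) (.const 0) (.const 0)).exec env s2 with hs3
      set s4 := (Cmd.setNat 6 (.var 20) (.const 0) (.const 1)).exec env s3 with hs4
      have hcost : ∀ v : Fin n, s'.real 0 v 2 = I.cost v := (h.of_frame hF rfl).cost
      have hn : s'.nat 0 0 0 = n := (h.of_frame hF rfl).num_vertices
      have h20 : s4.nat 20 0 0 = t := by
        simp [s4, s3, s2, s1, Cmd.exec, put_self, put_of_ne, State.enter]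
      have hn4 : s4.nat 0 0 0 = n := by
        simp [s4, s3, s2, s1, Cmd.exec, put_of_ne, State.enter, hn]
      have h5 := loop_rule (env := env) (a := 21) (e := .vertices) (s := s4) (N := n)
        (p := .setReal 5 (.var 20) (.var 21) (.const 0))
        (fun r s'' => (∀ v : Fin n, (v : ℕ) < r → s''.real 5 t v = 0) ∧
          ∀ x y, x ≠ t → s''.real 5 x y = s4.real 5 x y)
        hn4 ⟨fun u hu => absurd hu (Nat.not_lt_zero _), fun _ _ _ => rfl⟩ (by
          rintro r hr s'' hF' ⟨h1, h2⟩
          have e1 : (s''.enter 21 r).nat 20 0 0 = t := by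
            rw [enter_nat_of_ne _ (by decide), hF'.nat 20 rfl, h20]
          simp only [Cmd.exec, put_self, NExp.eval, RExp.eval, e1, enter_nat_self, Nat.cast_zero,
            true_and]
          refine ⟨fun v hv => ?_, fun x y hx => ?_⟩
          · split_ifs with h3
            · rfl
            · exact h1 v (by omega)
          · rw [if_neg (fun h => hx h.1)]
            exact h2 x y hx)
      have hF5 := frame env (.loop 21 .vertices (.setReal 5 (.var 20) (.var 21) (.const 0))) s4
      rw [hF5.real 6 rfl, hF5.real 7 rfl, hF5.nat 5 rfl, hF5.nat 6 rfl]
      rcases Nat.lt_succ_iff_lt_or_eq.1 hu with h6 | h6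
      · obtain ⟨i1, i2, i3, i4, i5⟩ := hI u h6
        have h6' : (u : ℕ) ≠ t := by omega
        have e5 : s4.real 5 = s'.real 5 := by
          simp [s4, s3, s2, s1, Cmd.exec, put_of_ne, State.enter]
        refine ⟨?_, ?_, ?_, ?_, fun v => ?_⟩
        · simpa [s4, s3, s2, s1, Cmd.exec, put_self, put_of_ne, State.enter, NExp.eval, h6'] using i1
        · simpa [s4, s3, s2, s1, Cmd.exec, put_self, put_of_ne, State.enter, NExp.eval, h6'] using i2
        · simpa [s4, s3, s2, s1, Cmd.exec, put_self, put_of_ne, State.enter, NExp.eval, h6'] using i3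
        · simpa [s4, s3, s2, s1, Cmd.exec, put_self, put_of_ne, State.enter, NExp.eval, h6'] using i4
        · rw [h5.2 u v h6', e5, i5 v]
      · subst h6
        refine ⟨?_, ?_, ?_, ?_, fun v => h5.1 v v.2⟩
        · simp [s4, s3, s2, s1, Cmd.exec, put_self, put_of_ne, State.enter, NExp.eval, RExp.eval,
            hcost]
        · simp [s4, s3, s2, s1, Cmd.exec, put_self, put_of_ne, State.enter, NExp.eval, RExp.eval,
            hcost]
        · simp [s4, s3, s2, s1, Cmd.exec, put_self, put_of_ne, State.enter, NExp.eval]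
        · simp [s4, s3, s2, s1, Cmd.exec, put_self, put_of_ne, State.enter, NExp.eval])
  ext u v
  · exact (this u u.2).2.2.2.2 v
  · exact (this u u.2).1
  · exact (this u u.2).2.1
  · exact (this u u.2).2.2.1
  · exact (this u u.2).2.2.2.1

/-- Store in natural array `7` a number that is not a label. -/
def gapCmd : Cmd :=
  .loop 23 .labels (.seq
    (.search 12 22 .vertices .skip
      (.either (.natEq (.entry 5 (.var 22)) (.var 23)) (.natEq (.entry 6 (.var 22)) (.var 23))))
    (.cond (.both (.natLE (.const 1) (.var 23)) (.neg (.flag 12)))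
      (.setNat 7 (.const 0) (.const 0) (.var 23)) .skip))

theorem gapCmd_spec {I : Instance n m} {k : ℕ} {d : ℝ} {s : State n} (env : Env n)
    (h : Inputs I k d s) : s.preflow.IsGap ((gapCmd.exec env s).nat 7 0 0) ∧
      (gapCmd.exec env s).nat 7 0 0 < 2 * n + 2 := by
  have := loop_rule (env := env) (a := 23) (e := .labels) (s := s) (N := 2 * n + 2)
    (p := (.seq (.search 12 22 .vertices .skip
      (.either (.natEq (.entry 5 (.var 22)) (.var 23)) (.natEq (.entry 6 (.var 22)) (.var 23))))
      (.cond (.both (.natLE (.const 1) (.var 23)) (.neg (.flag 12)))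
        (.setNat 7 (.const 0) (.const 0) (.var 23)) .skip)))
    -- The cell has no meaningful content before the first gap is met, hence the conditional
    -- invariant; later gaps simply overwrite earlier ones.
    (fun t s' => (∃ g < t, s.preflow.IsGap g) →
      s.preflow.IsGap (s'.nat 7 0 0) ∧ s'.nat 7 0 0 < 2 * n + 2)
    (by simp only [NExp.eval, h.num_vertices]; omega)
    (fun ⟨g, hg, _⟩ => absurd hg (Nat.not_lt_zero _)) (by
      intro t ht s' hF hI
      have hi1 : Inputs I k d (s'.enter 23 t) := (h.of_frame hF rfl).enter (by decide) t
      rw [Cmd.exec]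
      set p := Cmd.search 12 22 .vertices .skip
        (.either (.natEq (.entry 5 (.var 22)) (.var 23)) (.natEq (.entry 6 (.var 22)) (.var 23)))
      have hF1 := frame env p (s'.enter 23 t)
      have h23 : (p.exec env (s'.enter 23 t)).nat 23 0 0 = t := by
        rw [hF1.nat 23 rfl, enter_nat_self]
      have h7 : (p.exec env (s'.enter 23 t)).nat 7 = s'.nat 7 := by
        rw [hF1.nat 7 rfl, enter_nat_of_ne _ (by decide)]
      have h12 : 1 ≤ (p.exec env (s'.enter 23 t)).nat 12 0 0 ↔
          ∃ v, s.preflow.a v = t ∨ s.preflow.b v = t := by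
        refine search_spec (fun v => s.preflow.a v = t ∨ s.preflow.b v = t) (by decide) (by decide)
          rfl hi1.eval_vertices ?_
        intro v s'' hn hR hv
        have e5 : s''.nat 5 = s.nat 5 := by
          rw [hn 5 (by decide) (by decide) rfl, enter_nat_of_ne _ (by decide), hF.nat 5 rfl]
        have e6 : s''.nat 6 = s.nat 6 := by
          rw [hn 6 (by decide) (by decide) rfl, enter_nat_of_ne _ (by decide), hF.nat 6 rfl]
        simp only [Cmd.exec, Test.eval_either, Test.eval_natEq, NExp.eval, hv, e5, e6,
          hn 23 (by decide) (by decide) rfl, enter_nat_self]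
        rfl
      have htest : (Test.both (.natLE (.const 1) (.var 23)) (.neg (.flag 12))).eval
          (p.exec env (s'.enter 23 t)) ↔ s.preflow.IsGap t := by
        simp only [Test.eval, Test.eval_flag, NExp.eval, h23, h12, Preflow.IsGap]
        push Not
        rfl
      rw [Cmd.exec]
      by_cases hg : s.preflow.IsGap t
      · rw [if_pos (htest.2 hg)]
        have : ((Cmd.setNat 7 (.const 0) (.const 0) (.var 23)).exec env
            ((p.exec env (s'.enter 23 t)).tick 1)).nat 7 0 0 = t := by
          simp [Cmd.exec, put_self, NExp.eval, State.tick, h23]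
        rw [this]
        exact fun _ => ⟨hg, ht⟩
      · rw [if_neg (mt htest.1 hg)]
        rintro ⟨g, hgt, hgg⟩
        have : ((Cmd.skip).exec env ((p.exec env (s'.enter 23 t)).tick 1)).nat 7 = s'.nat 7 := h7
        rw [this]
        refine hI ⟨g, ?_, hgg⟩
        rcases Nat.lt_succ_iff_lt_or_eq.1 hgt with h | h
        · exact h
        · exact absurd (h ▸ hgg) hg)
  exact this (s.preflow.exists_gap le_rfl)

/-- The left copy of vertex `20` lies below the gap. -/
def belowGap : Test := .natLE (.add (.entry 5 (.var 20)) (.const 1)) (.var 7)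

/-- The right copy of vertex `20` lies above the gap. -/
def aboveGap : Test := .natLE (.add (.var 7) (.const 1)) (.entry 6 (.var 20))

/-- Store in natural array `8` twice the half-integral solution. -/
def solutionCmd : Cmd :=
  .loop 20 .vertices (.cond (.both belowGap aboveGap) (.setNat 8 (.var 20) (.const 0) (.const 2))
    (.cond (.either belowGap aboveGap) (.setNat 8 (.var 20) (.const 0) (.const 1))
      (.setNat 8 (.var 20) (.const 0) (.const 0))))

theorem solutionCmd_spec {I : Instance n m} {k : ℕ} {d : ℝ} {s : State n} (env : Env n)
    (h : Inputs I k d s) (v : Fin n) :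
    (solutionCmd.exec env s).nat 8 v 0 = s.preflow.twiceSolution (s.nat 7 0 0) v := by
  refine loop_rule (env := env) (a := 20) (e := .vertices) (s := s) (N := n)
    (fun t s' => ∀ v : Fin n, (v : ℕ) < t →
      s'.nat 8 v 0 = s.preflow.twiceSolution (s.nat 7 0 0) v)
    h.num_vertices (fun u hu => absurd hu (Nat.not_lt_zero _)) ?_ v v.2
  intro t ht s' hF hI
  obtain ⟨z, rfl⟩ : ∃ z : Fin n, (z : ℕ) = t := ⟨⟨t, ht⟩, rfl⟩
  have e7 : (s'.enter 20 z).nat 7 0 0 = s.nat 7 0 0 := by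
    rw [enter_nat_of_ne _ (by decide), hF.nat 7 rfl]
  have hA : belowGap.eval (s'.enter 20 z) ↔ s.preflow.a z < s.nat 7 0 0 := by
    simp only [belowGap, Test.eval, NExp.eval, enter_nat_self, e7]
    rw [enter_nat_of_ne _ (by decide), hF.nat 5 rfl]
    rfl
  have hB : aboveGap.eval (s'.enter 20 z) ↔ s.nat 7 0 0 < s.preflow.b z := by
    simp only [aboveGap, Test.eval, NExp.eval, enter_nat_self, e7]
    rw [enter_nat_of_ne _ (by decide), hF.nat 6 rfl]
    rfl
  have hstep : ∀ (y : ℕ) (s1 : State n), s1.nat = (s'.enter 20 z).nat →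
      y = s.preflow.twiceSolution (s.nat 7 0 0) z → ∀ v : Fin n, (v : ℕ) < z + 1 →
      ((Cmd.setNat 8 (.var 20) (.const 0) (.const y)).exec env s1).nat 8 v 0 =
        s.preflow.twiceSolution (s.nat 7 0 0) v := by
    intro y s1 h1 hy v hv
    simp only [Cmd.exec, put_self, NExp.eval, h1, enter_nat_self, and_true]
    rcases Nat.lt_succ_iff_lt_or_eq.1 hv with h | h
    · rw [if_neg (by omega), enter_nat_of_ne _ (by decide), hI v h]
    · have : v = z := Fin.ext h
      rw [if_pos h, this, hy]
  have htick : ∀ T : Test, T.eval ((s'.enter 20 z).tick 1) ↔ T.eval (s'.enter 20 z) :=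
    fun T => Test.eval_congr (s := s'.enter 20 z) (s' := (s'.enter 20 z).tick 1) rfl rfl T
  rw [Cmd.exec.eq_5, Cmd.exec.eq_5, Test.eval, Test.eval_either, htick, htick, hA, hB]
  by_cases h1 : s.preflow.a z < s.nat 7 0 0 <;> by_cases h2 : s.nat 7 0 0 < s.preflow.b z
  · rw [if_pos ⟨h1, h2⟩]
    exact hstep 2 _ rfl (by rw [Preflow.twiceSolution, if_pos h1, if_pos h2])
  · rw [if_neg (fun h => h2 h.2), if_pos (Or.inl h1)]
    exact hstep 1 _ rfl (by rw [Preflow.twiceSolution, if_pos h1, if_neg h2])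
  · rw [if_neg (fun h => h1 h.1), if_pos (Or.inr h2)]
    exact hstep 1 _ rfl (by rw [Preflow.twiceSolution, if_neg h1, if_pos h2])
  · rw [if_neg (fun h => h1 h.1), if_neg (fun h => h.elim h1 h2)]
    exact hstep 0 _ rfl (by rw [Preflow.twiceSolution, if_neg h1, if_neg h2])

/-- Compute a half-integral optimal solution of the vertex cover relaxation for the graph in
array `3`. -/
def relaxationCmd : Cmd :=
  .seq initCmd (.seq settleCmd (.seq gapCmd solutionCmd))

open Classical in
-- The flow runs on all vertices, those outside `U` being isolated. A competitor on `U` is extended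
-- by zero, and the nonnegative cost of the computed solution outside `U` is dropped.
theorem relaxationCmd_spec {I : Instance n m} {k : ℕ} {d : ℝ} {s : State n} (env : Env n)
    (h : Inputs I k d s) {U : Finset (Fin n)}
    (hG : ∀ u v : Fin n, s.nat 3 u v = if (restrict I.coverGraph U).Adj u v then 1 else 0) :
    I.IsHalfIntegralOptimum U fun v => ((relaxationCmd.exec env s).nat 8 v 0 : ℝ) / 2 := by
  rw [relaxationCmd, Cmd.exec, Cmd.exec, Cmd.exec]
  have hF1 := frame env initCmd s
  have h1 := initCmd_spec env h
  set s1 := initCmd.exec env s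
  have hI1 : FlowInv I k d (restrict I.coverGraph U).Adj s1 :=
    ⟨h.of_frame hF1 rfl, fun u v => by rw [hF1.nat 3 rfl, hG],
      h1 ▸ Preflow.initial_valid I.cost_nonneg (by omega)⟩
  obtain ⟨hI2, hs⟩ := settleCmd_spec env hI1 (h1 ▸ Preflow.initial_potential I.cost_nonneg)
  set s2 := settleCmd.exec env s1
  obtain ⟨hgap, hlt⟩ := gapCmd_spec env hI2.inputs
  have hF3 := frame env gapCmd s2
  set s3 := gapCmd.exec env s2
  have h8 := solutionCmd_spec env (hI2.inputs.of_frame hF3 rfl)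
  have hp : s3.preflow = s2.preflow := State.preflow_congr (hF3.real 5 rfl) (hF3.real 6 rfl)
    (hF3.real 7 rfl) (hF3.nat 5 rfl) (hF3.nat 6 rfl)
  rw [hp] at h8
  have hfeas : ∀ {u v : Fin n}, (restrict I.coverGraph U).Adj u v → (2 : ℝ) ≤
      s2.preflow.twiceSolution (s3.nat 7 0 0) u + s2.preflow.twiceSolution (s3.nat 7 0 0) v :=
    fun huv => by
      exact_mod_cast Preflow.twiceSolution_feasible hI2.valid (fun u v h => h.symm) hgap huv
  refine ⟨⟨fun v _ => div_nonneg (Nat.cast_nonneg _) zero_le_two, fun u hu v hv huv => ?_⟩, fun v _ => ?_, fun y hy => ?_⟩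
  · simp only [h8]
    have := hfeas (u := u) (v := v) ⟨huv, hu, hv⟩
    linarith
  · simp only [h8, Preflow.twiceSolution]
    split_ifs <;> norm_num
  · have := Preflow.twiceSolution_optimal hI2.valid I.cost_nonneg hs hlt hgap
      (y := fun v => if v ∈ U then y v else 0)
      (fun v => by
        split_ifs with hv
        · exact hy.1 v hv
        · exact le_rfl)
      (fun u v huv => by
        rw [if_pos huv.2.1, if_pos huv.2.2]
        exact hy.2 u huv.2.1 v huv.2.2 huv.1)
    simp only [mul_ite, mul_zero, Finset.sum_ite_mem, Finset.univ_inter] at this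
    refine le_trans ?_ this
    simp only [h8]
    exact Finset.sum_le_sum_of_subset_of_nonneg (Finset.subset_univ _) fun v _ _ =>
      mul_nonneg (I.cost_nonneg v)
        (div_nonneg (Nat.cast_nonneg _) zero_le_two)

end HypOrient

namespace HypOrient

variable {n m : ℕ}

/-! ### Queries -/

open Classical in
/-- Natural array `11` marks the queried vertices, and real array `8` holds the known lower bounds
on the weights. -/
structure Tracks (I : Instance n m) (k : ℕ) (d : ℝ) (w : Fin n → ℝ) (s : State n) : Prop where
  inputs : Inputs I k d s
  mark : ∀ v : Fin n, s.nat 11 v 0 = if v ∈ s.queried then 1 else 0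
  bound : ∀ v : Fin n, s.real 8 v 0 = I.lower w s.queried v

namespace Tracks

variable {I : Instance n m} {k : ℕ} {d : ℝ} {w : Fin n → ℝ} {s s' : State n}
  (h : Tracks I k d w s)
include h

theorem congr (hi : Inputs I k d s') (h11 : s'.nat 11 = s.nat 11) (h8 : s'.real 8 = s.real 8)
    (hq : s'.queries = s.queries) : Tracks I k d w s' := by
  have hq' : s'.queried = s.queried := by rw [State.queried, State.queried, hq]
  exact ⟨hi, fun v => by rw [h11, hq', h.mark], fun v => by rw [h8, hq', h.bound]⟩

theorem of_frame {p : Cmd} (hF : Frame p s s') (hp : p.keepsInputs = true)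
    (h11 : p.writesNat 11 = false) (h8 : p.writesReal 8 = false) (hq : p.noQuery = true) :
    Tracks I k d w s' :=
  h.congr (h.inputs.of_frame hF hp) (hF.nat 11 h11) (hF.real 8 h8) (hF.queries hq)

theorem tick (t : ℕ) : Tracks I k d w (s.tick t) := h.congr (h.inputs.tick t) rfl rfl rfl

theorem enter {a : ℕ} (ha : 12 ≤ a) (t : ℕ) : Tracks I k d w (s.enter a t) :=
  h.congr (h.inputs.enter (by omega) t) (enter_nat_of_ne _ (by omega) _) rfl rfl

theorem marked_iff (v : Fin n) : 1 ≤ s.nat 11 v 0 ↔ v ∈ s.queried := by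
  rw [h.mark]
  split_ifs with hv <;> simp [hv]

theorem unmarked_iff (v : Fin n) : s.nat 11 v 0 ≤ 0 ↔ v ∉ s.queried := by
  rw [h.mark]
  split_ifs with hv <;> simp [hv]

end Tracks

/-- Query the vertex in entry `(0, 0)` of natural array `c`. -/
def queryCmd (c : ℕ) : Cmd :=
  .seq (.query 8 (.var c) (.const 0) (.var c)) (.setNat 11 (.var c) (.const 0) (.const 1))

theorem queryCmd_queries {env : Env n} {c : ℕ} {s : State n} {v : Fin n} (hv : s.nat c 0 0 = v) :
    ((queryCmd c).exec env s).queries = s.queries ++ [v] := by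
  rw [queryCmd, Cmd.exec, exec_query v (show (NExp.var c).eval s = v from hv)]
  rfl

theorem queryCmd_queried {env : Env n} {c : ℕ} {s : State n} {v : Fin n} (hv : s.nat c 0 0 = v) :
    ((queryCmd c).exec env s).queried = insert v s.queried := by
  rw [State.queried, queryCmd_queries hv, State.queried, List.toFinset_append, Finset.union_comm]
  rfl

theorem queryCmd_tracks {I : Instance n m} {k : ℕ} {d : ℝ} {env : Env n} {c : ℕ} {s : State n}
    {v : Fin n} (h : Tracks I k d env.weight s) (hv : s.nat c 0 0 = v) :
    Tracks I k d env.weight ((queryCmd c).exec env s) := by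
  have hq := queryCmd_queried (env := env) hv
  refine ⟨h.inputs.exec env rfl, fun u => ?_, fun u => ?_⟩
  · rw [hq]
    rw [queryCmd, Cmd.exec, exec_query v (show (NExp.var c).eval s = v from hv)]
    simp only [Cmd.exec, put_self, NExp.eval, hv, h.mark, Fin.val_inj, Finset.mem_insert, and_true]
    by_cases huv : u = v <;> simp [huv]
  · rw [hq]
    rw [queryCmd, Cmd.exec, exec_query v (show (NExp.var c).eval s = v from hv)]
    simp only [Cmd.exec, put_self, NExp.eval, hv, h.bound, Fin.val_inj, and_true]
    unfold Instance.lower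
    by_cases huv : u = v <;> simp [huv]

/-! ### Candidates for the minimum of a hyperedge -/

/-- Set flag `12` if some vertex of hyperedge `21` is a better candidate than vertex `22`. -/
def betterCmd : Cmd :=
  .search 12 24 .vertices .skip (.both (.inc (.var 21) (.var 24))
    (.either (.realLT (.entry 8 (.var 24)) (.entry 8 (.var 22)))
      (.both (.natLE (.const 1) (.entry 11 (.var 24))) (.both (.natLE (.entry 11 (.var 22)) (.const 0))
        (.realLE (.entry 8 (.var 24)) (.entry 8 (.var 22)))))))

/-- Set flag `13` if another vertex of hyperedge `21` might be lighter than vertex `22`. -/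
def challengeCmd : Cmd :=
  .search 13 24 .vertices .skip (.both (.inc (.var 21) (.var 24))
    (.both (.neg (.natEq (.var 24) (.var 22))) (.realLT (.entry 8 (.var 24)) (.hi (.var 22)))))

/-- Vertex `22` is a candidate for the minimum of hyperedge `21`. -/
def isCandidate : Test := .both (.inc (.var 21) (.var 22)) (.neg (.flag 12))

section candidate

variable {I : Instance n m} {k : ℕ} {d : ℝ} {env : Env n} {s : State n} {j : Fin m} {b : Fin n}

/-- The search looks for a violation of candidacy: a smaller bound, or a bound no larger at a
queried vertex while `b` is unqueried. -/
theorem betterCmd_spec (h : Tracks I k d env.weight s) (hj : s.nat 21 0 0 = j)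
    (hb : s.nat 22 0 0 = b) :
    isCandidate.eval (betterCmd.exec env s) ↔ I.Candidate env.weight s.queried j b := by
  have hF := frame env betterCmd s
  have key : 1 ≤ (betterCmd.exec env s).nat 12 0 0 ↔ ∃ u : Fin n, u ∈ I.edge j ∧
      (I.lower env.weight s.queried u < I.lower env.weight s.queried b ∨ (u ∈ s.queried ∧
        b ∉ s.queried ∧ I.lower env.weight s.queried u ≤ I.lower env.weight s.queried b)) := by
    refine search_spec (fun u : Fin n => u ∈ I.edge j ∧
      (I.lower env.weight s.queried u < I.lower env.weight s.queried b ∨ (u ∈ s.queried ∧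
        b ∉ s.queried ∧ I.lower env.weight s.queried u ≤ I.lower env.weight s.queried b)))
      (by decide) (by decide) rfl h.inputs.eval_vertices ?_
    intro u s' hn hR hu
    simp only [Cmd.exec, Test.eval, Test.eval_either, Test.eval_realLT, NExp.eval, RExp.eval, hu,
      hn 21 (by decide) (by decide) rfl, hn 22 (by decide) (by decide) rfl,
      hn 1 (by decide) (by decide) rfl, hn 11 (by decide) (by decide) rfl, hR 8 rfl, hj, hb,
      h.inputs.incidence, h.marked_iff, h.unmarked_iff, h.bound]
  simp only [isCandidate, Test.eval, Test.eval_flag, key, NExp.eval, hF.nat 21 rfl, hF.nat 22 rfl,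
    hF.nat 1 rfl, hj, hb, h.inputs.incidence, Instance.Candidate]
  push Not
  refine and_congr_right fun _ => forall₂_congr fun u _ => and_congr_right fun _ => ?_
  rfl

theorem challengeCmd_spec (h : Tracks I k d env.weight s) (hj : s.nat 21 0 0 = j)
    (hb : s.nat 22 0 0 = b) :
    1 ≤ (challengeCmd.exec env s).nat 13 0 0 ↔ I.Challenged env.weight s.queried j b := by
  refine search_spec (fun u : Fin n => u ∈ I.edge j ∧ u ≠ b ∧
    I.lower env.weight s.queried u < I.hi b) (by decide) (by decide) rfl h.inputs.eval_vertices ?_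
  intro u s' hn hR hu
  simp only [Cmd.exec, Test.eval, Test.eval_natEq, Test.eval_realLT, NExp.eval, RExp.eval, hu,
    hn 21 (by decide) (by decide) rfl, hn 22 (by decide) (by decide) rfl,
    hn 1 (by decide) (by decide) rfl, hR 8 rfl, hR 0 rfl, hj, hb,
    h.inputs.incidence, h.inputs.hi, h.bound, Fin.val_inj, ne_eq]

end candidate

/-! ### Queries of known mandatory vertices -/

/-- Query vertex `22` if it is known to be mandatory because of hyperedge `21`. -/
def examineCmd : Cmd :=
  .seq betterCmd (.seq challengeCmd
    (.cond (.both isCandidate (.both (.natLE (.entry 11 (.var 22)) (.const 0)) (.flag 13)))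
      (queryCmd 22) .skip))

/-- After the queries `first`, only known mandatory vertices have been queried. -/
structure Adaptive (I : Instance n m) (k : ℕ) (d : ℝ) (w : Fin n → ℝ) (first : List (Fin n))
    (s : State n) : Prop where
  tracks : Tracks I k d w s
  later : ∃ later, s.queries = first ++ later ∧ ∀ before v after, later = before ++ v :: after →
    I.KnownMandatory w (first ++ before).toFinset v

namespace Adaptive

variable {I : Instance n m} {k : ℕ} {d : ℝ} {w : Fin n → ℝ} {first : List (Fin n)}
  {s s' : State n} (h : Adaptive I k d w first s)
include h

theorem congr (ht : Tracks I k d w s') (hq : s'.queries = s.queries) :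
    Adaptive I k d w first s' := ⟨ht, hq ▸ h.later⟩

theorem tick (t : ℕ) : Adaptive I k d w first (s.tick t) := h.congr (h.tracks.tick t) rfl

theorem enter {a : ℕ} (ha : 12 ≤ a) (t : ℕ) : Adaptive I k d w first (s.enter a t) :=
  h.congr (h.tracks.enter ha t) rfl

theorem append (ht : Tracks I k d w s') {v : Fin n} (hq : s'.queries = s.queries ++ [v])
    (hv : I.KnownMandatory w s.queried v) : Adaptive I k d w first s' := by
  obtain ⟨later, h1, h2⟩ := h.later
  refine ⟨ht, later ++ [v], by rw [hq, h1, List.append_assoc], fun before u after h3 => ?_⟩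
  -- Either the split is at the new last query, where the claim is `hv`, or it is a split of the old
  -- list.
  rcases List.eq_nil_or_concat after with rfl | ⟨after', z, rfl⟩
  · obtain ⟨h4, h5⟩ := List.append_inj' h3 rfl
    rw [← h4, ← h1, ← (List.singleton_inj.1 h5)]
    exact hv
  · rw [List.concat_eq_append, ← List.cons_append, ← List.append_assoc] at h3
    exact h2 before u after' (List.append_inj' h3 rfl).1

end Adaptive

section adaptive

variable {I : Instance n m} {k : ℕ} {d : ℝ} {env : Env n} {first : List (Fin n)}

/-- The number of vertices that are not queried. -/
def unqueried (Q : Finset (Fin n)) : ℤ := n - Q.card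

/-- Any query made here is of an unqueried challenged candidate. The queried set contains the
covering list `first`, so `Candidate.knownMandatory` applies, and the number of unqueried vertices
drops. -/
theorem examineCmd_steps (hI : I.Preprocessed) (hw : I.Realization env.weight)
    (hcov : ∀ u v, I.coverGraph.Adj u v → u ∈ first ∨ v ∈ first) {j : Fin m} {b : Fin n}
    {s : State n} (hj : s.nat 21 0 0 = j) (hb : s.nat 22 0 0 = b) :
    examineCmd.Steps env (Adaptive I k d env.weight first) State.queried unqueried
      (fun Q => ¬ (I.Candidate env.weight Q j b ∧ b ∉ Q ∧ I.Challenged env.weight Q j b)) s := by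
  intro h
  rw [examineCmd, Cmd.exec, Cmd.exec]
  have hF1 := frame env betterCmd s
  have h1 := betterCmd_spec h.tracks hj hb
  have t1 := h.tracks.of_frame hF1 rfl rfl rfl rfl
  have q1 : (betterCmd.exec env s).queried = s.queried := by
    rw [State.queried, State.queried, hF1.queries rfl]
  have hj1 : (betterCmd.exec env s).nat 21 0 0 = j := by rw [hF1.nat 21 rfl, hj]
  have hb1 : (betterCmd.exec env s).nat 22 0 0 = b := by rw [hF1.nat 22 rfl, hb]
  have hq1 : (betterCmd.exec env s).queries = s.queries := hF1.queries rfl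
  set s1 := betterCmd.exec env s
  have hF2 := frame env challengeCmd s1
  have h2 := challengeCmd_spec t1 hj1 hb1
  have t2 := t1.of_frame hF2 rfl rfl rfl rfl
  have q2 : (challengeCmd.exec env s1).queries = s.queries := by rw [hF2.queries rfl, hq1]
  have q2' : (challengeCmd.exec env s1).queried = s.queried := by
    rw [State.queried, State.queried, q2]
  have hb2 : (challengeCmd.exec env s1).nat 22 0 0 = b := by rw [hF2.nat 22 rfl, hb1]
  have htest : (Test.both isCandidate (.both (.natLE (.entry 11 (.var 22)) (.const 0))
      (.flag 13))).eval (challengeCmd.exec env s1) ↔ I.Candidate env.weight s.queried j b ∧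
        b ∉ s.queried ∧ I.Challenged env.weight s.queried j b := by
    have hc : isCandidate.eval (challengeCmd.exec env s1) ↔ isCandidate.eval s1 := by
      simp only [isCandidate, Test.eval, Test.eval_flag, NExp.eval, hF2.nat 21 rfl, hF2.nat 22 rfl,
        hF2.nat 1 rfl, hF2.nat 12 rfl]
    rw [Test.eval, Test.eval, hc, h1, Test.eval_flag, h2, q1]
    simp only [Test.eval, NExp.eval, hb2, t2.unmarked_iff, q2']
  set s2 := challengeCmd.exec env s1
  rw [Cmd.exec.eq_5]
  by_cases hc : I.Candidate env.weight s.queried j b ∧ b ∉ s.queried ∧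
      I.Challenged env.weight s.queried j b
  · rw [if_pos (htest.2 hc)]
    have hb3 : (s2.tick 1).nat 22 0 0 = b := hb2
    have hqs : ((queryCmd 22).exec env (s2.tick 1)).queries = s.queries ++ [b] := by
      rw [queryCmd_queries hb3]
      exact congrArg (· ++ [b]) q2
    refine ⟨h.append (queryCmd_tracks (t2.tick 1) hb3) hqs ?_, Or.inr ⟨not_not.2 hc, ?_⟩⟩
    · refine hc.1.knownMandatory hI hw (fun u v huv => ?_) hc.2.1 hc.2.2
      obtain ⟨later, hl, -⟩ := h.later
      rw [State.queried, hl]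
      simp only [List.mem_toFinset, List.mem_append]
      exact (hcov u v huv).imp Or.inl Or.inl
    · rw [queryCmd_queried hb3, show (s2.tick 1).queried = s.queried from q2', unqueried, unqueried,
        Finset.card_insert_of_notMem hc.2.1]
      push_cast
      omega
  · rw [if_neg (mt htest.1 hc)]
    exact ⟨h.congr (t2.tick 1) q2, Or.inl ⟨hc, q2'⟩⟩

/-- Query known mandatory vertices until no more are found. -/
def adaptiveCmd : Cmd :=
  .loop 20 (.add .vertices (.const 1)) (.loop 21 .edges (.loop 22 .vertices examineCmd))

theorem adaptiveCmd_spec (hI : I.Preprocessed) (hw : I.Realization env.weight)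
    (hcov : ∀ u v, I.coverGraph.Adj u v → u ∈ first ∨ v ∈ first) {s : State n}
    (h : Adaptive I k d env.weight first s) :
    Adaptive I k d env.weight first (adaptiveCmd.exec env s) ∧ ∀ (j : Fin m) (b : Fin n),
      ¬ (I.Candidate env.weight (adaptiveCmd.exec env s).queried j b ∧
        b ∉ (adaptiveCmd.exec env s).queried ∧
        I.Challenged env.weight (adaptiveCmd.exec env s).queried j b) := by
  have hstep : ∀ s : State n, (Cmd.loop 21 .edges (.loop 22 .vertices examineCmd)).Steps env
      (Adaptive I k d env.weight first) State.queried unqueried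
      (fun Q => ∀ (j : Fin m) (b : Fin n), ¬ (I.Candidate env.weight Q j b ∧ b ∉ Q ∧
        I.Challenged env.weight Q j b)) s := fun s =>
    Cmd.Steps.loop (fun h => h.tracks.inputs.num_edges) (fun s h => h.tick 1) (fun s => rfl)
      (fun s t h => h.enter (by decide) t) (fun s t => rfl) (fun j s hj => by
        intro h
        have key := Cmd.Steps.loop (env := env)
          (Inv := fun s => Adaptive I k d env.weight first s ∧ s.nat 21 0 0 = j)
          (core := State.queried) (Φ := unqueried) (a := 22) (e := .vertices) (p := examineCmd)
          (G := fun b Q => ¬ (I.Candidate env.weight Q j b ∧ b ∉ Q ∧ I.Challenged env.weight Q j b))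
          (s := s) (fun h => h.1.tracks.inputs.num_vertices) (fun s h => ⟨h.1.tick 1, h.2⟩)
          (fun s => rfl)
          (fun s t h => ⟨h.1.enter (by decide) t, by rw [enter_nat_of_ne _ (by decide), h.2]⟩)
          (fun s t => rfl)
          (fun b s hb h => by
            obtain ⟨h3, h4⟩ := examineCmd_steps hI hw hcov h.2 hb h.1
            exact ⟨⟨h3, by rw [(frame env _ s).nat 21 rfl, h.2]⟩, h4⟩)
        obtain ⟨h5, h6⟩ := key ⟨h, hj⟩
        exact ⟨h5.1, h6⟩)
  -- At most `n` passes can query something new, so among `n + 1` passes one is idle.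
  obtain ⟨h1, -, h2⟩ := (Cmd.Steps.settles hstep).loop (a := 20) (e := .add .vertices (.const 1))
    (N := n + 1) (fun s hs => by simp only [NExp.eval, hs.tracks.inputs.num_vertices])
    (fun s h => h.tick 1) (fun s => rfl) (fun s t h => h.enter (by decide) t) (fun s t => rfl) s h
  refine ⟨h1, h2.resolve_left fun h3 => ?_⟩
  unfold unqueried at h3
  have h4 := Finset.card_le_univ
    ((Cmd.loop 20 (.add .vertices (.const 1)) (.loop 21 .edges (.loop 22 .vertices examineCmd))).exec
      env s).queried
  rw [Fintype.card_fin] at h4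
  push_cast at h3
  omega

/-- Store in array `2` a candidate for the minimum of each hyperedge. -/
def outputCmd : Cmd :=
  .loop 21 .edges (.loop 22 .vertices
    (.seq betterCmd (.cond isCandidate (.setNat 2 (.var 21) (.const 0) (.var 22)) .skip)))

theorem outputCmd_spec {s : State n} (h : Tracks I k d env.weight s) (j : Fin m) :
    ∃ b : Fin n, (outputCmd.exec env s).nat 2 j 0 = b ∧ I.Candidate env.weight s.queried j b := by
  refine loop_rule (env := env) (a := 21) (e := .edges) (s := s) (N := m)
    (fun t s' => ∀ j : Fin m, (j : ℕ) < t → ∃ b : Fin n, s'.nat 2 j 0 = b ∧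
      I.Candidate env.weight s.queried j b) h.inputs.num_edges
    (fun j hj => absurd hj (Nat.not_lt_zero _)) ?_ j j.2
  intro t ht s' hF hI j hj
  obtain ⟨z, rfl⟩ : ∃ z : Fin m, (z : ℕ) = t := ⟨⟨t, ht⟩, rfl⟩
  have hq0 : (s'.enter 21 z).queries = s.queries := hF.queries rfl
  have t0 : Tracks I k d env.weight (s'.enter 21 z) :=
    (h.of_frame hF rfl rfl rfl rfl).enter (by decide) z
  set s0 := s'.enter 21 z with hs0
  have hj0 : s0.nat 21 0 0 = z := enter_nat_self _ _ _
  have hn0 : s0.nat 2 = s'.nat 2 := enter_nat_of_ne _ (by decide) _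
  have := loop_rule (env := env) (a := 22) (e := .vertices) (s := s0) (N := n)
    (p := .seq betterCmd (.cond isCandidate (.setNat 2 (.var 21) (.const 0) (.var 22)) .skip))
    -- Answers for other hyperedges are preserved, and the present one is meaningful as soon as a
    -- candidate has been seen; `exists_candidate` guarantees that this happens.
    (fun t s' => (∀ x y : ℕ, x ≠ z → s'.nat 2 x y = s0.nat 2 x y) ∧
      ((∃ b : Fin n, (b : ℕ) < t ∧ I.Candidate env.weight s.queried z b) →
        ∃ b : Fin n, s'.nat 2 z 0 = b ∧ I.Candidate env.weight s.queried z b))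
    t0.inputs.num_vertices
    ⟨fun x y hx => rfl, fun ⟨b, hb, _⟩ => absurd hb (Nat.not_lt_zero _)⟩ (by
      rintro r hr s1 hF1 ⟨h1, h2⟩
      obtain ⟨b, rfl⟩ : ∃ b : Fin n, (b : ℕ) = r := ⟨⟨r, hr⟩, rfl⟩
      have t1 : Tracks I k d env.weight (s1.enter 22 b) :=
        (t0.of_frame hF1 rfl rfl rfl rfl).enter (by decide) b
      have hq1 : (s1.enter 22 b).queried = s.queried := by
        rw [State.queried, State.queried]
        exact congrArg List.toFinset ((hF1.queries rfl).trans hq0)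
      have hj1 : (s1.enter 22 b).nat 21 0 0 = z := by
        rw [enter_nat_of_ne _ (by decide), hF1.nat 21 rfl, hj0]
      have hb1 : (s1.enter 22 b).nat 22 0 0 = b := enter_nat_self _ _ _
      have hspec := betterCmd_spec t1 hj1 hb1
      rw [hq1] at hspec
      have hF2 := frame env betterCmd (s1.enter 22 b)
      have hn2 : (betterCmd.exec env (s1.enter 22 b)).nat 2 = s1.nat 2 := by
        rw [hF2.nat 2 rfl, enter_nat_of_ne _ (by decide)]
      have hj2 : (betterCmd.exec env (s1.enter 22 b)).nat 21 0 0 = z := by rw [hF2.nat 21 rfl, hj1]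
      have hb2 : (betterCmd.exec env (s1.enter 22 b)).nat 22 0 0 = b := by rw [hF2.nat 22 rfl, hb1]
      rw [Cmd.exec]
      set s2 := betterCmd.exec env (s1.enter 22 b)
      rw [Cmd.exec.eq_5]
      by_cases hc : I.Candidate env.weight s.queried z b
      · rw [if_pos (hspec.2 hc)]
        have e2 : ∀ x y, ((Cmd.setNat 2 (.var 21) (.const 0) (.var 22)).exec env
            (s2.tick 1)).nat 2 x y = if x = z ∧ y = 0 then (b : ℕ) else s1.nat 2 x y := fun x y => by
          simp only [Cmd.exec, put_self, NExp.eval, State.tick, hj2, hb2, hn2]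
        simp only [e2]
        exact ⟨fun x y hx => by rw [if_neg (fun h => hx h.1), h1 x y hx],
          fun _ => ⟨b, by simp, hc⟩⟩
      · rw [if_neg (mt hspec.1 hc)]
        have e2 : ((Cmd.skip).exec env (s2.tick 1)).nat 2 = s1.nat 2 := hn2
        rw [e2]
        refine ⟨h1, fun ⟨b', hb', hc'⟩ => h2 ⟨b', ?_, hc'⟩⟩
        rcases Nat.lt_succ_iff_lt_or_eq.1 hb' with h | h
        · exact h
        · exact absurd (Fin.ext h ▸ hc') hc)
  rcases Nat.lt_succ_iff_lt_or_eq.1 hj with h | h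
  · rw [this.1 j 0 (by omega), hn0]
    exact hI j h
  · have : j = z := Fin.ext h
    subst this
    obtain ⟨b, hb⟩ := I.exists_candidate env.weight s.queried j
    exact this.2 ⟨b, b.2, hb⟩

end adaptive

end HypOrient

namespace HypOrient

variable {n m : ℕ}

/-! ### The program -/

/-- Copy the query costs to real array `9` and the left end points to real array `8`. -/
def copyCmd : Cmd :=
  .loop 20 .vertices (.seq (.setReal 9 (.var 20) (.const 0) (.cost (.var 20)))
    (.setReal 8 (.var 20) (.const 0) (.lo (.var 20))))

/-- The vertex cover call expects weights in column `0` of an array of their own, and the left end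
points are the lower bounds known before any query. -/
theorem copyCmd_spec {I : Instance n m} {k : ℕ} {d : ℝ} {s : State n} (env : Env n)
    (h : Inputs I k d s) (v : Fin n) :
    (copyCmd.exec env s).real 9 v 0 = I.cost v ∧ (copyCmd.exec env s).real 8 v 0 = I.lo v := by
  refine loop_rule (env := env) (a := 20) (e := .vertices) (s := s) (N := n)
    (fun t s' => ∀ v : Fin n, (v : ℕ) < t → s'.real 9 v 0 = I.cost v ∧ s'.real 8 v 0 = I.lo v)
    h.num_vertices (fun u hu => absurd hu (Nat.not_lt_zero _)) ?_ v v.2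
  intro t ht s' hF hI v hv
  have hi := h.of_frame hF rfl
  rcases Nat.lt_succ_iff_lt_or_eq.1 hv with h1 | h1
  · have h' : (v : ℕ) ≠ t := by omega
    rw [← (hI v h1).1, ← (hI v h1).2]
    simp [Cmd.exec, put_self, put_of_ne, NExp.eval, State.enter, h']
  · subst h1
    rw [← hi.cost, ← hi.lo]
    simp [Cmd.exec, put_self, put_of_ne, NExp.eval, RExp.eval, State.enter]

/-- Store in array `9` the vertices that have the value `1 / 2` in the half-integral solution. -/
def supportCmd : Cmd :=
  .mark 9 20 (.const 0) .skip
    (.both (.natLE (.entry 4 (.var 20)) (.const 0)) (.natEq (.entry 8 (.var 20)) (.const 1)))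

/-- Everything up to the call of the vertex cover procedure. -/
def planCmd : Cmd :=
  .seq (.seq thresholdCmd (.seq graphCmd relaxationCmd)) (.seq supportCmd copyCmd)

/-- The LP solution of the algorithm. -/
def Instance.solution (I : Instance n m) (k : ℕ) (d : ℝ) (env : Env n) (v : Fin n) : ℝ :=
  ((planCmd.exec env (I.start k d)).nat 8 v 0 : ℝ) / 2

theorem Instance.inputs_start (I : Instance n m) (k : ℕ) (d : ℝ) : Inputs I k d (I.start k d) :=
  ⟨rfl, rfl, rfl, rfl⟩

open Classical in
theorem planCmd_spec (I : Instance n m) (k : ℕ) (d : ℝ) (env : Env n) :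
    let M := overThreshold d (I.estimate k env.tape)
    let s := planCmd.exec env (I.start k d)
    I.IsHalfIntegralOptimum Mᶜ (I.solution k d env) ∧ s.draws = n * k * n ∧
      (∀ v : Fin n, s.nat 4 v 0 = if v ∈ M then 1 else 0) ∧
      s.coverInput 9 3 9 = I.coverInput (levelSet Mᶜ (I.solution k d env) (1 / 2)) ∧
      ∀ v : Fin n, s.real 8 v 0 = I.lo v := by
  intro M s
  obtain ⟨h1, h2⟩ := thresholdCmd_spec env (I.inputs_start k d) rfl
  set s1 := thresholdCmd.exec env (I.start k d) with hs1
  have i1 : Inputs I k d s1 := (I.inputs_start k d).exec env rfl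
  have h3 := graphCmd_spec env i1 h2
  have F2 := frame env graphCmd s1
  set s2 := graphCmd.exec env s1 with hs2
  have i2 : Inputs I k d s2 := i1.exec env rfl
  have h4 := relaxationCmd_spec env i2 h3
  have F3 := frame env relaxationCmd s2
  set s3 := relaxationCmd.exec env s2 with hs3
  have i3 : Inputs I k d s3 := i2.exec env rfl
  have F4 := frame env supportCmd s3
  have h4' : ∀ v : Fin n, s3.nat 4 v 0 = if v ∈ M then 1 else 0 := fun v => by
    rw [F3.nat 4 rfl, F2.nat 4 rfl, h2]
  have h5 := (mark_spec (a := 9) (c := 20) (i := .const 0) (x := 0) (pre := .skip)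
    (b := .both (.natLE (.entry 4 (.var 20)) (.const 0)) (.natEq (.entry 8 (.var 20)) (.const 1)))
    env i3 (fun v => v ∉ M ∧ s3.nat 8 v 0 = 1) (by decide) rfl rfl (fun v s' hn hR hv => by
      simp only [Cmd.exec, Test.eval, Test.eval_natEq, NExp.eval, hv,
        hn 4 (by decide) (by decide) rfl, hn 8 (by decide) (by decide) rfl, h4', and_true]
      refine and_congr_left fun _ => ?_
      split_ifs with hM <;> simp [hM])).1
  set s4 := supportCmd.exec env s3 with hs4
  have i4 : Inputs I k d s4 := i3.exec env rfl
  have F5 := frame env copyCmd s4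
  have h6 := copyCmd_spec env i4
  have hs : s = copyCmd.exec env s4 := by
    simp only [s, planCmd, Cmd.exec.eq_2, hs4, hs3, hs2, hs1]
  have e8 : s.nat 8 = s3.nat 8 := by rw [hs, F5.nat 8 rfl, F4.nat 8 rfl]
  have e9 : ∀ v : Fin n, s.nat 9 v 0 = 1 ↔ v ∉ M ∧ s3.nat 8 v 0 = 1 := fun v => by
    rw [hs, F5.nat 9 rfl, show s4.nat 9 v 0 = _ from h5 v]
    split_ifs with h <;> simp [h]
  have hx : I.solution k d env = fun v : Fin n => (s3.nat 8 v 0 : ℝ) / 2 := by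
    funext v
    rw [Instance.solution, ← e8]
  have hS : (Finset.univ.filter fun v : Fin n => s.nat 9 v 0 = 1) =
      levelSet Mᶜ (I.solution k d env) (1 / 2) := by
    ext v
    rw [Finset.mem_filter, mem_levelSet, e9, Finset.mem_compl]
    have : (s3.nat 8 v 0 : ℝ) / 2 = 1 / 2 ↔ s3.nat 8 v 0 = 1 := by
      rw [div_left_inj' two_ne_zero, Nat.cast_eq_one]
    simp only [hx, this, Finset.mem_univ, true_and]
  refine ⟨hx ▸ h4, ?_, fun v => ?_, ?_, fun v => ?_⟩
  · rw [hs, F5.draws rfl, F4.draws rfl, F3.draws rfl, F2.draws rfl, h1]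
  · rw [hs, F5.nat 4 rfl, F4.nat 4 rfl, h4']
  · unfold State.coverInput Instance.coverInput
    rw [hS]
    refine congrArg₂ (CoverInput.mk _) ?_ ?_
    -- Array `3` holds the graph induced on the complement of `M`. The call restricts it further to
    -- the half-integral vertices, which lie in that complement, so the result is an induced
    -- subgraph of the full cover graph.
    · ext u v
      simp only [restrict, SimpleGraph.fromRel_adj]
      refine and_congr_left fun h => ?_
      have e3 : ∀ u v : Fin n, s.nat 3 u v = 1 ↔ I.coverGraph.Adj u v ∧ u ∉ M ∧ v ∉ M := by
        intro u v
        rw [hs, F5.nat 3 rfl, F4.nat 3 rfl, F3.nat 3 rfl, h3]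
        simp [restrict, M]
      rw [mem_levelSet, mem_levelSet, Finset.mem_compl, Finset.mem_compl] at h
      rw [e3, e3]
      constructor
      · rintro ⟨-, h | h⟩
        · exact h.1
        · exact h.1.symm
      · exact fun h' => ⟨h'.ne, Or.inl ⟨h', h.1.1, h.2.1⟩⟩
    · funext v
      rw [hs, (h6 v).1]
  · rw [hs, (h6 v).2]

/-- Query the threshold vertices, those of value `1` in the half-integral solution, and the vertex
cover. -/
def firstCmd : Cmd :=
  .loop 20 .vertices (.cond (.either (.natLE (.const 1) (.entry 4 (.var 20)))
    (.either (.natEq (.entry 8 (.var 20)) (.const 2)) (.natLE (.const 1) (.entry 10 (.var 20)))))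
    (queryCmd 20) .skip)

theorem firstCmd_spec {I : Instance n m} {k : ℕ} {d : ℝ} {env : Env n} {s : State n}
    (h : Tracks I k d env.weight s) (hq : s.queries = []) {F : Finset (Fin n)}
    (hF : ∀ v : Fin n, (1 ≤ s.nat 4 v 0 ∨ s.nat 8 v 0 = 2 ∨ 1 ≤ s.nat 10 v 0) ↔ v ∈ F) :
    Tracks I k d env.weight (firstCmd.exec env s) ∧ (firstCmd.exec env s).queried = F := by
  have := loop_rule (env := env) (a := 20) (e := .vertices) (s := s) (N := n)
    (p := .cond (.either (.natLE (.const 1) (.entry 4 (.var 20)))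
      (.either (.natEq (.entry 8 (.var 20)) (.const 2)) (.natLE (.const 1) (.entry 10 (.var 20)))))
      (queryCmd 20) .skip)
    (fun t s' => Tracks I k d env.weight s' ∧
      ∀ v : Fin n, v ∈ s'.queried ↔ (v : ℕ) < t ∧ v ∈ F) h.inputs.num_vertices
    ⟨h.tick 1, fun v => by simp [State.queried, State.tick, hq]⟩ (by
      rintro t ht s' hF' ⟨h1, h2⟩
      obtain ⟨z, rfl⟩ : ∃ z : Fin n, (z : ℕ) = t := ⟨⟨t, ht⟩, rfl⟩
      have hz : (s'.enter 20 z).nat 20 0 0 = z := enter_nat_self _ _ _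
      have t1 : Tracks I k d env.weight (s'.enter 20 z) := h1.enter (by decide) z
      have q1 : ((s'.enter 20 z).tick 1).queried = s'.queried := rfl
      have hlt : ∀ v : Fin n, (v : ℕ) < z + 1 ↔ v = z ∨ (v : ℕ) < z := fun v => by
        rw [Nat.lt_succ_iff_lt_or_eq, Fin.val_inj, or_comm]
      rw [Cmd.exec.eq_5]
      have htest : (Test.either (.natLE (.const 1) (.entry 4 (.var 20)))
          (.either (.natEq (.entry 8 (.var 20)) (.const 2))
            (.natLE (.const 1) (.entry 10 (.var 20))))).eval (s'.enter 20 z) ↔ z ∈ F := by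
        rw [← hF]
        simp only [Test.eval_either, Test.eval_natEq, Test.eval, NExp.eval, hz]
        rw [enter_nat_of_ne _ (by decide), enter_nat_of_ne _ (by decide),
          enter_nat_of_ne _ (by decide), hF'.nat 4 rfl, hF'.nat 8 rfl, hF'.nat 10 rfl]
      by_cases hc : z ∈ F
      · rw [if_pos (htest.2 hc)]
        have hz' : ((s'.enter 20 z).tick 1).nat 20 0 0 = z := hz
        refine ⟨queryCmd_tracks (t1.tick 1) hz', fun v => ?_⟩
        rw [queryCmd_queried hz', q1, Finset.mem_insert, h2, hlt]
        constructor
        · rintro (rfl | h)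
          · exact ⟨Or.inl rfl, hc⟩
          · exact ⟨Or.inr h.1, h.2⟩
        · rintro ⟨rfl | h, h'⟩
          · exact Or.inl rfl
          · exact Or.inr ⟨h, h'⟩
      · rw [if_neg (mt htest.1 hc)]
        refine ⟨t1.tick 1, fun v => ?_⟩
        rw [show ((Cmd.skip).exec env ((s'.enter 20 z).tick 1)).queried = s'.queried from rfl, h2,
          hlt]
        constructor
        · exact fun h => ⟨Or.inr h.1, h.2⟩
        · rintro ⟨rfl | h, h'⟩
          · exact absurd h' hc
          · exact ⟨h, h'⟩)
  refine ⟨this.1, Finset.ext fun v => ?_⟩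
  rw [show v ∈ (firstCmd.exec env s).queried ↔ _ from this.2 v]
  simp

/-- Everything after the call of the vertex cover procedure. -/
def resolveCmd : Cmd := .seq firstCmd (.seq adaptiveCmd outputCmd)

/-- The modified threshold algorithm. -/
def program : Cmd := .seq planCmd (.seq (.cover 9 3 9 10) resolveCmd)

/-- The set of vertices that the algorithm queries before the adaptive phase. -/
def Instance.firstQueries (I : Instance n m) (B : BlackBox n) (M : Finset (Fin n))
    (x : Fin n → ℝ) : Finset (Fin n) :=
  M ∪ levelSet Mᶜ x 1 ∪ B.answer (I.coverInput (levelSet Mᶜ x (1 / 2)))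

/-- An edge avoiding `M` and `V₁` needs values adding up to at least `1` without a value `1`, so
both ends have value `1 / 2` and the black box covers it. -/
theorem firstQueries_covers {I : Instance n m} {B : BlackBox n} {M : Finset (Fin n)}
    {x : Fin n → ℝ} (hx : I.IsHalfIntegralOptimum Mᶜ x)
    (hB : ∀ S, (I.coverInput S).IsCover (B.answer (I.coverInput S))) {u v : Fin n}
    (huv : I.coverGraph.Adj u v) :
    u ∈ I.firstQueries B M x ∨ v ∈ I.firstQueries B M x := by
  obtain ⟨h1, h2, -⟩ := hx
  by_contra! hno
  simp only [Instance.firstQueries, Finset.mem_union, not_or, mem_levelSet, Finset.mem_compl,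
    not_and] at hno
  obtain ⟨⟨⟨hu1, hu2⟩, hu3⟩, ⟨hv1, hv2⟩, hv3⟩ := hno
  have hu1' := Finset.mem_compl.2 hu1
  have hv1' := Finset.mem_compl.2 hv1
  have h3 := h1.2 u hu1' v hv1' huv
  have h4 : x u = 1 / 2 ∧ x v = 1 / 2 := by
    rcases h2 u hu1' with h | h | h <;> rcases h2 v hv1' with h' | h' | h' <;>
      first
      | exact absurd h (hu2 hu1)
      | exact absurd h' (hv2 hv1)
      | exact ⟨h, h'⟩
      | (rw [h, h'] at h3; norm_num at h3)
  have hu : u ∈ levelSet Mᶜ x (1 / 2) := mem_levelSet.2 ⟨hu1', h4.1⟩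
  have hv : v ∈ levelSet Mᶜ x (1 / 2) := mem_levelSet.2 ⟨hv1', h4.2⟩
  exact ((hB _).2 u hu v hv ⟨huv, hu, hv⟩).elim hu3 hv3

/-- The first queries form a vertex cover, which the adaptive phase requires. When that phase ends,
no candidate is both unqueried and challenged, so every candidate written to the output is
certified. Approximation quality of the black box plays no role here. -/
theorem program_spec {I : Instance n m} (hI : I.Preprocessed) (k : ℕ) (d : ℝ) {env : Env n}
    (hw : I.Realization env.weight)
    (hB : ∀ S, (I.coverInput S).IsCover (env.box.answer (I.coverInput S))) :
    I.IsThresholdRun env.box d (I.estimate k env.tape) (I.solution k d env) env.weight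
        (program.exec env (I.start k d)) ∧
      I.Solved env.weight (program.exec env (I.start k d)) ∧
      (program.exec env (I.start k d)).draws = n * k * n := by
  obtain ⟨h1, h2, h3, h4, h5⟩ := planCmd_spec I k d env
  set M := overThreshold d (I.estimate k env.tape) with hM
  set x := I.solution k d env with hx
  have F1 := frame env planCmd (I.start k d)
  have hx8 : ∀ v : Fin n, ((planCmd.exec env (I.start k d)).nat 8 v 0 : ℝ) / 2 = x v := fun v => rfl
  have i1 : Inputs I k d (planCmd.exec env (I.start k d)) := (I.inputs_start k d).exec env rfl
  set s1 := planCmd.exec env (I.start k d) with hs1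
  set p := I.coverInput (levelSet Mᶜ x (1 / 2)) with hp
  have F2 := frame env (.cover 9 3 9 10) s1
  have c2 : ((Cmd.cover 9 3 9 10).exec env s1).calls = [p] := by
    rw [Cmd.exec]
    dsimp only
    rw [F1.calls rfl, h4]
    rfl
  have a2 : ∀ v : Fin n, 1 ≤ ((Cmd.cover 9 3 9 10).exec env s1).nat 10 v 0 ↔
      v ∈ env.box.answer p := fun v => by
    rw [Cmd.exec]
    dsimp only
    rw [dif_pos ⟨rfl, rfl, v.2⟩, h4]
    split_ifs with h <;> simp [h]
  set s2 := (Cmd.cover 9 3 9 10).exec env s1 with hs2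
  have i2 : Inputs I k d s2 := i1.of_frame F2 rfl
  have q2 : s2.queries = [] := by rw [F2.queries rfl, F1.queries rfl]; rfl
  have q2' : s2.queried = ∅ := by rw [State.queried, q2]; rfl
  have t2 : Tracks I k d env.weight s2 := by
    refine ⟨i2, fun v => ?_, fun v => ?_⟩
    · rw [F2.nat 11 rfl, F1.nat 11 rfl, q2']
      simp [Instance.start]
    · rw [F2.real 8 rfl, h5 v, q2']
      simp [Instance.lower]
  obtain ⟨t3, q3⟩ := firstCmd_spec t2 q2 (F := I.firstQueries env.box M x) (fun v => by
    rw [a2, F2.nat 4 rfl, F2.nat 8 rfl, h3]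
    simp only [Instance.firstQueries, Finset.mem_union, mem_levelSet, Finset.mem_compl, ← hx8, ← hp]
    have : ((s1.nat 8 v 0 : ℕ) : ℝ) / 2 = 1 ↔ s1.nat 8 v 0 = 2 := by
      rw [div_eq_one_iff_eq two_ne_zero]
      norm_cast
    rw [this]
    by_cases hv : v ∈ M <;> simp [hv])
  have F3 := frame env firstCmd s2
  set s3 := firstCmd.exec env s2 with hs3
  have hcov : ∀ u v, I.coverGraph.Adj u v → u ∈ s3.queries ∨ v ∈ s3.queries := fun u v huv => by
    have := firstQueries_covers h1 hB huv
    rw [← q3, State.queried, List.mem_toFinset, List.mem_toFinset] at this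
    exact this
  obtain ⟨h6, h7⟩ := adaptiveCmd_spec hI hw hcov (s := s3) ⟨t3, [], by simp, by simp⟩
  have F4 := frame env adaptiveCmd s3
  set s4 := adaptiveCmd.exec env s3 with hs4
  have h8 := outputCmd_spec h6.tracks
  have F5 := frame env outputCmd s4
  have q5 : (outputCmd.exec env s4).queries = s4.queries := F5.queries rfl
  have hfin : program.exec env (I.start k d) = outputCmd.exec env s4 := by
    simp only [program, resolveCmd, Cmd.exec.eq_2, hs4, hs3, hs2, hs1]
  rw [hfin]
  obtain ⟨later, h9, h10⟩ := h6.later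
  refine ⟨⟨h1, ?_, s3.queries, later, q5.trans h9, q3, h10⟩, fun j => ?_, ?_⟩
  · rw [F5.calls rfl, F4.calls rfl, F3.calls rfl, c2]
  · obtain ⟨b, h11, h12⟩ := h8 j
    rw [State.queried, q5]
    refine ⟨b, h11, h12.identifies ?_⟩
    by_contra! hno
    exact h7 j b ⟨h12, hno.1, hno.2⟩
  · rw [F5.draws rfl, F4.draws rfl, F3.draws rfl, F2.draws rfl, h2]

end HypOrient

namespace HypOrient

variable {n m : ℕ}

/-! ### Measurability in the precise weights -/

/-- Array indices, loop bounds and branches may depend on the weights, but range over countable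
types; splitting into countably many pieces reduces to fixed values. -/
theorem measurable_select {Ω ι β : Type*} [MeasurableSpace Ω] [Countable ι] [MeasurableSpace β]
    {c : Ω → ι} (hc : ∀ i, MeasurableSet {w | c w = i}) {f : ι → Ω → β}
    (hf : ∀ i, Measurable (f i)) : Measurable fun w => f (c w) w := by
  intro A hA
  have : (fun w => f (c w) w) ⁻¹' A = ⋃ i, {w | c w = i} ∩ f i ⁻¹' A := by
    ext w
    simp
  rw [this]
  exact MeasurableSet.iUnion fun i => (hc i).inter (hf i hA)

/-- All that is stored depends measurably on the precise weights. -/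
structure MeasurableState (S : (Fin n → ℝ) → State n) : Prop where
  nat : ∀ a i j, Measurable fun w => (S w).nat a i j
  real : ∀ a i j, Measurable fun w => (S w).real a i j
  draws : Measurable fun w => (S w).draws
  queries : ∀ l, MeasurableSet {w | (S w).queries = l}

namespace MeasurableState

variable {S : (Fin n → ℝ) → State n}

theorem const (s : State n) : MeasurableState fun _ => s :=
  ⟨fun _ _ _ => measurable_const, fun _ _ _ => measurable_const, measurable_const,
    fun _ => MeasurableSet.const _⟩

theorem select {ι : Type*} [Countable ι] {c : (Fin n → ℝ) → ι}
    (hc : ∀ i, MeasurableSet {w | c w = i}) {S : ι → (Fin n → ℝ) → State n}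
    (hS : ∀ i, MeasurableState (S i)) : MeasurableState fun w => S (c w) w := by
  refine ⟨fun a i j => measurable_select (f := fun t w => (S t w).nat a i j) hc
      fun t => (hS t).nat a i j,
    fun a i j => measurable_select (f := fun t w => (S t w).real a i j) hc
      fun t => (hS t).real a i j,
    measurable_select (f := fun t w => (S t w).draws) hc fun t => (hS t).draws, fun l => ?_⟩
  have : {w | (S (c w) w).queries = l} = ⋃ i, {w | c w = i} ∩ {w | (S i w).queries = l} := by
    ext w
    simp
  rw [this]
  exact MeasurableSet.iUnion fun i => (hc i).inter ((hS i).queries l)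

theorem measurableSet_nat_eq {c : (Fin n → ℝ) → ℕ} (hc : Measurable c) (i : ℕ) :
    MeasurableSet {w | c w = i} := hc (measurableSet_singleton i)

theorem eval_nat (h : MeasurableState S) (e : NExp) : Measurable fun w => e.eval (S w) := by
  induction e with
  | const k => exact measurable_const
  | cell a i j ihi ihj =>
    exact measurable_select (c := fun w => (i.eval (S w), j.eval (S w)))
      (f := fun t w => (S w).nat a t.1 t.2)
      (fun t => (ihi.prodMk ihj) (measurableSet_singleton t)) fun t => h.nat a t.1 t.2
  | add e f ihe ihf => exact ihe.add ihf
  | sub e f ihe ihf =>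
    exact (Measurable.of_discrete (f := fun t : ℕ × ℕ => t.1 - t.2)).comp (ihe.prodMk ihf)

theorem eval_real (h : MeasurableState S) (e : RExp) : Measurable fun w => e.eval (S w) := by
  induction e with
  | const k => exact measurable_const
  | cell a i j =>
    exact measurable_select (c := fun w => (i.eval (S w), j.eval (S w)))
      (f := fun t w => (S w).real a t.1 t.2)
      (fun t => ((h.eval_nat i).prodMk (h.eval_nat j)) (measurableSet_singleton t))
      fun t => h.real a t.1 t.2
  | add e f ihe ihf => exact ihe.add ihf
  | sub e f ihe ihf => exact ihe.sub ihf
  | mul e f ihe ihf => exact ihe.mul ihf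
  | div e f ihe ihf => exact ihe.div ihf

theorem eval_test (h : MeasurableState S) (b : Test) : MeasurableSet {w | b.eval (S w)} := by
  induction b with
  | natLE e f => exact measurableSet_le (h.eval_nat e) (h.eval_nat f)
  | realLE e f => exact measurableSet_le (h.eval_real e) (h.eval_real f)
  | neg b ih => exact ih.compl
  | both b c ihb ihc => exact ihb.inter ihc

theorem measurable_put {β : Type} [MeasurableSpace β] {f : (Fin n → ℝ) → ℕ → ℕ → ℕ → β}
    (hf : ∀ a i j, Measurable fun w => f w a i j) {i j : (Fin n → ℝ) → ℕ} (hi : Measurable i)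
    (hj : Measurable j) {y : (Fin n → ℝ) → β} (hy : Measurable y) (a a' i' j' : ℕ) :
    Measurable fun w => put (f w) a (i w) (j w) (y w) a' i' j' := by
  refine Measurable.ite ?_ hy (hf a' i' j')
  exact (MeasurableSet.const _).inter
    ((measurableSet_eq_fun measurable_const hi).inter (measurableSet_eq_fun measurable_const hj))

theorem ite (h : MeasurableState S) (b : Test) {P Q : (Fin n → ℝ) → State n}
    (hP : MeasurableState P) (hQ : MeasurableState Q) {S' : (Fin n → ℝ) → State n}
    (h1 : ∀ w, b.eval (S w) → S' w = P w) (h2 : ∀ w, ¬ b.eval (S w) → S' w = Q w) :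
    MeasurableState S' := by
  classical
  have hb := h.eval_test b
  have key := select (c := fun w => b.eval (S w)) (S := fun p w => if p then P w else Q w)
    (fun p => by
      by_cases hp : p
      · simpa [hp] using hb
      · have : {w | b.eval (S w) = p} = {w | b.eval (S w)}ᶜ := by
          ext w
          simp [hp]
        exact this ▸ hb.compl)
    (fun p => by
      by_cases hp : p
      · simpa [hp] using hP
      · simpa [hp] using hQ)
  convert key using 2 with w
  by_cases hw : b.eval (S w)
  · rw [if_pos hw, h1 w hw]
  · rw [if_neg hw, h2 w hw]

theorem tick (h : MeasurableState S) (t : ℕ) : MeasurableState fun w => (S w).tick t :=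
  ⟨h.nat, h.real, h.draws, h.queries⟩

theorem enter (h : MeasurableState S) (a t : ℕ) : MeasurableState fun w => (S w).enter a t :=
  ⟨measurable_put h.nat measurable_const measurable_const measurable_const a, h.real, h.draws,
    h.queries⟩

/-- Calls of the vertex cover procedure are excluded because the black box is an arbitrary function
of real inputs. The number of draws has to be tracked, since it determines which tape entry a sample
reads. -/
theorem exec (h : MeasurableState S) {p : Cmd} (hp : p.noCover = true) (tape : ℕ → Fin n → ℝ)
    (B : BlackBox n) : MeasurableState fun w => p.exec ⟨tape, w, B⟩ (S w) := by
  induction p generalizing S with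
  | skip => exact h
  | seq p q ihp ihq =>
    simp only [Cmd.noCover, Bool.and_eq_true] at hp
    exact ihq (ihp h hp.1) hp.2
  | setNat a i j e =>
    exact ⟨measurable_put h.nat (h.eval_nat i) (h.eval_nat j) (h.eval_nat e) a, h.real, h.draws,
      h.queries⟩
  | setReal a i j e =>
    exact ⟨h.nat, measurable_put h.real (h.eval_nat i) (h.eval_nat j) (h.eval_real e) a, h.draws,
      h.queries⟩
  | cond b p q ihp ihq =>
    simp only [Cmd.noCover, Bool.and_eq_true] at hp
    refine h.ite b (ihp (h.tick 1) hp.1) (ihq (h.tick 1) hp.2) (fun w hw => ?_) fun w hw => ?_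
    · rw [Cmd.exec, if_pos hw]
    · rw [Cmd.exec, if_neg hw]
  | loop a e p ih =>
    simp only [exec_loop]
    refine select (c := fun w => e.eval (S w))
      (S := fun N w => p.loopState ⟨tape, w, B⟩ a (S w) N)
      (fun N => measurableSet_nat_eq (h.eval_nat e) N) fun N => ?_
    induction N with
    | zero => exact h.tick 1
    | succ N ihN => exact ih (ihN.enter a N) hp
  | sample a i j v =>
    simp only [Cmd.exec]
    refine select (c := fun w => v.eval (S w)) (S := fun V w => if hV : V < n then
        { S w with
          real := put (S w).real a (i.eval (S w)) (j.eval (S w)) (tape (S w).draws ⟨V, hV⟩)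
          time := (S w).time + 1
          draws := (S w).draws + 1 } else (S w).tick 1)
      (fun V => measurableSet_nat_eq (h.eval_nat v) V) fun V => ?_
    by_cases hV : V < n
    · simp only [hV, dif_pos]
      refine ⟨h.nat, measurable_put h.real (h.eval_nat i) (h.eval_nat j) ?_ a, ?_, h.queries⟩
      · exact (Measurable.of_discrete (f := fun t : ℕ => tape t ⟨V, hV⟩)).comp h.draws
      · exact h.draws.add_const 1
    · simp only [hV, dif_neg, not_false_eq_true]
      exact h.tick 1
  | query a i j v =>
    simp only [Cmd.exec]
    refine select (c := fun w => v.eval (S w)) (S := fun V w => if hV : V < n then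
        { S w with
          real := put (S w).real a (i.eval (S w)) (j.eval (S w)) (w ⟨V, hV⟩)
          time := (S w).time + 1
          queries := (S w).queries ++ [⟨V, hV⟩] } else (S w).tick 1)
      (fun V => measurableSet_nat_eq (h.eval_nat v) V) fun V => ?_
    by_cases hV : V < n
    · simp only [hV, dif_pos]
      refine ⟨h.nat, measurable_put h.real (h.eval_nat i) (h.eval_nat j) (measurable_pi_apply _) a,
        h.draws, fun l => ?_⟩
      have : {w | (S w).queries ++ [⟨V, hV⟩] = l} =
          ⋃ l' ∈ {l' : List (Fin n) | l' ++ [⟨V, hV⟩] = l}, {w | (S w).queries = l'} := by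
        ext w
        simp
      exact this ▸ MeasurableSet.biUnion (Set.to_countable _) fun l' _ => h.queries l'
    · simp only [hV, dif_neg, not_false_eq_true]
      exact h.tick 1
  | cover _ _ _ _ => simp [Cmd.noCover] at hp

theorem queried (h : MeasurableState S) (Q : Finset (Fin n)) :
    MeasurableSet {w | (S w).queried = Q} := by
  have : {w | (S w).queried = Q} =
      ⋃ l ∈ {l : List (Fin n) | l.toFinset = Q}, {w | (S w).queries = l} := by
    ext w
    simp [State.queried]
  exact this ▸ MeasurableSet.biUnion (Set.to_countable _) fun l _ => h.queries l

end MeasurableState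

/-- Up to and including the call of the black box nothing is queried, so the state is constant in
the weights; the remainder makes no call. -/
theorem measurableSet_queried (s : State n) (tape : ℕ → Fin n → ℝ) (B : BlackBox n)
    (Q : Finset (Fin n)) :
    MeasurableSet {w : Fin n → ℝ | (program.exec ⟨tape, w, B⟩ s).queried = Q} := by
  have h := ((MeasurableState.const ((Cmd.seq planCmd (.cover 9 3 9 10)).exec
    ⟨tape, 0, B⟩ s)).exec (p := resolveCmd) rfl tape B).queried Q
  convert h using 5 with w
  rw [exec_congr_weight (w := 0) (w' := w) _ rfl]
  rfl

end HypOrient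

namespace HypOrient

variable {n m : ℕ}

/-! ### Polynomial running time -/

/-- `f n m k` is at most polynomial in `n` and `m`. -/
def IsPoly (f : ℕ → ℕ → ℕ → ℕ) : Prop := ∃ c, ∀ n m k, f n m k ≤ c * (n + m + 1) ^ c

/-- `f n m k` is at most polynomial in `n` and `m` times `k + 1`. -/
def IsPolyLinear (f : ℕ → ℕ → ℕ → ℕ) : Prop :=
  ∃ c, ∀ n m k, f n m k ≤ c * (n + m + 1) ^ c * (k + 1)

theorem IsPoly.const (c : ℕ) : IsPoly fun _ _ _ => c :=
  ⟨c, fun n m _ => Nat.le_mul_of_pos_right c (Nat.pow_pos (Nat.succ_pos (n + m)))⟩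

theorem IsPoly.add {f g : ℕ → ℕ → ℕ → ℕ} (hf : IsPoly f) (hg : IsPoly g) :
    IsPoly fun n m k => f n m k + g n m k := by
  obtain ⟨c, hc⟩ := hf
  obtain ⟨c', hc'⟩ := hg
  refine ⟨c + c', fun n m k => (Nat.add_le_add (hc n m k) (hc' n m k)).trans ?_⟩
  rw [add_mul]
  exact Nat.add_le_add
    (Nat.mul_le_mul_left c (Nat.pow_le_pow_right (Nat.succ_pos _) (Nat.le_add_right c c')))
    (Nat.mul_le_mul_left c' (Nat.pow_le_pow_right (Nat.succ_pos _) (Nat.le_add_left c' c)))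

theorem IsPoly.mul {f g : ℕ → ℕ → ℕ → ℕ} (hf : IsPoly f) (hg : IsPoly g) :
    IsPoly fun n m k => f n m k * g n m k := by
  obtain ⟨c, hc⟩ := hf
  obtain ⟨c', hc'⟩ := hg
  refine ⟨c * c' + (c + c'), fun n m k => (Nat.mul_le_mul (hc n m k) (hc' n m k)).trans ?_⟩
  rw [mul_mul_mul_comm, ← pow_add]
  exact Nat.mul_le_mul (Nat.le_add_right _ _)
    (Nat.pow_le_pow_right (Nat.succ_pos _) (Nat.le_add_left _ _))

theorem IsPoly.isPolyLinear {f : ℕ → ℕ → ℕ → ℕ} (hf : IsPoly f) : IsPolyLinear f :=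
  hf.imp fun _ hc n m k => (hc n m k).trans (Nat.le_mul_of_pos_right _ (Nat.succ_pos k))

theorem IsPolyLinear.add {f g : ℕ → ℕ → ℕ → ℕ} (hf : IsPolyLinear f) (hg : IsPolyLinear g) :
    IsPolyLinear fun n m k => f n m k + g n m k := by
  obtain ⟨c, hc⟩ := hf
  obtain ⟨c', hc'⟩ := hg
  refine ⟨c + c', fun n m k => (Nat.add_le_add (hc n m k) (hc' n m k)).trans ?_⟩
  rw [← add_mul, add_mul c c']
  exact Nat.mul_le_mul_right _ (Nat.add_le_add
    (Nat.mul_le_mul_left c (Nat.pow_le_pow_right (Nat.succ_pos _) (Nat.le_add_right c c')))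
    (Nat.mul_le_mul_left c' (Nat.pow_le_pow_right (Nat.succ_pos _) (Nat.le_add_left c' c))))

theorem IsPoly.mul_linear {f g : ℕ → ℕ → ℕ → ℕ} (hf : IsPoly f) (hg : IsPolyLinear g) :
    IsPolyLinear fun n m k => f n m k * g n m k := by
  obtain ⟨c, hc⟩ := hf
  obtain ⟨c', hc'⟩ := hg
  refine ⟨c * c' + (c + c'), fun n m k => (Nat.mul_le_mul (hc n m k) (hc' n m k)).trans ?_⟩
  rw [← mul_assoc, mul_mul_mul_comm, ← pow_add]
  exact Nat.mul_le_mul_right _ (Nat.mul_le_mul (Nat.le_add_right _ _)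
    (Nat.pow_le_pow_right (Nat.succ_pos _) (Nat.le_add_left _ _)))

theorem isPolyLinear_samples : IsPolyLinear fun _ _ k => k :=
  ⟨1, fun n m k => by
    have : 1 ≤ (n + m + 1) ^ 1 := Nat.succ_le_of_lt (Nat.pow_pos (Nat.succ_pos _))
    nlinarith⟩

theorem IsPolyLinear.mul {f g : ℕ → ℕ → ℕ → ℕ} (hf : IsPolyLinear f) (hg : IsPoly g) :
    IsPolyLinear fun n m k => f n m k * g n m k := by
  simpa only [mul_comm] using hg.mul_linear hf

/-- The content of natural array `0`. -/
def dims (n m k i j : ℕ) : ℕ :=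
  if j = 0 then (if i = 0 then n else if i = 1 then m else if i = 2 then k else 0) else 0

theorem Instance.start_dims (I : Instance n m) (k : ℕ) (d : ℝ) :
    (I.start k d).nat 0 = dims n m k := by
  funext i j
  simp [Instance.start, dims]

/-- The expression is a sum of constants and numbers of vertices and hyperedges. -/
def NExp.small : NExp → Bool
  | .const _ => true
  | .cell 0 (.const 0) _ => true
  | .cell 0 (.const 1) _ => true
  | .add e f => e.small && f.small
  | _ => false

theorem NExp.small_isPoly {e : NExp} (h : e.small = true) :
    IsPoly fun n m k => e.val (dims n m k) := by
  induction e using NExp.small.induct with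
  | case1 c => exact IsPoly.const c
  | case2 j =>
    refine ⟨1, fun n m k => ?_⟩
    simp only [NExp.val, dims, pow_one]
    split_ifs <;> omega
  | case3 j =>
    refine ⟨1, fun n m k => ?_⟩
    simp only [NExp.val, dims, pow_one]
    split_ifs <;> omega
  | case4 e f ihe ihf =>
    simp only [NExp.small, Bool.and_eq_true] at h
    exact (ihe h.1).add (ihf h.2)
  | case5 e h1 h2 h3 h4 => simp [NExp.small] at h

/-- The numbers of passes of all loops depend only on the numbers of vertices and hyperedges. -/
def Cmd.short : Cmd → Bool
  | .seq p q => p.short && q.short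
  | .cond _ p q => p.short && q.short
  | .loop _ e p => e.small && p.short
  | _ => true

theorem Cmd.short_isPoly {p : Cmd} (h : p.short = true) :
    IsPoly fun n m k => p.cost (dims n m k) := by
  induction p with
  | skip => exact IsPoly.const 0
  | seq p q ihp ihq =>
    simp only [Cmd.short, Bool.and_eq_true] at h
    exact (ihp h.1).add (ihq h.2)
  | cond b p q ihp ihq =>
    simp only [Cmd.short, Bool.and_eq_true] at h
    exact ((IsPoly.const 1).add (ihp h.1)).add (ihq h.2)
  | loop a e p ih =>
    simp only [Cmd.short, Bool.and_eq_true] at h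
    exact (IsPoly.const 1).add ((NExp.small_isPoly h.1).mul ((IsPoly.const 1).add (ih h.2)))
  | _ => exact IsPoly.const 1

/-- Loops over the samples are not nested. -/
def Cmd.linear : Cmd → Bool
  | .seq p q => p.linear && q.linear
  | .cond _ p q => p.linear && q.linear
  | .loop _ (.cell 0 (.const 2) (.const 0)) p => p.short
  | .loop _ e p => e.small && p.linear
  | _ => true

/-- A loop over the samples has a body whose cost is polynomial in `n` and `m` uniformly in `k`, and
all surrounding loops multiply by such polynomials, so `k` enters to the first power only. -/
theorem Cmd.linear_isPolyLinear {p : Cmd} (h : p.linear = true) :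
    IsPolyLinear fun n m k => p.cost (dims n m k) := by
  induction p using Cmd.linear.induct with
  | case1 p q ihp ihq =>
    simp only [Cmd.linear, Bool.and_eq_true] at h
    exact (ihp h.1).add (ihq h.2)
  | case2 b p q ihp ihq =>
    simp only [Cmd.linear, Bool.and_eq_true] at h
    exact ((IsPoly.const 1).isPolyLinear.add (ihp h.1)).add (ihq h.2)
  | case3 a p =>
    simp only [Cmd.linear] at h
    exact (IsPoly.const 1).isPolyLinear.add
      (isPolyLinear_samples.mul ((IsPoly.const 1).add (Cmd.short_isPoly h)))
  | case4 a e p h1 ih =>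
    simp only [Cmd.linear, Bool.and_eq_true] at h
    exact (IsPoly.const 1).isPolyLinear.add ((NExp.small_isPoly h.1).mul_linear
      ((IsPoly.const 1).isPolyLinear.add (ih h.2)))
  | case5 p h1 h2 h3 h4 =>
    cases p with
    | seq p q => exact absurd rfl (h1 p q)
    | cond b p q => exact absurd rfl (h2 b p q)
    | loop a e p => exact absurd rfl (h4 a e p)
    | skip => exact (IsPoly.const 0).isPolyLinear
    | _ => exact (IsPoly.const 1).isPolyLinear

theorem program_time : ∃ C : ℕ, ∀ (n m : ℕ) (I : Instance n m) (k : ℕ) (d : ℝ) (env : Env n),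
    (program.exec env (I.start k d)).time ≤ C * (n + m + 1) ^ C * (k + 1) +
      env.box.time (I.coverInput (levelSet (overThreshold d (I.estimate k env.tape))ᶜ
        (I.solution k d env) (1 / 2))) := by
  have hsq : IsPoly fun n _ _ => n ^ 2 + 1 := ⟨2, fun n m _ => by
    show n ^ 2 + 1 ≤ _
    nlinarith [Nat.zero_le (n * m), Nat.zero_le (m ^ 2)]⟩
  obtain ⟨C, hC⟩ := ((Cmd.linear_isPolyLinear (p := planCmd) rfl).add hsq.isPolyLinear).add
    (Cmd.linear_isPolyLinear (p := resolveCmd) rfl)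
  refine ⟨C, fun n m I k d env => ?_⟩
  -- This identifies the input of the call, so that its time is that of the black box on the
  -- half-integral subgraph.
  have hcov := (planCmd_spec I k d env).2.2.2.1
  have h1 := time_le env (dims n m k) planCmd rfl rfl (I.start k d) (I.start_dims k d)
  have F1 := frame env planCmd (I.start k d)
  set s1 := planCmd.exec env (I.start k d) with hs1
  have h2 : ((Cmd.cover 9 3 9 10).exec env s1).time = s1.time + (n ^ 2 + 1) +
      env.box.time (s1.coverInput 9 3 9) := rfl
  have F2 := frame env (.cover 9 3 9 10) s1
  have h3 := time_le env (dims n m k) resolveCmd rfl rfl ((Cmd.cover 9 3 9 10).exec env s1)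
    (by rw [F2.nat 0 rfl, F1.nat 0 rfl, I.start_dims])
  rw [show program.exec env (I.start k d) =
    resolveCmd.exec env ((Cmd.cover 9 3 9 10).exec env s1) from rfl]
  rw [show s1.coverInput 9 3 9 = _ from hcov] at h2
  have h0 : (I.start k d).time = 0 := rfl
  have h4 : _ + _ + _ ≤ _ := hC n m k
  omega

end HypOrient
end

/-! ### Conclusion -/

theorem theorem3p2 :
    ∃ (P : HypOrient.Cmd) (C : ℕ),
      ∀ (n m : ℕ) (I : HypOrient.Instance n m), I.Preprocessed →
      ∀ α ε δ : ℝ, 1 ≤ α → α ≤ 2 → 0 < ε → 0 < δ → δ < 1 →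
      ∀ B : HypOrient.BlackBox n,
        (∀ S : Finset (Fin n), (I.coverInput S).IsApproxCover α (B.answer (I.coverInput S))) →
      let R := HypOrient.ratio α ε
      let d := 1 / R + ε
      let k := HypOrient.sampleCount n ε δ
      let final : (ℕ → Fin n → ℝ) → (Fin n → ℝ) → HypOrient.State n :=
        fun ω w => P.exec ⟨ω, w, B⟩ (I.start k d)
      ∃ Y x : (ℕ → Fin n → ℝ) → Fin n → ℝ,
        -- on every run: the algorithm, its correctness and its running time
        (∀ ω w, I.Realization w →
          I.IsThresholdRun B d (Y ω) (x ω) w (final ω w) ∧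
          I.Solved w (final ω w) ∧
          (final ω w).draws ≤ n * n * k ∧
          (final ω w).time ≤ C * (n + m + 1) ^ C * (k + 1) +
            B.time (I.coverInput
              (HypOrient.levelSet (HypOrient.overThreshold d (Y ω))ᶜ (x ω) (1 / 2)))) ∧
        -- with probability at least `1 - δ` over the samples: the competitive ratio
        ∃ A : Set (ℕ → Fin n → ℝ), MeasurableSet A ∧ 1 - δ ≤ I.tapeLaw.real A ∧
          ∀ ω ∈ A,
            (∀ v, |Y ω v - I.mandatoryProb v| ≤ ε) ∧
            MeasureTheory.Integrable I.opt I.weightLaw ∧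
            MeasureTheory.Integrable (fun w => I.setCost (final ω w).queried) I.weightLaw ∧
            ∫ w, I.setCost (final ω w).queried ∂I.weightLaw ≤
              R * ∫ w, I.opt w ∂I.weightLaw := by
  obtain ⟨C, hC⟩ := HypOrient.program_time
  refine ⟨HypOrient.program, C, ?_⟩
  intro n m I hI α ε δ h1 h2 hε hδ hδ' B hB R d k final
  set x : (ℕ → Fin n → ℝ) → Fin n → ℝ := fun ω => I.solution k d ⟨ω, 0, B⟩ with hx
  have hxw : ∀ ω w, I.solution k d ⟨ω, w, B⟩ = x ω := fun ω w => by
    funext v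
    simp only [hx, HypOrient.Instance.solution]
    rw [HypOrient.exec_congr_weight (w := w) (w' := 0) _ rfl]
  have hrun : ∀ ω w, I.Realization w →
      I.IsThresholdRun B d (I.estimate k ω) (x ω) w (final ω w) ∧ I.Solved w (final ω w) ∧
        (final ω w).draws = n * k * n := fun ω w hw => by
    rw [← hxw ω w]
    exact HypOrient.program_spec hI k d (env := ⟨ω, w, B⟩) hw fun S => (hB S).1
  refine ⟨I.estimate k, x, fun ω w hw => ?_, ?_⟩
  · obtain ⟨h3, h4, h5⟩ := hrun ω w hw
    refine ⟨h3, h4, h5.le.trans (le_of_eq (by ring)), ?_⟩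
    have := hC n m I k d ⟨ω, w, B⟩
    rw [hxw] at this
    exact this
  · obtain ⟨hA, hA'⟩ := I.estimates_close hε hδ hδ' (k := k) rfl
    refine ⟨_, hA, hA', fun ω hω => ⟨hω, HypOrient.Instance.integrable_opt, ?_⟩⟩
    have hopt : I.IsHalfIntegralOptimum (HypOrient.overThreshold d (I.estimate k ω))ᶜ (x ω) :=
      (HypOrient.planCmd_spec I k d ⟨ω, 0, B⟩).1
    refine HypOrient.Instance.expected_cost_le h1 h2 hε hω hopt (hB _)
      (alg := fun w => (final ω w).queried)
      (fun Q => HypOrient.measurableSet_queried _ ω B Q) fun w hw v hv => ?_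
    obtain ⟨⟨-, -, first, later, h3, h4, h5⟩, -⟩ := hrun ω w hw
    rw [HypOrient.State.queried, h3, List.toFinset_append, Finset.mem_union] at hv
    rcases hv with hv | hv
    · rw [h4] at hv
      exact Or.inl hv
    -- A later query is mandatory for all consistent weights, in particular for `w` itself.
    · obtain ⟨before, after, h6⟩ := List.append_of_mem (List.mem_toFinset.1 hv)
      exact Or.inr (h5 before v after h6 w (HypOrient.Instance.consistent_self hw _))
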